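/- **Setting.** Fix $d_X,d_Y\in\mathbb N=\{1,2,\dots\}$, $s_X,s_Y,A,R_0>0$, and $\alpha,\beta\in(0,1)$ with $\alpha+\beta<1$. Put $d:=d_X+d_Y$ and $s:=d/(d_X/s_X+d_Y/s_Y)$. Let $(\mathcal X,\mu_X)$, $(\mathcal Y,\mu_Y)$ be $\sigma$-finite measure spaces, $\mu:=\mu_X\otimes\mu_Y$, and let $(p^X_j)_{j\in\mathbb N_0^{d_X}}$, $(p^Y_k)_{k\in\mathbb N_0^{d_Y}}$ be (measurable) orthonormal bases of $L^2(\mu_X)$, $L^2(\mu_Y)$; write $p_{jk}(x,y)=p^X_j(x)p^Y_k(y)$. For a probability density $f\in L^2(\mu)$ with marginal densities $f_X,f_Y$ let $D(f):=\int (f(x,y)-f_X(x)f_Y(y))^2\,d\mu(x,y)$, $a_{jk}:=\int f p_{jk}\,d\mu$, $a_{j\bullet}:=\int f_Xp^X_j\,d\mu_X$, $a_{\bullet k}:=\int f_Yp^Y_k\,d\mu_Y$, and $S_\theta(f):=\sum_{j,k}\theta_{jk}^2(a_{jk}-a_{j\bullet}a_{\bullet k})^2$ (with $\infty\cdot 0=0$),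 where $\theta_{jk}:=\|j\|_1^{s_X}\vee\|k\|_1^{s_Y}$ if $j\ne0$ and $k\neq 0$, and $\theta_{jk}:=\infty$ otherwise. For $r,\rho>0$ let $\mathcal F_{(\theta,r,A)}(\rho)$ be the set of probability densities $f\in L^2(\mu)$ with $D(f)\ge\rho^2$, $S_\theta(f)\le r^2$ and $\max(\|f\|_\infty,\|f_X\|_\infty,\|f_Y\|_\infty)\le A$. **USP test.** For a finite $\mathcal M\subset\mathbb N_0^{d_X}\times\mathbb N_0^{d_Y}$ and data $z=((x_i,y_i))_{i\in[n]}$, $n\ge4$, let $$\hat D_n^{\mathcal M}(z):=\frac1{4!\binom n4}\sum_{(i_1,\dots,i_4)\text{ distinct}}h\bigl((x_{i_1},y_{i_1}),\dots,(x_{i_4},y_{i_4})\bigr),$$ $$h\bigl((x_1,y_1),\dots,(x_4,y_4)\bigr):=\sum_{(j,k)\in\mathcal M}\{p_{jk}(x_1,y_1)p_{jk}(x_2,y_2)-2p_{jk}(x_1,y_1)p_{jk}(x_2,y_3)+p_{jk}(x_1,y_2)p_{jk}(x_3,y_4)\}.$$ With $\Pi_1,\dots,\Pi_B$ independent uniform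 permutations of $[n]$, independent of the data, and $z^{(\sigma)}:=((x_i,y_{\sigma(i)}))_{i\in[n]}$, the p-value is $$P:=\frac{1+\sum_{b=1}^B\mathbf 1\{\hat D_n^{\mathcal M}(z)\le\hat D_n^{\mathcal M}(z^{(\Pi_b)})\}}{1+B}.$$ **Adaptive test.** Let $\gamma_X:=\lceil(2/d_X)\log_2n\rceil$, $K_X:=\{2^l:l\in[\gamma_X]\}$, and define $\gamma_Y,K_Y$ similarly. For each $(m_X,m_Y)\in K_X\times K_Y$ compute the p-value $p^{(m_X,m_Y)}$ with $\mathcal M=\{(j,k):1\le\|j\|_1\le m_X,\ 1\le\|k\|_1\le m_Y\}$ and some number $B\ge2\bigl(\frac{\gamma_X\gamma_Y}{\alpha\beta}-1\bigr)$ of permutations ($B$ may differ between the tests, and the permutations of different tests may be dependent in any way, e.g. shared). Reject $H_0$ (independence) if $\min_{(m_X,m_Y)}p^{(m_X,m_Y)}<\alpha/(\gamma_X\gamma_Y)$. **Proposition.** There exists $C>0$, depending only on $\alpha,\beta,R_0,s_X,s_Y,d_X,d_Y,A$, such that the following hold for all such spaces and bases and every such test. 1. (Level.) For every $n\ge4$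 the test has level $\alpha$: for i.i.d. data $(X_i,Y_i)$, $i\in[n]$, from any distribution on $\mathcal X\times\mathcal Y$ under which $X$ and $Y$ are independent, $H_0$ is rejected with probability at most $\alpha$. 2. (Power.) If $n\ge \max(C,4)$, $0<r\le R_0$, $\rho>0$ and $$\rho\ \ge\ C\Bigl\{\frac{r^d}{(n/\log n)^{2s}}\Bigr\}^{1/(4s+d)},$$ then for every $f\in\mathcal F_{(\theta,r,A)}(\rho)$, on i.i.d. data with density $f$ the test rejects $H_0$ with probability at least $1-\beta$. The test does not depend on $s_X,s_Y,r,A$ or $\rho$. -/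

import Mathlib

open MeasureTheory ProbabilityTheory
open scoped ENNReal

namespace USP

noncomputable section

/-! Orthonormal bases, coefficients and the measure of dependence -/

/-- The measurable functions `p i : Z → ℝ` represent an orthonormal (Hilbert) basis of `L²(ν)`. -/
structure IsL2Basis {Z ι : Type*} [MeasurableSpace Z] (ν : Measure Z) (p : ι → Z → ℝ) : Prop where
  measurable : ∀ i, Measurable (p i)
  exists_basis : ∃ b : HilbertBasis ι ℝ (Lp ℝ 2 ν), ∀ i, (b i : Z → ℝ) =ᵐ[ν] p i

/-- The supremum norm (a genuine supremum over all points). -/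
def supNorm {Z : Type*} (f : Z → ℝ) : ℝ≥0∞ := ⨆ z, ‖f z‖ₑ

section Functionals

variable {𝒳 𝒴 ι κ : Type*} [MeasurableSpace 𝒳] [MeasurableSpace 𝒴]

/-- `f` is a square-integrable probability density with respect to `μX ⊗ μY`. -/
structure IsDensity (μX : Measure 𝒳) (μY : Measure 𝒴) (f : 𝒳 × 𝒴 → ℝ) : Prop where
  memLp : MemLp f 2 (μX.prod μY)
  nonneg : ∀ᵐ z ∂(μX.prod μY), 0 ≤ f z
  integral_eq_one : ∫ z, f z ∂(μX.prod μY) = 1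

/-- Marginal density of the first coordinate. -/
def margX (μY : Measure 𝒴) (f : 𝒳 × 𝒴 → ℝ) (x : 𝒳) : ℝ := ∫ y, f (x, y) ∂μY

/-- Marginal density of the second coordinate. -/
def margY (μX : Measure 𝒳) (f : 𝒳 × 𝒴 → ℝ) (y : 𝒴) : ℝ := ∫ x, f (x, y) ∂μX

/-- The law on `𝒳 × 𝒴` with density `f`. -/
def law (μX : Measure 𝒳) (μY : Measure 𝒴) (f : 𝒳 × 𝒴 → ℝ) : Measure (𝒳 × 𝒴) :=
  (μX.prod μY).withDensity fun z => ENNReal.ofReal (f z)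

/-- `D(f)`, the squared `L²` distance between `f` and the product of its marginals. -/
def dep (μX : Measure 𝒳) (μY : Measure 𝒴) (f : 𝒳 × 𝒴 → ℝ) : ℝ :=
  ∫ z, (f z - margX μY f z.1 * margY μX f z.2) ^ 2 ∂(μX.prod μY)

/-- The coefficient `a_{jk}(f)`. -/
def coeff (μX : Measure 𝒳) (μY : Measure 𝒴) (pX : ι → 𝒳 → ℝ) (pY : κ → 𝒴 → ℝ)
    (f : 𝒳 × 𝒴 → ℝ) (j : ι) (k : κ) : ℝ :=
  ∫ z, f z * (pX j z.1 * pY k z.2) ∂(μX.prod μY)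

/-- The coefficient `a_{j•}(f)`. -/
def coeffX (μX : Measure 𝒳) (μY : Measure 𝒴) (pX : ι → 𝒳 → ℝ) (f : 𝒳 × 𝒴 → ℝ) (j : ι) : ℝ :=
  ∫ x, margX μY f x * pX j x ∂μX

/-- The coefficient `a_{•k}(f)`. -/
def coeffY (μX : Measure 𝒳) (μY : Measure 𝒴) (pY : κ → 𝒴 → ℝ) (f : 𝒳 × 𝒴 → ℝ) (k : κ) : ℝ :=
  ∫ y, margY μX f y * pY k y ∂μY

/-- `S_θ(f) = ∑_{j,k} θ_{jk}² (a_{jk} - a_{j•} a_{•k})²`, with values in `[0, ∞]`; as usual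
`∞ * 0 = 0`, so an infinite weight forces the coefficient to vanish when the sum is finite. -/
def smoothness (μX : Measure 𝒳) (μY : Measure 𝒴) (pX : ι → 𝒳 → ℝ) (pY : κ → 𝒴 → ℝ)
    (θ : ι → κ → ℝ≥0∞) (f : 𝒳 × 𝒴 → ℝ) : ℝ≥0∞ :=
  ∑' j, ∑' k, θ j k ^ 2 * ENNReal.ofReal
    ((coeff μX μY pX pY f j k - coeffX μX μY pX f j * coeffY μX μY pY f k) ^ 2)

/-- The class of alternatives `F_ξ(ρ)`, `ξ = (θ, r, A)`. -/
def alternatives (μX : Measure 𝒳) (μY : Measure 𝒴) (pX : ι → 𝒳 → ℝ) (pY : κ → 𝒴 → ℝ)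
    (θ : ι → κ → ℝ≥0∞) (r A ρ : ℝ) : Set (𝒳 × 𝒴 → ℝ) :=
  {f | IsDensity μX μY f ∧ ρ ^ 2 ≤ dep μX μY f ∧
    smoothness μX μY pX pY θ f ≤ ENNReal.ofReal (r ^ 2) ∧
    supNorm f ≤ ENNReal.ofReal A ∧ supNorm (margX μY f) ≤ ENNReal.ofReal A ∧
    supNorm (margY μX f) ≤ ENNReal.ofReal A}

/-- `Ψ(α)`: measurable randomised tests, based on `n` observations, whose rejection probability
is at most `α` for i.i.d. data from any law under which the two coordinates are independent. -/
structure IsValidTest {n : ℕ} (α : ℝ) (ψ : (Fin n → 𝒳 × 𝒴) → ℝ≥0∞) : Prop where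
  measurable : Measurable ψ
  le_one : ∀ z, ψ z ≤ 1
  level : ∀ P : Measure (𝒳 × 𝒴), IsProbabilityMeasure P → IndepFun Prod.fst Prod.snd P →
    ∫⁻ z, ψ z ∂(Measure.pi fun _ : Fin n => P) ≤ ENNReal.ofReal α

end Functionals

/-! The permutation test -/

section PermutationTest

variable {𝒳 𝒴 ι κ : Type*}

/-- The kernel `h` with truncation set `M`. -/
def kernelH (pX : ι → 𝒳 → ℝ) (pY : κ → 𝒴 → ℝ) (M : Finset (ι × κ)) (z₁ z₂ z₃ z₄ : 𝒳 × 𝒴) : ℝ :=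
  ∑ q ∈ M,
    ((pX q.1 z₁.1 * pY q.2 z₁.2) * (pX q.1 z₂.1 * pY q.2 z₂.2)
      - 2 * (pX q.1 z₁.1 * pY q.2 z₁.2) * (pX q.1 z₂.1 * pY q.2 z₃.2)
      + (pX q.1 z₁.1 * pY q.2 z₂.2) * (pX q.1 z₃.1 * pY q.2 z₄.2))

/-- The `U`-statistic: the average of `h` over ordered 4-tuples of distinct indices. -/
def Dhat {n : ℕ} (pX : ι → 𝒳 → ℝ) (pY : κ → 𝒴 → ℝ) (M : Finset (ι × κ))
    (z : Fin n → 𝒳 × 𝒴) : ℝ :=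
  (1 / ((Nat.factorial 4 : ℝ) * (n.choose 4 : ℝ))) *
    ∑ i : Fin 4 ↪ Fin n, kernelH pX pY M (z (i 0)) (z (i 1)) (z (i 2)) (z (i 3))

/-- The data set `(x_i, y_{σ(i)})`. -/
def permuteData {n : ℕ} (σ : Equiv.Perm (Fin n)) (z : Fin n → 𝒳 × 𝒴) : Fin n → 𝒳 × 𝒴 :=
  fun i => ((z i).1, (z (σ i)).2)

/-- The permutation p-value computed from the permutations `π 0, …, π (B - 1)`. -/
def pValue {n B : ℕ} (pX : ι → 𝒳 → ℝ) (pY : κ → 𝒴 → ℝ) (M : Finset (ι × κ))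
    (z : Fin n → 𝒳 × 𝒴) (π : Fin B → Equiv.Perm (Fin n)) : ℝ :=
  (1 + ∑ b, if Dhat pX pY M z ≤ Dhat pX pY M (permuteData (π b) z) then (1 : ℝ) else 0) /
    (1 + (B : ℝ))

end PermutationTest

/-! The Sobolev setting and the adaptive test -/

/-- The `ℓ¹` norm of a multi-index. -/
def norm1 {d : ℕ} (j : Fin d → ℕ) : ℕ := ∑ i, j i

/-- The multi-indices `j` with `1 ≤ ‖j‖₁ ≤ m`. -/
def multiIndices (d m : ℕ) : Finset (Fin d → ℕ) :=
  (Finset.Icc 0 fun _ => m).filter fun j => 1 ≤ norm1 j ∧ norm1 j ≤ m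

theorem mem_multiIndices {d m : ℕ} {j : Fin d → ℕ} :
    j ∈ multiIndices d m ↔ 1 ≤ norm1 j ∧ norm1 j ≤ m := by
  simp only [multiIndices, Finset.mem_filter, Finset.mem_Icc, and_iff_right_iff_imp]
  rintro ⟨-, h⟩
  refine ⟨fun i => Nat.zero_le _, fun i => le_trans ?_ h⟩
  exact Finset.single_le_sum (f := j) (fun _ _ => Nat.zero_le _) (Finset.mem_univ i)

/-- The Sobolev weights `θ_{jk} = ‖j‖₁^{sX} ∨ ‖k‖₁^{sY}` for `j, k ≠ 0`, and `∞` otherwise. -/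
def sobolevWeight {dX dY : ℕ} (sX sY : ℝ) (j : Fin dX → ℕ) (k : Fin dY → ℕ) : ℝ≥0∞ :=
  if j ≠ 0 ∧ k ≠ 0 then
    ENNReal.ofReal (max ((norm1 j : ℝ) ^ sX) ((norm1 k : ℝ) ^ sY))
  else ⊤

/-- `⌈(2/d) log₂ n⌉`, the number of dyadic truncation levels `2, 4, …` that are used. -/
def numLevels (d n : ℕ) : ℕ := ⌈(2 / (d : ℝ)) * Real.logb 2 n⌉₊

/-- The truncation set `M_{mX,mY}` with `mX = 2^{q₁+1}` and `mY = 2^{q₂+1}`. -/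
def truncation {dX dY n : ℕ} (q : Fin (numLevels dX n) × Fin (numLevels dY n)) :
    Finset ((Fin dX → ℕ) × (Fin dY → ℕ)) :=
  multiIndices dX (2 ^ ((q.1 : ℕ) + 1)) ×ˢ multiIndices dY (2 ^ ((q.2 : ℕ) + 1))

/-- A choice of `B q` permutations of `{1, …, n}` for every pair `q` of truncation levels. -/
abbrev PermFamily {dX dY n : ℕ} (B : Fin (numLevels dX n) × Fin (numLevels dY n) → ℕ) : Type :=
  ∀ q, Fin (B q) → Equiv.Perm (Fin n)

/-- For each pair `q` of levels, the permutations `Π_1, …, Π_{B q}` of the test number `q` are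
independent and uniformly distributed. The joint law for different `q` is arbitrary: the tests may
use independent permutations or share them. -/
def HasUniformPerms {dX dY n : ℕ} {B : Fin (numLevels dX n) × Fin (numLevels dY n) → ℕ}
    (Q : PMF (PermFamily B)) : Prop :=
  ∀ q, Q.map (fun π => π q) = PMF.uniformOfFintype (Fin (B q) → Equiv.Perm (Fin n))

/-- The Bonferroni-combined test: the conditional probability, given the data `z`, that the
smallest of the p-values is less than `α` divided by the number of tests, the permutations being
drawn from `Q` independently of the data. -/
def adaptiveTest {𝒳 𝒴 : Type*} {dX dY n : ℕ} (pX : (Fin dX → ℕ) → 𝒳 → ℝ)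
    (pY : (Fin dY → ℕ) → 𝒴 → ℝ) (α : ℝ)
    (B : Fin (numLevels dX n) × Fin (numLevels dY n) → ℕ) (Q : PMF (PermFamily B))
    (z : Fin n → 𝒳 × 𝒴) : ℝ≥0∞ :=
  Q.toOuterMeasure {π | ∃ q, pValue pX pY (truncation q) z (π q) <
    α / ((numLevels dX n : ℝ) * (numLevels dY n : ℝ))}

/-- The overall smoothness `s = d / (dX / sX + dY / sY)`, where `d = dX + dY`. -/
def effSmoothness (dX dY : ℕ) (sX sY : ℝ) : ℝ :=
  ((dX : ℝ) + dY) / ((dX : ℝ) / sX + (dY : ℝ) / sY)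

/-- The adaptive separation rate `{r^d / (n / log n)^{2s}}^{1/(4s+d)}`. -/
def adaptiveRate (dX dY : ℕ) (sX sY r : ℝ) (n : ℕ) : ℝ :=
  (r ^ (dX + dY) / ((n : ℝ) / Real.log n) ^ (2 * effSmoothness dX dY sX sY)) ^
    (1 / (4 * effSmoothness dX dY sX sY + ((dX : ℝ) + dY)))

end

end USP

namespace USP

/-! ### Averages over permutations -/

section PermutationAverages

open Finset
open scoped BigOperators

/-! Level. Under independence the law of the sample is invariant under permuting the second
coordinates, so the statistic of the data and those of the permuted data have exchangeable ranks and
every single p-value is conservative (`lintegral_expect_pValue_lt_le`). A union bound over the grid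
of truncation levels then needs nothing about the joint law of the permutations.

Power. By Parseval (`tsum_covCoeff_sq`), `dep` is the sum of the squared covariances of p_j(X) and
p_k(Y). For one truncation set of size N, write D for the truncated sum. The statistic is an average
of products of two elementary covariance estimators, each built from two observations
(`Dhat_eq_expect`). It is also an average over relabellings of sums over m × m pairs of disjoint
blocks, with m = n/4 rounded down. In such a sum the fluctuation around D splits into orthogonal
families: two linear ones and an interaction. This gives a variance of order D/m + N/m²
(`IsDominated.integral_sq_Dhat_sub_le`). For permuted data, exchanging two second coordinates flips
the sign of one estimator, so different block pairs are orthogonal under the random permutation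
itself; the second moment is of order N/m² for every law, dependent or not
(`IsDominated.integral_expect_sq_Dhat_permuteData_le`).

Chebyshev on the event that the statistic is below D/2, and Markov on the number of permuted
statistics above D/2, bound the type II error (`one_sub_le_expect_pValue`). The Bonferroni threshold
α/γ, with γ of order (log n)², multiplies only the permutation term; this is the source of n/log n
in the rate.

Finally the truncation is chosen by T = √2 r/ρ: the smoothness constraint leaves a tail of at most
ρ²/2, so D ≥ ρ²/2, while some dyadic level of the grid has N of order T^(d/s). Inserting this in the
moment bounds reproduces exactly the separation rate (`error_budget`). -/

/-- The symmetric group acts transitively on embeddings, so the left side does not depend on `ι`.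
Averaging it over all `ι` and exchanging the two averages gives the right side. -/
theorem expect_perm_trans {α : Type*} [Fintype α] [DecidableEq α] {k : ℕ} (ι : Fin k ↪ α)
    (F : (Fin k ↪ α) → ℝ) :
    𝔼 σ : Equiv.Perm α, F (ι.trans σ.toEmbedding) = 𝔼 i, F i := by
  have : Nonempty (Fin k ↪ α) := ⟨ι⟩
  have key : ∀ ι' : Fin k ↪ α, 𝔼 σ : Equiv.Perm α, F (ι.trans σ.toEmbedding) =
      𝔼 σ : Equiv.Perm α, F (ι'.trans σ.toEmbedding) := by
    intro ι'
    have := Equiv.Perm.isMultiplyPretransitive α k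
    obtain ⟨g, hg⟩ := MulAction.exists_smul_eq (Equiv.Perm α) ι' ι
    refine Fintype.expect_equiv (Equiv.mulRight g) _ _ fun σ => ?_
    rw [← hg]
    rfl
  calc 𝔼 σ : Equiv.Perm α, F (ι.trans σ.toEmbedding)
      = 𝔼 ι' : Fin k ↪ α, 𝔼 σ : Equiv.Perm α, F (ι'.trans σ.toEmbedding) := by
        rw [← Fintype.expect_const (ι := Fin k ↪ α)
          (𝔼 σ : Equiv.Perm α, F (ι.trans σ.toEmbedding))]
        exact expect_congr rfl fun ι' _ => key ι'
    _ = 𝔼 σ : Equiv.Perm α, 𝔼 ι' : Fin k ↪ α, F (ι'.trans σ.toEmbedding) := expect_comm _ _ _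
    _ = 𝔼 σ : Equiv.Perm α, 𝔼 i, F i := by
        refine expect_congr rfl fun σ _ => ?_
        exact Fintype.expect_equiv (Equiv.embeddingCongr (Equiv.refl _) σ) _ _ fun i => rfl
    _ = 𝔼 i, F i := Fintype.expect_const _

theorem sq_expect_le {ι : Type*} [Fintype ι] (f : ι → ℝ) : (𝔼 i, f i) ^ 2 ≤ 𝔼 i, f i ^ 2 := by
  rw [Fintype.expect_eq_sum_div_card, Fintype.expect_eq_sum_div_card, div_pow]
  rcases isEmpty_or_nonempty ι with h | h
  · simp
  have hc : (0 : ℝ) < Fintype.card ι := by exact_mod_cast Fintype.card_pos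
  rw [div_le_div_iff₀ (by positivity) hc]
  have := sq_sum_le_card_mul_sum_sq (s := (univ : Finset ι)) (f := f)
  rw [card_univ] at this
  nlinarith

/-- Weighted orthogonality: the second moment of a sum of pairwise orthogonal functions. -/
theorem expect_sq_sum_eq {ι T : Type*} [Fintype ι] [Fintype T] (W : T → ι → ℝ)
    (h : ∀ s t, s ≠ t → 𝔼 i, W s i * W t i = 0) :
    𝔼 i, (∑ t, W t i) ^ 2 = ∑ t, 𝔼 i, W t i ^ 2 := by
  classical
  have h1 : ∀ i, (∑ t, W t i) ^ 2 = ∑ s, ∑ t, W s i * W t i := fun i => by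
    rw [sq, sum_mul_sum]
  simp_rw [h1, expect_sum_comm]
  refine sum_congr rfl fun s _ => ?_
  rw [sum_eq_single s (fun t _ hts => h s t hts.symm) (by simp)]
  simp_rw [sq]

end PermutationAverages

/-! ### The statistic as an average of products of covariance estimators -/

section CovKernel

open Finset
open scoped BigOperators

variable {𝒳 𝒴 ι κ : Type*}

/-- The inner product of two elementary covariance estimators; the points with indices `a` provide
the first coordinates, those with indices `b` the second ones. -/
noncomputable def covKernel {n : ℕ} (pX : ι → 𝒳 → ℝ) (pY : κ → 𝒴 → ℝ) (M : Finset (ι × κ))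
    (z : Fin n → 𝒳 × 𝒴) (a b : Fin 4 → Fin n) : ℝ :=
  ∑ q ∈ M,
    ((pX q.1 (z (a 0)).1 - pX q.1 (z (a 1)).1) * (pY q.2 (z (b 0)).2 - pY q.2 (z (b 1)).2) / 2) *
    ((pX q.1 (z (a 2)).1 - pX q.1 (z (a 3)).1) * (pY q.2 (z (b 2)).2 - pY q.2 (z (b 3)).2) / 2)

theorem expect_embedding_perm {α : Type*} [Fintype α] [DecidableEq α] {k : ℕ}
    (τ : Equiv.Perm (Fin k)) (F : (Fin k → α) → ℝ) :
    𝔼 i : Fin k ↪ α, F (i ∘ τ) = 𝔼 i : Fin k ↪ α, F i :=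
  Fintype.expect_equiv (Equiv.embeddingCongr τ.symm (Equiv.refl α)) _ _ fun i => by
    congr 1

/-- The product of two covariance estimators expands into sixteen monomials. Up to relabelling the
four positions, which the average does not see, only three types occur: four monomials with two
coinciding pairs, eight (with a minus sign) with one, and four with none. Dividing by 4 leaves the
coefficients 1, -2, 1 of `kernelH`. -/
theorem Dhat_eq_expect {n : ℕ} (pX : ι → 𝒳 → ℝ) (pY : κ → 𝒴 → ℝ) (M : Finset (ι × κ))
    (z : Fin n → 𝒳 × 𝒴) :
    Dhat pX pY M z = 𝔼 i : Fin 4 ↪ Fin n, covKernel pX pY M z i i := by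
  have hc : (1 / ((Nat.factorial 4 : ℝ) * (n.choose 4 : ℝ))) *
      ∑ i : Fin 4 ↪ Fin n, kernelH pX pY M (z (i 0)) (z (i 1)) (z (i 2)) (z (i 3)) =
      𝔼 i : Fin 4 ↪ Fin n, kernelH pX pY M (z (i 0)) (z (i 1)) (z (i 2)) (z (i 3)) := by
    rw [Fintype.expect_eq_sum_div_card, Fintype.card_embedding_eq, Fintype.card_fin,
      Fintype.card_fin, Nat.descFactorial_eq_factorial_mul_choose]
    push_cast
    ring
  rw [Dhat, hc]
  simp only [kernelH, covKernel, expect_sum_comm]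
  refine sum_congr rfl fun q _ => ?_
  set u : Fin n → ℝ := fun i => pX q.1 (z i).1
  set v : Fin n → ℝ := fun i => pY q.2 (z i).2
  let F : Fin 4 → Fin 4 → Fin 4 → Fin 4 → (Fin 4 → Fin n) → ℝ := fun a b c d i =>
    u (i a) * v (i b) * (u (i c) * v (i d))
  have hF : ∀ (τ : Equiv.Perm (Fin 4)) (a b c d : Fin 4),
      𝔼 i : Fin 4 ↪ Fin n, F (τ a) (τ b) (τ c) (τ d) i = 𝔼 i : Fin 4 ↪ Fin n, F a b c d i :=
    fun τ a b c d => expect_embedding_perm τ (F a b c d)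
  have h1 : ∀ a c : Fin 4, a ≠ c →
      𝔼 i : Fin 4 ↪ Fin n, F a a c c i = 𝔼 i : Fin 4 ↪ Fin n, F 0 0 1 1 i := by
    intro a c hac
    obtain ⟨τ, rfl, rfl⟩ : ∃ τ : Equiv.Perm (Fin 4), τ 0 = a ∧ τ 1 = c := by
      revert a c; decide
    exact hF τ 0 0 1 1
  have h2 : ∀ a c d : Fin 4, a ≠ c → a ≠ d → c ≠ d →
      𝔼 i : Fin 4 ↪ Fin n, F a a c d i = 𝔼 i : Fin 4 ↪ Fin n, F 0 0 1 2 i := by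
    intro a c d hac had hcd
    obtain ⟨τ, rfl, rfl, rfl⟩ : ∃ τ : Equiv.Perm (Fin 4), τ 0 = a ∧ τ 1 = c ∧ τ 2 = d := by
      revert a c d; decide
    exact hF τ 0 0 1 2
  -- Commutativity moves the coinciding pair to the front, so that `h2` also covers these monomials.
  have hc : ∀ a c d : Fin 4, F c d a a = F a a c d := fun a c d => by
    funext i; simp only [F]; ring
  have h3 : ∀ a b c d : Fin 4, a ≠ b → a ≠ c → a ≠ d → b ≠ c → b ≠ d → c ≠ d →
      𝔼 i : Fin 4 ↪ Fin n, F a b c d i = 𝔼 i : Fin 4 ↪ Fin n, F 0 1 2 3 i := by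
    intro a b c d hab hac had hbc hbd hcd
    have hinj : Function.Injective ![a, b, c, d] := by
      intro s t
      fin_cases s <;> fin_cases t <;>
        simp [hab, hac, had, hbc, hbd, hcd, hab.symm, hac.symm, had.symm, hbc.symm, hbd.symm,
          hcd.symm]
    obtain ⟨τ, rfl, rfl, rfl, rfl⟩ : ∃ τ : Equiv.Perm (Fin 4),
        τ 0 = a ∧ τ 1 = b ∧ τ 2 = c ∧ τ 3 = d :=
      ⟨Equiv.ofBijective _ (Finite.injective_iff_bijective.1 hinj), rfl, rfl, rfl, rfl⟩
    exact hF τ 0 1 2 3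
  have lhs : ∀ i : Fin 4 ↪ Fin n, u (i 0) * v (i 0) * (u (i 1) * v (i 1)) -
      2 * (u (i 0) * v (i 0)) * (u (i 1) * v (i 2)) + u (i 0) * v (i 1) * (u (i 2) * v (i 3)) =
      F 0 0 1 1 i - 2 * F 0 0 1 2 i + F 0 1 2 3 i := fun i => by simp only [F]; ring
  have rhs : ∀ i : Fin 4 ↪ Fin n, (u (i 0) - u (i 1)) * (v (i 0) - v (i 1)) / 2 *
      ((u (i 2) - u (i 3)) * (v (i 2) - v (i 3)) / 2) =
      1 / 4 * (F 0 0 2 2 i + F 0 0 3 3 i + F 1 1 2 2 i + F 1 1 3 3 i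
        - (F 0 0 2 3 i + F 0 0 3 2 i + F 1 1 2 3 i + F 1 1 3 2 i
          + (F 0 1 2 2 i + F 0 1 3 3 i + F 1 0 2 2 i + F 1 0 3 3 i))
        + (F 0 1 2 3 i + F 0 1 3 2 i + F 1 0 2 3 i + F 1 0 3 2 i)) := fun i => by
    simp only [F]; ring
  change 𝔼 i : Fin 4 ↪ Fin n, (u (i 0) * v (i 0) * (u (i 1) * v (i 1)) -
      2 * (u (i 0) * v (i 0)) * (u (i 1) * v (i 2)) + u (i 0) * v (i 1) * (u (i 2) * v (i 3))) =
    𝔼 i : Fin 4 ↪ Fin n, (u (i 0) - u (i 1)) * (v (i 0) - v (i 1)) / 2 *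
      ((u (i 2) - u (i 3)) * (v (i 2) - v (i 3)) / 2)
  rw [expect_congr rfl fun i _ => lhs i, expect_congr rfl fun i _ => rhs i, hc 2 0 1, hc 3 0 1,
    hc 2 1 0, hc 3 1 0]
  simp only [expect_add_distrib, expect_sub_distrib, ← mul_expect]
  rw [h1 0 2 (by decide), h1 0 3 (by decide), h1 1 2 (by decide), h1 1 3 (by decide),
    h2 0 2 3 (by decide) (by decide) (by decide), h2 0 3 2 (by decide) (by decide) (by decide),
    h2 1 2 3 (by decide) (by decide) (by decide), h2 1 3 2 (by decide) (by decide) (by decide),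
    h2 2 0 1 (by decide) (by decide) (by decide), h2 3 0 1 (by decide) (by decide) (by decide),
    h2 2 1 0 (by decide) (by decide) (by decide), h2 3 1 0 (by decide) (by decide) (by decide),
    h3 0 1 3 2 (by decide) (by decide) (by decide) (by decide) (by decide) (by decide),
    h3 1 0 2 3 (by decide) (by decide) (by decide) (by decide) (by decide) (by decide),
    h3 1 0 3 2 (by decide) (by decide) (by decide) (by decide) (by decide) (by decide)]
  ring

/-- The position `4 a + t`: the points of a block come from the groups of four consecutive ones. -/
def blockIndex {m n : ℕ} (h : 4 * m ≤ n) (a : Fin m) (t : Fin 4) : Fin n :=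
  ⟨4 * a + t, by have := a.2; have := t.2; omega⟩

theorem blockIndex_inj {m n : ℕ} (h : 4 * m ≤ n) {a b : Fin m} {s t : Fin 4} :
    blockIndex h a s = blockIndex h b t ↔ a = b ∧ s = t := by
  simp only [blockIndex, Fin.ext_iff]
  have := s.2; have := t.2
  omega

/-- The first two indices of block `a` followed by the last two indices of block `b`. -/
def blockPair {m n : ℕ} (h : 4 * m ≤ n) (p : Fin m × Fin m) : Fin 4 ↪ Fin n where
  toFun t := blockIndex h (if t = 0 ∨ t = 1 then p.1 else p.2) t
  inj' _ _ hst := ((blockIndex_inj h).1 hst).2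

theorem blockPair_apply {m n : ℕ} (h : 4 * m ≤ n) (p : Fin m × Fin m) (t : Fin 4) :
    blockPair h p t = blockIndex h (if t = 0 ∨ t = 1 then p.1 else p.2) t := rfl

theorem expect_blockPair {m n : ℕ} (hm : 0 < m) (h : 4 * m ≤ n) (F : (Fin 4 → Fin n) → ℝ) :
    𝔼 i : Fin 4 ↪ Fin n, F i =
      𝔼 σ : Equiv.Perm (Fin n), 𝔼 p : Fin m × Fin m, F (σ ∘ blockPair h p) := by
  have : Nonempty (Fin m × Fin m) := ⟨⟨⟨0, hm⟩, ⟨0, hm⟩⟩⟩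
  rw [expect_comm, ← Fintype.expect_const (ι := Fin m × Fin m) (𝔼 i : Fin 4 ↪ Fin n, F i)]
  refine expect_congr rfl fun p _ => ?_
  exact (expect_perm_trans (blockPair h p) fun i => F i).symm

theorem Dhat_eq_expect_blocks {m n : ℕ} (hm : 0 < m) (h : 4 * m ≤ n) (pX : ι → 𝒳 → ℝ)
    (pY : κ → 𝒴 → ℝ) (M : Finset (ι × κ)) (z : Fin n → 𝒳 × 𝒴) :
    Dhat pX pY M z = 𝔼 σ : Equiv.Perm (Fin n), 𝔼 p : Fin m × Fin m,
      covKernel pX pY M z (σ ∘ blockPair h p) (σ ∘ blockPair h p) := by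
  rw [Dhat_eq_expect]
  exact expect_blockPair hm h fun i => covKernel pX pY M z i i

/-- Distinct block pairs differ in one component, and the two positions that `p` takes from that
block are not used by `p'`. A uniform permutation composed with their transposition is again
uniform, so the average equals its own negative. The points `z` are fixed: no assumption on their
law enters. -/
theorem covKernel_orthogonal {m n : ℕ} (h : 4 * m ≤ n) (pX : ι → 𝒳 → ℝ) (pY : κ → 𝒴 → ℝ)
    (M : Finset (ι × κ)) (z : Fin n → 𝒳 × 𝒴) {p p' : Fin m × Fin m} (hp : p ≠ p')
    (a a' : Fin 4 → Fin n) :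
    𝔼 π : Equiv.Perm (Fin n), covKernel pX pY M z a (π ∘ blockPair h p) *
      covKernel pX pY M z a' (π ∘ blockPair h p') = 0 := by
  -- exchanging two second coordinates changes the sign of the first factor only
  obtain ⟨s, h1, h2⟩ : ∃ s : Equiv.Perm (Fin n),
      (∀ π : Equiv.Perm (Fin n), covKernel pX pY M z a ((π * s) ∘ blockPair h p) =
        -covKernel pX pY M z a (π ∘ blockPair h p)) ∧
      (∀ π : Equiv.Perm (Fin n), (π * s) ∘ blockPair h p' = π ∘ blockPair h p') := by
    by_cases hp1 : p.1 = p'.1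
    · have hp2 : p.2 ≠ p'.2 := fun h2 => hp (Prod.ext hp1 h2)
      refine ⟨Equiv.swap (blockPair h p 2) (blockPair h p 3), fun π => ?_, fun π => ?_⟩
      · simp only [covKernel, Function.comp, Equiv.Perm.mul_apply, Equiv.swap_apply_left,
          Equiv.swap_apply_right, ← sum_neg_distrib]
        rw [Equiv.swap_apply_of_ne_of_ne, Equiv.swap_apply_of_ne_of_ne]
        · exact sum_congr rfl fun q _ => by ring
        all_goals rw [(blockPair h p).injective.ne_iff]; decide
      · funext t
        simp only [Function.comp, Equiv.Perm.mul_apply]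
        rw [Equiv.swap_apply_of_ne_of_ne]
        all_goals
          simp only [blockPair_apply, ne_eq, blockIndex_inj]
          fin_cases t <;> simp [hp2.symm]
    · refine ⟨Equiv.swap (blockPair h p 0) (blockPair h p 1), fun π => ?_, fun π => ?_⟩
      · simp only [covKernel, Function.comp, Equiv.Perm.mul_apply, Equiv.swap_apply_left,
          Equiv.swap_apply_right, ← sum_neg_distrib]
        rw [Equiv.swap_apply_of_ne_of_ne, Equiv.swap_apply_of_ne_of_ne]
        · exact sum_congr rfl fun q _ => by ring
        all_goals rw [(blockPair h p).injective.ne_iff]; decide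
      · funext t
        simp only [Function.comp, Equiv.Perm.mul_apply]
        rw [Equiv.swap_apply_of_ne_of_ne]
        all_goals
          simp only [blockPair_apply, ne_eq, blockIndex_inj]
          fin_cases t <;> simp [Ne.symm hp1]
  have key : 𝔼 π : Equiv.Perm (Fin n), covKernel pX pY M z a (π ∘ blockPair h p) *
      covKernel pX pY M z a' (π ∘ blockPair h p') =
      -𝔼 π : Equiv.Perm (Fin n), covKernel pX pY M z a (π ∘ blockPair h p) *
      covKernel pX pY M z a' (π ∘ blockPair h p') := by
    rw [← expect_neg_distrib]
    refine Fintype.expect_equiv (Equiv.mulRight s⁻¹) _ _ fun π => ?_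
    have e1 := h1 (π * s⁻¹)
    have e2 := h2 (π * s⁻¹)
    rw [inv_mul_cancel_right] at e1 e2
    simp only [Equiv.coe_mulRight]
    rw [e1, e2, neg_mul]
  linarith

/-- In the block form of the permuted statistic the first coordinates are indexed through `τ` and
the second ones through `σ * τ`. After Jensen in `τ`, the substitution `π = σ * τ` decouples the two
index sets, and orthogonality in `π` removes all cross terms. The factor m⁻⁴ is the square of the
weight m⁻² of a block pair. -/
theorem expect_sq_Dhat_permuteData_le {m n : ℕ} (hm : 0 < m) (h : 4 * m ≤ n) (pX : ι → 𝒳 → ℝ)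
    (pY : κ → 𝒴 → ℝ) (M : Finset (ι × κ)) (z : Fin n → 𝒳 × 𝒴) :
    𝔼 σ : Equiv.Perm (Fin n), Dhat pX pY M (permuteData σ z) ^ 2 ≤
      (1 / (m : ℝ) ^ 4) * ∑ p : Fin m × Fin m, 𝔼 τ : Equiv.Perm (Fin n),
        𝔼 π : Equiv.Perm (Fin n),
          covKernel pX pY M z (τ ∘ blockPair h p) (π ∘ blockPair h p) ^ 2 := by
  set G : Equiv.Perm (Fin n) → Equiv.Perm (Fin n) → ℝ := fun τ π => 𝔼 p : Fin m × Fin m,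
    covKernel pX pY M z (τ ∘ blockPair h p) (π ∘ blockPair h p) with hG
  have h1 : ∀ σ, Dhat pX pY M (permuteData σ z) = 𝔼 τ, G τ (σ * τ) := fun σ => by
    rw [Dhat_eq_expect_blocks hm h]
    rfl
  have hm' : (m : ℝ) ≠ 0 := by positivity
  calc 𝔼 σ, Dhat pX pY M (permuteData σ z) ^ 2
      ≤ 𝔼 σ, 𝔼 τ, G τ (σ * τ) ^ 2 := expect_le_expect fun σ _ => by
        rw [h1]; exact sq_expect_le _
    _ = 𝔼 τ, 𝔼 σ, G τ (σ * τ) ^ 2 := expect_comm _ _ _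
    _ = 𝔼 τ, 𝔼 π, G τ π ^ 2 := expect_congr rfl fun τ _ =>
        Fintype.expect_equiv (Equiv.mulRight τ) _ _ fun σ => rfl
    _ = 𝔼 τ : Equiv.Perm (Fin n), (1 / (m : ℝ) ^ 4) * ∑ p : Fin m × Fin m,
        𝔼 π : Equiv.Perm (Fin n),
          covKernel pX pY M z (τ ∘ blockPair h p) (π ∘ blockPair h p) ^ 2 := by
        refine expect_congr rfl fun τ _ => ?_
        rw [← expect_sq_sum_eq _ fun p p' hp => covKernel_orthogonal h pX pY M z hp _ _,
          mul_expect]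
        refine expect_congr rfl fun π _ => ?_
        simp only [hG, Fintype.expect_eq_sum_div_card, Fintype.card_prod, Fintype.card_fin]
        push_cast
        field_simp
    _ = _ := by rw [← mul_expect, expect_sum_comm]


end CovKernel
end USP

namespace USP

/-! ### The level of the permutation test -/

section Level

open Finset
open scoped BigOperators

/-- At most `c` elements of a finite family have fewer than `c` elements above or equal to them. -/
theorem card_rank_lt_le {T : Type*} [Fintype T] (D : T → ℝ) (c : ℝ) (hc : 0 ≤ c) :
    ∑ t, (if (∑ s, if D t ≤ D s then (1 : ℝ) else 0) < c then (1 : ℝ) else 0) ≤ c := by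
  classical
  set S : Finset T := univ.filter fun t => (∑ s, if D t ≤ D s then (1 : ℝ) else 0) < c with hS
  rw [sum_boole]
  change (#S : ℝ) ≤ c
  rcases S.eq_empty_or_nonempty with h | h
  · simpa [h] using hc
  -- All of `S` lies at or above its minimiser `t`, so `#S` is at most the rank count of `t`, which
  -- is less than `c`.
  obtain ⟨t, ht, hmin⟩ := S.exists_min_image D h
  have h1 : (∑ s, if D t ≤ D s then (1 : ℝ) else 0) < c := (mem_filter.1 ht).2
  refine le_trans ?_ h1.le
  rw [sum_boole]
  exact_mod_cast card_le_card fun s hs => by simpa using hmin s hs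

/-- If the family is drawn uniformly, every member is equally likely to have a small rank. -/
theorem expect_rank_lt_le {G : Type*} [Fintype G] [Nonempty G] (D : G → ℝ) (B : ℕ) (c : ℝ)
    (hc : 0 ≤ c) :
    𝔼 g : Option (Fin B) → G,
      (if (∑ b, if D (g none) ≤ D (g b) then (1 : ℝ) else 0) < c then (1 : ℝ) else 0) ≤
        c / (1 + B) := by
  -- The index `none` stands for the observed statistic. Exchangeability lets any `t` take its
  -- place; after averaging over `t` the deterministic count above applies to each `g`.
  have key : ∀ t : Option (Fin B), 𝔼 g : Option (Fin B) → G,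
      (if (∑ b, if D (g none) ≤ D (g b) then (1 : ℝ) else 0) < c then (1 : ℝ) else 0) =
      𝔼 g : Option (Fin B) → G,
      (if (∑ b, if D (g t) ≤ D (g b) then (1 : ℝ) else 0) < c then (1 : ℝ) else 0) := by
    intro t
    refine Fintype.expect_equiv (Equiv.arrowCongr (Equiv.swap none t) (Equiv.refl G)) _ _
      fun g => ?_
    have h1 : ∀ x, (∑ b, if x ≤ D ((Equiv.arrowCongr (Equiv.swap none t) (Equiv.refl G)) g b)
        then (1 : ℝ) else 0) = ∑ b, if x ≤ D (g b) then (1 : ℝ) else 0 := fun x =>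
      Fintype.sum_equiv (Equiv.swap none t) _ _ fun b => by
        simp [Equiv.arrowCongr]
    rw [h1]
    simp [Equiv.arrowCongr]
  have h2 := Fintype.expect_const (ι := Option (Fin B)) (𝔼 g : Option (Fin B) → G,
      (if (∑ b, if D (g none) ≤ D (g b) then (1 : ℝ) else 0) < c then (1 : ℝ) else 0))
  rw [← h2, expect_congr rfl fun t _ => key t, expect_comm]
  refine expect_le univ_nonempty fun g _ => ?_
  rw [Fintype.expect_eq_sum_div_card, Fintype.card_option, Fintype.card_fin]
  push_cast
  rw [add_comm (B : ℝ)]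
  gcongr
  exact card_rank_lt_le (fun b => D (g b)) c hc

variable {𝒳 𝒴 ι κ : Type*}

theorem permuteData_permuteData {n : ℕ} (σ τ : Equiv.Perm (Fin n)) (z : Fin n → 𝒳 × 𝒴) :
    permuteData σ (permuteData τ z) = permuteData (τ * σ) z := rfl

/-- Averaged over a random relabelling of the data, the permutation p-value is conservative. -/
theorem expect_pValue_lt_le {n B : ℕ} (pX : ι → 𝒳 → ℝ) (pY : κ → 𝒴 → ℝ) (M : Finset (ι × κ))
    (z : Fin n → 𝒳 × 𝒴) (t : ℝ) (ht : 0 ≤ t) :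
    𝔼 τ : Equiv.Perm (Fin n), 𝔼 π : Fin B → Equiv.Perm (Fin n),
      (if pValue pX pY M (permuteData τ z) π < t then (1 : ℝ) else 0) ≤ t := by
  set D : Equiv.Perm (Fin n) → ℝ := fun σ => Dhat pX pY M (permuteData σ z) with hD
  have hB : (0 : ℝ) < 1 + B := by positivity
  have h1 : ∀ (τ : Equiv.Perm (Fin n)) (π : Fin B → Equiv.Perm (Fin n)),
      (if pValue pX pY M (permuteData τ z) π < t then (1 : ℝ) else 0) =
      if 1 + ∑ b, (if D τ ≤ D (τ * π b) then (1 : ℝ) else 0) < t * (1 + B) then (1 : ℝ) else 0 := by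
    intro τ π
    simp only [pValue, permuteData_permuteData, div_lt_iff₀ hB]
    rfl
  -- Left translation by `τ` preserves the uniform law, so `τ` and the products `τ * π b` are
  -- together 1 + B independent uniform permutations.
  have h2 : ∀ τ : Equiv.Perm (Fin n), 𝔼 π : Fin B → Equiv.Perm (Fin n),
      (if pValue pX pY M (permuteData τ z) π < t then (1 : ℝ) else 0) =
      𝔼 π : Fin B → Equiv.Perm (Fin n),
        if 1 + ∑ b, (if D τ ≤ D (π b) then (1 : ℝ) else 0) < t * (1 + B) then (1 : ℝ) else 0 :=
    fun τ => Fintype.expect_equiv (Equiv.arrowCongr (Equiv.refl _) (Equiv.mulLeft τ)) _ _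
      fun π => h1 τ π
  rw [expect_congr rfl fun τ _ => h2 τ]
  have h3 := expect_rank_lt_le D B (t * (1 + B)) (by positivity)
  rw [mul_div_cancel_right₀ _ hB.ne'] at h3
  refine le_of_eq_of_le ?_ h3
  rw [← expect_product' (s := univ) (t := univ) (f := fun (τ : Equiv.Perm (Fin n))
    (π : Fin B → Equiv.Perm (Fin n)) =>
      if 1 + ∑ b, (if D τ ≤ D (π b) then (1 : ℝ) else 0) < t * (1 + B) then (1 : ℝ) else 0)]
  rw [univ_product_univ]
  refine (Fintype.expect_equiv (Equiv.piOptionEquivProd (α := Fin B)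
    (β := fun _ => Equiv.Perm (Fin n))) _ _ fun g => ?_).symm
  -- The summand at `none` compares the observed statistic with itself; it is the 1 in the numerator
  -- of the p-value.
  rw [Fintype.sum_option, if_pos le_rfl]
  rfl

variable [MeasurableSpace 𝒳] [MeasurableSpace 𝒴]

theorem measurable_Dhat {n : ℕ} {pX : ι → 𝒳 → ℝ} {pY : κ → 𝒴 → ℝ} (hX : ∀ j, Measurable (pX j))
    (hY : ∀ k, Measurable (pY k)) (M : Finset (ι × κ)) :
    Measurable (Dhat (n := n) pX pY M) := by
  unfold Dhat kernelH
  fun_prop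

theorem measurable_permuteData {n : ℕ} (σ : Equiv.Perm (Fin n)) :
    Measurable (permuteData (𝒳 := 𝒳) (𝒴 := 𝒴) σ) := by
  unfold permuteData
  fun_prop

theorem measurable_pValue {n B : ℕ} {pX : ι → 𝒳 → ℝ} {pY : κ → 𝒴 → ℝ}
    (hX : ∀ j, Measurable (pX j)) (hY : ∀ k, Measurable (pY k)) (M : Finset (ι × κ))
    (π : Fin B → Equiv.Perm (Fin n)) :
    Measurable fun z => pValue pX pY M z π := by
  unfold pValue
  refine Measurable.div_const (measurable_const.add (Finset.measurable_sum _ fun b _ => ?_)) _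
  exact Measurable.ite (measurableSet_le (measurable_Dhat hX hY M)
    ((measurable_Dhat hX hY M).comp (measurable_permuteData _))) measurable_const measurable_const

theorem measurePreserving_pi_comp_perm {Z : Type*} [MeasurableSpace Z] {n : ℕ} (ν : Measure Z)
    [SigmaFinite ν] (σ : Equiv.Perm (Fin n)) :
    MeasurePreserving (fun z : Fin n → Z => z ∘ σ) (Measure.pi fun _ => ν)
      (Measure.pi fun _ => ν) := by
  refine ⟨by fun_prop, (Measure.pi_eq fun s hs => ?_).symm⟩
  rw [Measure.map_apply (by fun_prop) (MeasurableSet.univ_pi hs)]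
  have : (fun z : Fin n → Z => z ∘ σ) ⁻¹' Set.pi Set.univ s =
      Set.pi Set.univ fun i => s (σ.symm i) := by
    ext z
    simp only [Set.mem_preimage, Set.mem_pi, Set.mem_univ, forall_true_left, Function.comp]
    exact ⟨fun h i => by simpa using h (σ.symm i), fun h i => by simpa using h (σ i)⟩
  rw [this, Measure.pi_pi]
  exact Fintype.prod_equiv σ.symm _ _ fun i => rfl

/-- Independence makes `P` the product of its marginals. The two coordinate samples are then
independent, and permuting the second one preserves its i.i.d. law. -/
theorem measurePreserving_permuteData {n : ℕ} (P : Measure (𝒳 × 𝒴)) [IsProbabilityMeasure P]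
    (hP : IndepFun Prod.fst Prod.snd P) (σ : Equiv.Perm (Fin n)) :
    MeasurePreserving (permuteData (𝒳 := 𝒳) (𝒴 := 𝒴) σ) (Measure.pi fun _ : Fin n => P)
      (Measure.pi fun _ => P) := by
  have h : P = (P.map Prod.fst).prod (P.map Prod.snd) := by
    rw [← (indepFun_iff_map_prod_eq_prod_map_map measurable_fst.aemeasurable
      measurable_snd.aemeasurable).1 hP]
    exact Measure.map_id.symm
  have := Measure.isProbabilityMeasure_map (μ := P) measurable_fst.aemeasurable
  have := Measure.isProbabilityMeasure_map (μ := P) measurable_snd.aemeasurable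
  have e := measurePreserving_arrowProdEquivProdArrow 𝒳 𝒴 (Fin n)
    (fun _ => P.map Prod.fst) (fun _ => P.map Prod.snd)
  rw [← h] at e
  exact (e.symm.comp (((MeasurePreserving.id _).prod
    (measurePreserving_pi_comp_perm (P.map Prod.snd) σ)).comp e))

/-- Invariance of the law allows the data to be relabelled by a uniform `τ` inside the integral,
where `expect_pValue_lt_le` holds pointwise in `z`. -/
theorem lintegral_expect_pValue_lt_le {n B : ℕ} {pX : ι → 𝒳 → ℝ} {pY : κ → 𝒴 → ℝ}
    (hX : ∀ j, Measurable (pX j)) (hY : ∀ k, Measurable (pY k)) (M : Finset (ι × κ))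
    (P : Measure (𝒳 × 𝒴)) [IsProbabilityMeasure P] (hP : IndepFun Prod.fst Prod.snd P)
    (t : ℝ) (ht : 0 ≤ t) :
    ∫⁻ z, ENNReal.ofReal (𝔼 π : Fin B → Equiv.Perm (Fin n),
      (if pValue pX pY M z π < t then (1 : ℝ) else 0)) ∂(Measure.pi fun _ : Fin n => P) ≤
      ENNReal.ofReal t := by
  set E : (Fin n → 𝒳 × 𝒴) → ℝ := fun z => 𝔼 π : Fin B → Equiv.Perm (Fin n),
      (if pValue pX pY M z π < t then (1 : ℝ) else 0) with hE
  have hE0 : ∀ z, 0 ≤ E z := fun z => expect_nonneg fun π _ => by positivity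
  have hEm : Measurable E := by
    simp only [hE, Fintype.expect_eq_sum_div_card]
    refine Measurable.div_const (Finset.measurable_sum _ fun π _ => ?_) _
    exact Measurable.ite (measurableSet_lt (measurable_pValue hX hY M π) measurable_const)
      measurable_const measurable_const
  set N : ℝ≥0∞ := (Fintype.card (Equiv.Perm (Fin n)) : ℝ≥0∞) with hN
  have hN0 : N ≠ 0 := by simp [hN, Fintype.card_ne_zero]
  have hNt : N ≠ ∞ := by simp [hN]
  have h1 : N * ∫⁻ z, ENNReal.ofReal (E z) ∂(Measure.pi fun _ : Fin n => P) ≤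
      N * ENNReal.ofReal t := by
    calc N * ∫⁻ z, ENNReal.ofReal (E z) ∂(Measure.pi fun _ : Fin n => P)
        = ∑ τ : Equiv.Perm (Fin n), ∫⁻ z, ENNReal.ofReal (E (permuteData τ z))
            ∂(Measure.pi fun _ : Fin n => P) := by
          rw [sum_congr rfl fun τ _ => (measurePreserving_permuteData P hP τ).lintegral_comp
            hEm.ennreal_ofReal]
          simp [hN]
      _ = ∫⁻ z, ∑ τ : Equiv.Perm (Fin n), ENNReal.ofReal (E (permuteData τ z))
            ∂(Measure.pi fun _ : Fin n => P) :=
          (lintegral_finsetSum _ fun τ _ =>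
            (hEm.comp (measurable_permuteData τ)).ennreal_ofReal).symm
      _ ≤ ∫⁻ z, N * ENNReal.ofReal t ∂(Measure.pi fun _ : Fin n => P) := by
          refine lintegral_mono fun z => ?_
          rw [← ENNReal.ofReal_sum_of_nonneg fun τ _ => hE0 _]
          have h2 := expect_pValue_lt_le (B := B) pX pY M z t ht
          rw [Fintype.expect_eq_sum_div_card, div_le_iff₀ (by positivity)] at h2
          rw [hN, ← ENNReal.ofReal_natCast, ← ENNReal.ofReal_mul (by positivity)]
          exact ENNReal.ofReal_le_ofReal (by linarith)
      _ = N * ENNReal.ofReal t := by simp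
  exact (ENNReal.mul_le_mul_iff_right hN0 hNt).1 h1

theorem uniformOfFintype_toOuterMeasure {G : Type*} [Fintype G] [Nonempty G] (p : G → Prop)
    [DecidablePred p] :
    (PMF.uniformOfFintype G).toOuterMeasure {g | p g} =
      ENNReal.ofReal (𝔼 g, if p g then (1 : ℝ) else 0) := by
  classical
  rw [PMF.toOuterMeasure_uniformOfFintype_apply, Fintype.expect_eq_sum_div_card, sum_boole,
    ENNReal.ofReal_div_of_pos (by positivity), ENNReal.ofReal_natCast, ENNReal.ofReal_natCast]
  congr 2
  rw [Fintype.card_subtype]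
  congr

theorem numLevels_pos {d n : ℕ} (hd : 1 ≤ d) (hn : 4 ≤ n) : 0 < numLevels d n := by
  refine Nat.ceil_pos.2 (mul_pos (by positivity) (Real.logb_pos one_lt_two ?_))
  exact_mod_cast (by omega : 1 < n)

section Adaptive

variable {dX dY n : ℕ} {pX : (Fin dX → ℕ) → 𝒳 → ℝ} {pY : (Fin dY → ℕ) → 𝒴 → ℝ}
  {B : Fin (numLevels dX n) × Fin (numLevels dY n) → ℕ} {Q : PMF (PermFamily B)}

theorem toOuterMeasure_level (hQ : HasUniformPerms Q) (q) (p : (Fin (B q) → Equiv.Perm (Fin n)) → Prop)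
    [DecidablePred p] :
    Q.toOuterMeasure {π | p (π q)} = ENNReal.ofReal (𝔼 π, if p π then (1 : ℝ) else 0) := by
  rw [← uniformOfFintype_toOuterMeasure, ← hQ q, PMF.toOuterMeasure_map_apply]
  rfl

/-- The level is a union bound over `q`, which uses only the marginal law of the permutations of
each test; hence arbitrary dependence between tests is harmless. -/
theorem isValidTest_adaptiveTest (hdX : 1 ≤ dX) (hdY : 1 ≤ dY) (hn : 4 ≤ n) {α : ℝ} (hα : 0 < α)
    (hX : ∀ j, Measurable (pX j)) (hY : ∀ k, Measurable (pY k)) (hQ : HasUniformPerms Q) :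
    IsValidTest α (adaptiveTest pX pY α B Q) where
  measurable := by
    unfold adaptiveTest
    simp_rw [PMF.toOuterMeasure_apply]
    refine Measurable.tsum fun π => ?_
    refine Measurable.ite ?_ measurable_const measurable_const
    have : {z : Fin n → 𝒳 × 𝒴 | π ∈ {π : PermFamily B | ∃ q, pValue pX pY (truncation q) z (π q) <
        α / ((numLevels dX n : ℝ) * (numLevels dY n : ℝ))}} =
        ⋃ q, {z | pValue pX pY (truncation q) z (π q) <
          α / ((numLevels dX n : ℝ) * (numLevels dY n : ℝ))} := by
      ext z; simp
    rw [this]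
    exact MeasurableSet.iUnion fun q =>
      measurableSet_lt (measurable_pValue hX hY _ _) measurable_const
  le_one z := by
    rw [adaptiveTest, PMF.toOuterMeasure_apply, ← Q.tsum_coe]
    exact ENNReal.tsum_le_tsum fun π => Set.indicator_le_self _ _ _
  level P _ hP := by
    set t : ℝ := α / ((numLevels dX n : ℝ) * (numLevels dY n : ℝ)) with ht
    have hγX : (0 : ℝ) < numLevels dX n := by exact_mod_cast numLevels_pos hdX hn
    have hγY : (0 : ℝ) < numLevels dY n := by exact_mod_cast numLevels_pos hdY hn
    have ht0 : 0 ≤ t := by positivity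
    calc ∫⁻ z, adaptiveTest pX pY α B Q z ∂(Measure.pi fun _ : Fin n => P)
        ≤ ∫⁻ z, ∑ q, ENNReal.ofReal (𝔼 π : Fin (B q) → Equiv.Perm (Fin n),
            (if pValue pX pY (truncation q) z π < t then (1 : ℝ) else 0))
            ∂(Measure.pi fun _ : Fin n => P) := by
          refine lintegral_mono fun z => ?_
          simp_rw [← toOuterMeasure_level hQ]
          rw [adaptiveTest, Set.ofPred_exists]
          exact measure_iUnion_fintype_le _ _
      _ = ∑ q, ∫⁻ z, ENNReal.ofReal (𝔼 π : Fin (B q) → Equiv.Perm (Fin n),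
            (if pValue pX pY (truncation q) z π < t then (1 : ℝ) else 0))
            ∂(Measure.pi fun _ : Fin n => P) := by
          refine lintegral_finsetSum _ fun q _ => Measurable.ennreal_ofReal ?_
          simp only [Fintype.expect_eq_sum_div_card]
          refine Measurable.div_const (Finset.measurable_sum _ fun π _ => ?_) _
          exact Measurable.ite (measurableSet_lt (measurable_pValue hX hY _ π) measurable_const)
            measurable_const measurable_const
      _ ≤ ∑ q : Fin (numLevels dX n) × Fin (numLevels dY n), ENNReal.ofReal t :=
          sum_le_sum fun q _ => lintegral_expect_pValue_lt_le hX hY _ P hP t ht0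
      _ = ENNReal.ofReal α := by
          rw [← ENNReal.ofReal_sum_of_nonneg fun _ _ => ht0]
          congr 1
          simp only [sum_const, card_univ, Fintype.card_prod, Fintype.card_fin, nsmul_eq_mul, ht]
          push_cast
          field_simp

end Adaptive

end Level

end USP

namespace USP

/-! ### Moments under a law dominated by the reference measures -/

section Dominated

open scoped NNReal

variable {𝒳 𝒴 : Type*} [MeasurableSpace 𝒳] [MeasurableSpace 𝒴]

/-- A probability law whose density and marginal densities are at most `A`, with `1 ≤ A`. -/
structure IsDominated (μX : Measure 𝒳) (μY : Measure 𝒴) (A : ℝ≥0) (P : Measure (𝒳 × 𝒴)) :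
    Prop where
  prob : IsProbabilityMeasure P
  one_le : 1 ≤ A
  le_prod : P ≤ A • μX.prod μY
  le_fst : P.map Prod.fst ≤ A • μX
  le_snd : P.map Prod.snd ≤ A • μY

variable {μX : Measure 𝒳} {μY : Measure 𝒴} {A : ℝ≥0} {P : Measure (𝒳 × 𝒴)}

theorem lintegral_le_of_le_smul {Z : Type*} [MeasurableSpace Z] {ν ν' : Measure Z}
    (h : ν ≤ A • ν') (F : Z → ℝ≥0∞) : ∫⁻ z, F z ∂ν ≤ A * ∫⁻ z, F z ∂ν' := by
  refine (lintegral_mono' h le_rfl).trans ?_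
  rw [lintegral_smul_measure]
  rfl

theorem IsDominated.lintegral_le (h : IsDominated μX μY A P) (F : 𝒳 × 𝒴 → ℝ≥0∞) :
    ∫⁻ z, F z ∂P ≤ A * ∫⁻ z, F z ∂(μX.prod μY) := lintegral_le_of_le_smul h.le_prod F

theorem IsDominated.lintegral_fst_le (h : IsDominated μX μY A P) {F : 𝒳 → ℝ≥0∞}
    (hF : Measurable F) : ∫⁻ z, F z.1 ∂P ≤ A * ∫⁻ x, F x ∂μX := by
  rw [← lintegral_map hF measurable_fst]
  exact lintegral_le_of_le_smul h.le_fst F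

theorem IsDominated.lintegral_snd_le (h : IsDominated μX μY A P) {F : 𝒴 → ℝ≥0∞}
    (hF : Measurable F) : ∫⁻ z, F z.2 ∂P ≤ A * ∫⁻ y, F y ∂μY := by
  rw [← lintegral_map hF measurable_snd]
  exact lintegral_le_of_le_smul h.le_snd F

/-- Resampling one coordinate of an i.i.d. sample. -/
theorem lintegral_pi_update {Z ι : Type*} [MeasurableSpace Z] [Fintype ι] [DecidableEq ι]
    (P : Measure Z) [IsProbabilityMeasure P] (i : ι) {F : (ι → Z) → ℝ≥0∞} (hF : Measurable F) :
    ∫⁻ z, F z ∂(Measure.pi fun _ => P) =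
      ∫⁻ z, ∫⁻ w, F (Function.update z i w) ∂P ∂(Measure.pi fun _ => P) := by
  have hm : Measurable fun q : (ι → Z) × Z => Function.update q.1 i q.2 := by
    refine measurable_pi_lambda _ fun j => ?_
    by_cases hj : j = i
    · subst hj; simpa using measurable_snd
    · simp only [Function.update_of_ne hj]; fun_prop
  have hmp : (Measure.pi fun _ : ι => P) =
      ((Measure.pi fun _ : ι => P).prod P).map fun q => Function.update q.1 i q.2 := by
    refine Measure.pi_eq fun s hs => ?_
    rw [Measure.map_apply hm (MeasurableSet.univ_pi hs)]
    have : (fun q : (ι → Z) × Z => Function.update q.1 i q.2) ⁻¹' Set.pi Set.univ s =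
        (Set.pi Set.univ (Function.update s i Set.univ)) ×ˢ s i := by
      ext ⟨z, w⟩
      simp only [Set.mem_preimage, Set.mem_pi, Set.mem_univ, forall_true_left, Set.mem_prod]
      constructor
      · intro h
        refine ⟨fun j => ?_, by simpa using h i⟩
        by_cases hj : j = i
        · subst hj; simp
        · simpa [Function.update_of_ne hj] using h j
      · rintro ⟨h1, h2⟩ j
        by_cases hj : j = i
        · subst hj; simpa using h2
        · simpa [Function.update_of_ne hj] using h1 j
    rw [this, Measure.prod_prod, Measure.pi_pi, ← Finset.prod_erase_mul _ _ (Finset.mem_univ i),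
      ← Finset.prod_erase_mul _ _ (Finset.mem_univ i)]
    simp only [Function.update_self, measure_univ, mul_one]
    congr 1
    refine Finset.prod_congr rfl fun j hj => ?_
    rw [Function.update_of_ne (Finset.ne_of_mem_erase hj)]
  conv_lhs => rw [hmp]
  rw [lintegral_map hF hm]
  exact lintegral_prod (fun q : (ι → Z) × Z => F (Function.update q.1 i q.2))
    (hF.comp hm).aemeasurable

theorem lintegral_pi_le_of_update {Z ι : Type*} [MeasurableSpace Z] [Fintype ι] [DecidableEq ι]
    (P : Measure Z) [IsProbabilityMeasure P] (i : ι) {F F' : (ι → Z) → ℝ≥0∞} (hF : Measurable F)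
    (h : ∀ z, ∫⁻ w, F (Function.update z i w) ∂P ≤ A * F' z) :
    ∫⁻ z, F z ∂(Measure.pi fun _ => P) ≤ A * ∫⁻ z, F' z ∂(Measure.pi fun _ => P) := by
  rw [lintegral_pi_update P i hF]
  refine (lintegral_mono h).trans ?_
  rw [lintegral_const_mul' _ _ ENNReal.coe_ne_top]

/-- When one observation supplies both coordinates, a single factor `A` is used where distinct
observations cost two. Since 1 ≤ `A`, both cases fit under a common power. -/
theorem IsDominated.one_le_pow (h : IsDominated μX μY A P) {k l : ℕ} (hkl : k ≤ l) (c : ℝ≥0∞) :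
    (A : ℝ≥0∞) ^ k * c ≤ (A : ℝ≥0∞) ^ l * c := by
  gcongr
  exact_mod_cast h.one_le

variable {n : ℕ} [SFinite μX] [SFinite μY]

theorem IsDominated.lintegral_pair_le (h : IsDominated μX μY A P) (i l : Fin n)
    {F : 𝒳 × 𝒴 → ℝ≥0∞} (hF : Measurable F) :
    ∫⁻ z, F ((z i).1, (z l).2) ∂(Measure.pi fun _ => P) ≤
      A ^ 2 * ∫⁻ z, F z ∂(μX.prod μY) := by
  have := h.prob
  by_cases hil : i = l
  · subst hil
    refine (lintegral_pi_le_of_update (A := A) P i (F' := fun _ => ∫⁻ z, F z ∂(μX.prod μY))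
      (by fun_prop) fun z => ?_).trans ?_
    · simp only [Function.update_self]
      exact h.lintegral_le F
    · rw [lintegral_const, measure_univ, mul_one]
      simpa using h.one_le_pow (k := 1) (l := 2) (by norm_num) (∫⁻ z, F z ∂(μX.prod μY))
  · refine (lintegral_pi_le_of_update (A := A) P i
      (F' := fun z => ∫⁻ x, F (x, (z l).2) ∂μX) (by fun_prop) fun z => ?_).trans ?_
    · simp only [Function.update_self, Function.update_of_ne (Ne.symm hil)]
      exact h.lintegral_fst_le (F := fun x => F (x, (z l).2)) (by fun_prop)
    · rw [pow_two, mul_assoc]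
      gcongr
      have hm : Measurable fun y => ∫⁻ x, F (x, y) ∂μX := hF.lintegral_prod_left'
      refine (lintegral_pi_le_of_update (A := A) P l
        (F' := fun _ => ∫⁻ z, F z ∂(μX.prod μY)) (by fun_prop) fun z => ?_).trans (by simp)
      simp only [Function.update_self]
      rw [lintegral_prod_symm' F hF]
      exact h.lintegral_snd_le hm

theorem lintegral_prod_swap_eq {Z : Type*} [MeasurableSpace Z] (ν : Measure Z) [SFinite ν]
    (H : Z × Z → ℝ≥0∞) : ∫⁻ z, H z.swap ∂(ν.prod ν) = ∫⁻ z, H z ∂(ν.prod ν) :=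
  lintegral_prod_swap H

theorem IsDominated.lintegral_triple_le (h : IsDominated μX μY A P) (i : Fin n) {l l' : Fin n}
    (hl : l ≠ l') {G : 𝒳 → ℝ≥0∞} (hG : Measurable G) {H : 𝒴 × 𝒴 → ℝ≥0∞} (hH : Measurable H) :
    ∫⁻ z, G (z i).1 * H ((z l).2, (z l').2) ∂(Measure.pi fun _ => P) ≤
      A ^ 3 * ((∫⁻ x, G x ∂μX) * ∫⁻ y, H y ∂(μY.prod μY)) := by
  have := h.prob
  -- At most one of `l`, `l'` equals `i`. Exchanging the arguments of `H`, the other one may be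
  -- integrated out first, through the second marginal.
  wlog hil : l ≠ i generalizing l l' H
  · have hil' : l' ≠ i := fun h' => hl (by rw [h', not_not.1 hil])
    have := this hl.symm (H := fun y => H y.swap) (by fun_prop) hil'
    rwa [lintegral_prod_swap_eq] at this
  · have hm : Measurable fun y' => ∫⁻ y, H (y, y') ∂μY := hH.lintegral_prod_left'
    refine (lintegral_pi_le_of_update (A := A) P l
      (F' := fun z => G (z i).1 * ∫⁻ y, H (y, (z l').2) ∂μY) (by fun_prop) fun z => ?_).trans ?_
    · simp only [Function.update_self, Function.update_of_ne hil.symm,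
        Function.update_of_ne hl.symm]
      rw [lintegral_const_mul _ (by fun_prop), mul_left_comm]
      gcongr
      exact h.lintegral_snd_le (F := fun y => H (y, (z l').2)) (by fun_prop)
    · rw [pow_succ' _ 2, mul_assoc]
      gcongr
      refine (h.lintegral_pair_le i l' (F := fun q => G q.1 * ∫⁻ y, H (y, q.2) ∂μY)
        (by fun_prop)).trans ?_
      rw [lintegral_prod_mul hG.aemeasurable hm.aemeasurable, lintegral_prod_symm' H hH]

theorem IsDominated.lintegral_quadruple_le (h : IsDominated μX μY A P) {i i' l l' : Fin n}
    (hi : i ≠ i') (hl : l ≠ l') {G : 𝒳 × 𝒳 → ℝ≥0∞} (hG : Measurable G) {H : 𝒴 × 𝒴 → ℝ≥0∞}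
    (hH : Measurable H) :
    ∫⁻ z, G ((z i).1, (z i').1) * H ((z l).2, (z l').2) ∂(Measure.pi fun _ => P) ≤
      A ^ 4 * ((∫⁻ x, G x ∂(μX.prod μX)) * ∫⁻ y, H y ∂(μY.prod μY)) := by
  have := h.prob
  have hGm : Measurable fun x' => ∫⁻ x, G (x, x') ∂μX := hG.lintegral_prod_left'
  -- If observation `i` also supplies a second coordinate, both of its coordinates are integrated at
  -- once against the joint density. Otherwise only the first marginal is needed and three variables
  -- remain.
  by_cases hc : l = i ∨ l' = i
  · wlog hil : l = i generalizing l l' H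
    · have := this hl.symm (H := fun y => H y.swap) (by fun_prop) hc.symm (hc.resolve_left hil)
      rwa [lintegral_prod_swap_eq] at this
    · subst hil
      have hm : Measurable fun y' => ∫⁻ y, H (y, y') ∂μY := hH.lintegral_prod_left'
      refine (lintegral_pi_le_of_update (A := A) P l
        (F' := fun z => (∫⁻ x, G (x, (z i').1) ∂μX) * ∫⁻ y, H (y, (z l').2) ∂μY)
        (by fun_prop) fun z => ?_).trans ?_
      · simp only [Function.update_self, Function.update_of_ne hi.symm,
          Function.update_of_ne hl.symm]
        refine (h.lintegral_le fun w => G (w.1, (z i').1) * H (w.2, (z l').2)).trans_eq ?_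
        rw [lintegral_prod_mul (f := fun x => G (x, (z i').1)) (g := fun y => H (y, (z l').2))
          (by fun_prop) (by fun_prop)]
      · refine le_trans ?_ (h.one_le_pow (k := 3) (l := 4) (by norm_num) _)
        rw [pow_succ' _ 2, mul_assoc]
        gcongr
        refine (h.lintegral_pair_le i' l'
          (F := fun q => (∫⁻ x, G (x, q.1) ∂μX) * ∫⁻ y, H (y, q.2) ∂μY) (by fun_prop)).trans ?_
        rw [lintegral_prod_mul hGm.aemeasurable hm.aemeasurable, lintegral_prod_symm' H hH,
          lintegral_prod_symm' G hG]
  · push Not at hc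
    refine (lintegral_pi_le_of_update (A := A) P i
      (F' := fun z => (∫⁻ x, G (x, (z i').1) ∂μX) * H ((z l).2, (z l').2))
      (by fun_prop) fun z => ?_).trans ?_
    · simp only [Function.update_self, Function.update_of_ne hi.symm,
        Function.update_of_ne hc.1, Function.update_of_ne hc.2]
      rw [lintegral_mul_const _ (by fun_prop), ← mul_assoc]
      gcongr
      exact h.lintegral_fst_le (F := fun x => G (x, (z i').1)) (by fun_prop)
    · rw [pow_succ' _ 3, mul_assoc]
      gcongr
      refine (h.lintegral_triple_le i' hl hGm hH).trans ?_
      rw [lintegral_prod_symm' G hG]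

end Dominated

/-! ### Orthonormal bases of `L²` -/

section Basis

variable {Z ι : Type*} [MeasurableSpace Z] {ν : Measure Z} {p : ι → Z → ℝ}

theorem IsL2Basis.memLp (h : IsL2Basis ν p) (i : ι) : MemLp (p i) 2 ν := by
  obtain ⟨b, hb⟩ := h.exists_basis
  exact (memLp_congr_ae (hb i)).1 (Lp.memLp (b i))

theorem IsL2Basis.integral_mul [DecidableEq ι] (h : IsL2Basis ν p) (i j : ι) :
    ∫ z, p i z * p j z ∂ν = if i = j then 1 else 0 := by
  obtain ⟨b, hb⟩ := h.exists_basis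
  rw [← orthonormal_iff_ite.1 b.orthonormal i j, L2.inner_def]
  refine integral_congr_ae ?_
  filter_upwards [hb i, hb j] with z h1 h2
  simp [h1, h2, mul_comm]

theorem IsL2Basis.integrable_mul (h : IsL2Basis ν p) (i j : ι) :
    Integrable (fun z => p i z * p j z) ν := (h.memLp i).integrable_mul (h.memLp j)

/-- Parseval's identity. -/
theorem IsL2Basis.tsum_sq_integral (h : IsL2Basis ν p) {g : Z → ℝ} (hg : MemLp g 2 ν) :
    ∑' i, ENNReal.ofReal ((∫ z, g z * p i z ∂ν) ^ 2) = ∫⁻ z, ENNReal.ofReal (g z ^ 2) ∂ν := by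
  obtain ⟨b, hb⟩ := h.exists_basis
  have h1 := b.hasSum_inner_mul_inner hg.toLp hg.toLp
  have h2 : ∀ i, inner ℝ hg.toLp (b i) * inner ℝ (b i) hg.toLp = (∫ z, g z * p i z ∂ν) ^ 2 := by
    intro i
    rw [real_inner_comm, sq]
    have : inner ℝ (b i) hg.toLp = ∫ z, g z * p i z ∂ν := by
      rw [L2.inner_def]
      refine integral_congr_ae ?_
      filter_upwards [hb i, hg.coeFn_toLp] with z h3 h4
      simp [h3, h4]
    rw [← this, real_inner_comm]
  simp_rw [h2] at h1
  rw [← ENNReal.ofReal_tsum_of_nonneg (fun i => sq_nonneg _) h1.summable, h1.tsum_eq,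
    L2.inner_def, ← ofReal_integral_eq_lintegral_ofReal hg.integrable_sq
      (ae_of_all _ fun z => sq_nonneg _)]
  congr 1
  refine integral_congr_ae ?_
  filter_upwards [hg.coeFn_toLp] with z h3
  simp [h3, sq]

theorem IsL2Basis.lintegral_sq_sum (h : IsL2Basis ν p) (S : Finset ι) (c : ι → ℝ) :
    ∫⁻ z, ENNReal.ofReal ((∑ i ∈ S, c i * p i z) ^ 2) ∂ν = ENNReal.ofReal (∑ i ∈ S, c i ^ 2) := by
  classical
  have h1 : ∀ z, (∑ i ∈ S, c i * p i z) ^ 2 =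
      ∑ i ∈ S, ∑ j ∈ S, c i * c j * (p i z * p j z) := fun z => by
    rw [sq, Finset.sum_mul_sum]
    exact Finset.sum_congr rfl fun i _ => Finset.sum_congr rfl fun j _ => by ring
  have hint : ∀ i ∈ S, ∀ j ∈ S, Integrable (fun z => c i * c j * (p i z * p j z)) ν :=
    fun i _ j _ => (h.integrable_mul i j).const_mul _
  rw [← ofReal_integral_eq_lintegral_ofReal _ (ae_of_all _ fun z => sq_nonneg _)]
  · congr 1
    simp_rw [h1]
    rw [integral_finsetSum _ fun i hi => integrable_finsetSum _ (hint i hi)]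
    refine Finset.sum_congr rfl fun i hi => ?_
    rw [integral_finsetSum _ (hint i hi), Finset.sum_eq_single i]
    · rw [integral_const_mul, h.integral_mul, if_pos rfl]; ring
    · intro j _ hj
      rw [integral_const_mul, h.integral_mul, if_neg hj.symm, mul_zero]
    · exact fun hi' => absurd hi hi'
  · simp_rw [h1]
    exact integrable_finsetSum _ fun i hi => integrable_finsetSum _ (hint i hi)

/-- This is the squared Hilbert–Schmidt norm of an orthogonal projection, equal to its rank. It
brings the number of basis functions into the variance. -/
theorem IsL2Basis.lintegral_kernel_sq [SFinite ν] (h : IsL2Basis ν p) (S : Finset ι) :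
    ∫⁻ z, ENNReal.ofReal ((∑ i ∈ S, p i z.1 * p i z.2) ^ 2) ∂(ν.prod ν) = S.card := by
  have hm := h.measurable
  rw [lintegral_prod _ (by fun_prop)]
  simp only
  simp_rw [h.lintegral_sq_sum S]
  have h1 : ∀ i, ∫⁻ z, ENNReal.ofReal (p i z ^ 2) ∂ν = 1 := fun i => by
    simpa using h.lintegral_sq_sum {i} fun _ => 1
  simp_rw [ENNReal.ofReal_sum_of_nonneg fun i _ => sq_nonneg _]
  rw [lintegral_finsetSum _ fun i _ => by fun_prop]
  simp [h1]

theorem lintegral_prod_sq_sum {Z' κ : Type*} [MeasurableSpace Z'] {ν' : Measure Z'}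
    [SFinite ν] [SFinite ν'] {p' : κ → Z' → ℝ} (h : IsL2Basis ν p) (h' : IsL2Basis ν' p')
    (S : Finset ι) (S' : Finset κ) (c : ι × κ → ℝ) :
    ∫⁻ z, ENNReal.ofReal ((∑ q ∈ S ×ˢ S', c q * (p q.1 z.1 * p' q.2 z.2)) ^ 2) ∂(ν.prod ν') =
      ENNReal.ofReal (∑ q ∈ S ×ˢ S', c q ^ 2) := by
  have hm := h.measurable
  have hm' := h'.measurable
  rw [lintegral_prod _ (by fun_prop)]
  have h1 : ∀ (x : Z) (y : Z'), ∑ q ∈ S ×ˢ S', c q * (p q.1 x * p' q.2 y) =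
      ∑ k ∈ S', (∑ i ∈ S, c (i, k) * p i x) * p' k y := fun x y => by
    rw [Finset.sum_product_right]
    refine Finset.sum_congr rfl fun k _ => ?_
    rw [Finset.sum_mul]
    exact Finset.sum_congr rfl fun i _ => by ring
  simp_rw [h1, h'.lintegral_sq_sum S', ENNReal.ofReal_sum_of_nonneg fun i _ => sq_nonneg _]
  rw [lintegral_finsetSum _ fun k _ => by fun_prop]
  simp_rw [h.lintegral_sq_sum S, ENNReal.ofReal_sum_of_nonneg fun i _ => sq_nonneg _]
  rw [Finset.sum_product_right]

end Basis
end USP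

namespace USP

/-! ### Second moments of the statistic -/

section SecondMoment

open Finset
open scoped BigOperators NNReal

theorem memLp_two_of_lintegral_sq_le {Ω : Type*} [MeasurableSpace Ω] {μ : Measure Ω} {f : Ω → ℝ}
    (hf : AEStronglyMeasurable f μ) {c : ℝ} (hc : 0 ≤ c)
    (h : ∫⁻ ω, ENNReal.ofReal (f ω ^ 2) ∂μ ≤ ENNReal.ofReal c) :
    MemLp f 2 μ ∧ ∫ ω, f ω ^ 2 ∂μ ≤ c := by
  have hint : Integrable (fun ω => f ω ^ 2) μ := by
    refine ⟨hf.pow 2, ?_⟩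
    rw [hasFiniteIntegral_iff_ofReal (ae_of_all _ fun ω => sq_nonneg _)]
    exact h.trans_lt ENNReal.ofReal_lt_top
  refine ⟨(memLp_two_iff_integrable_sq hf).2 hint, ?_⟩
  rw [← ENNReal.ofReal_le_ofReal_iff hc,
    ofReal_integral_eq_lintegral_ofReal hint (ae_of_all _ fun ω => sq_nonneg _)]
  exact h

theorem integral_sq_sum_eq {Ω T : Type*} [MeasurableSpace Ω] {μ : Measure Ω} [Fintype T]
    {W : T → Ω → ℝ} (hW : ∀ t, MemLp (W t) 2 μ)
    (h : ∀ s t, s ≠ t → ∫ ω, W s ω * W t ω ∂μ = 0) :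
    ∫ ω, (∑ t, W t ω) ^ 2 ∂μ = ∑ t, ∫ ω, W t ω ^ 2 ∂μ := by
  have h1 : ∀ ω, (∑ t, W t ω) ^ 2 = ∑ s, ∑ t, W s ω * W t ω := fun ω => by rw [sq, sum_mul_sum]
  have hint : ∀ s t, Integrable (fun ω => W s ω * W t ω) μ := fun s t =>
    (hW s).integrable_mul (hW t)
  simp_rw [h1]
  rw [integral_finsetSum _ fun s _ => integrable_finsetSum _ fun t _ => hint s t]
  refine sum_congr rfl fun s _ => ?_
  rw [integral_finsetSum _ fun t _ => hint s t,
    sum_eq_single s (fun t _ hts => h s t hts.symm) (by simp)]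
  simp_rw [sq]

/-- Functions of disjoint sets of coordinates of an i.i.d. sample are independent. -/
theorem indepFun_of_dependsOn {Z ι : Type*} [MeasurableSpace Z] [Fintype ι]
    {P : Measure Z} [IsProbabilityMeasure P] {f g : (ι → Z) → ℝ} (hf : Measurable f)
    (hg : Measurable g) (S T : Finset ι) (hST : Disjoint S T) (hfS : DependsOn f S)
    (hgT : DependsOn g T) : IndepFun f g (Measure.pi fun _ : ι => P) := by
  classical
  obtain ⟨z₀⟩ : Nonempty Z := nonempty_of_isProbabilityMeasure P
  -- Filling the missing coordinates with a fixed point exhibits `f` and `g` as functions of the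
  -- restrictions to `S` and `T`.
  let ext (S : Finset ι) (w : S → Z) : ι → Z := fun i => if h : i ∈ S then w ⟨i, h⟩ else z₀
  have hext : ∀ S, Measurable (ext S) := fun S => by
    refine measurable_pi_lambda _ fun i => ?_
    by_cases h : i ∈ S
    · simpa [ext, h] using measurable_pi_apply _
    · simp [ext, h]
  have key := (iIndepFun_pi (μ := fun _ : ι => P) (X := fun _ z => z)
    fun _ => aemeasurable_id).indepFun_finset S T hST fun i => measurable_pi_apply i
  have h2 := key.comp (hf.comp (hext S)) (hg.comp (hext T))
  convert h2 using 1
  · funext z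
    exact hfS fun i hi => by simp only [ext]; rw [dif_pos (by simpa using hi)]
  · funext z
    exact hgT fun i hi => by simp only [ext]; rw [dif_pos (by simpa using hi)]

variable {𝒳 𝒴 ι κ : Type*} {n : ℕ}

/-- The elementary covariance estimator from the observations `s` and `t`. -/
noncomputable def covEst (pX : ι → 𝒳 → ℝ) (pY : κ → 𝒴 → ℝ) (q : ι × κ) (s t : Fin n)
    (z : Fin n → 𝒳 × 𝒴) : ℝ :=
  (pX q.1 (z s).1 - pX q.1 (z t).1) * (pY q.2 (z s).2 - pY q.2 (z t).2) / 2

theorem covEst_dependsOn (pX : ι → 𝒳 → ℝ) (pY : κ → 𝒴 → ℝ) (q : ι × κ) (s t : Fin n)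
    {S : Set (Fin n)} (hs : s ∈ S) (ht : t ∈ S) : DependsOn (covEst pX pY q s t) S := by
  intro z w h
  simp only [covEst, h s hs, h t ht]

/-- The covariance of `p_j(X)` and `p_k(Y)`. -/
noncomputable def covCoeff [MeasurableSpace 𝒳] [MeasurableSpace 𝒴] (pX : ι → 𝒳 → ℝ)
    (pY : κ → 𝒴 → ℝ) (P : Measure (𝒳 × 𝒴)) (q : ι × κ) : ℝ :=
  ∫ z, pX q.1 z.1 * pY q.2 z.2 ∂P - (∫ z, pX q.1 z.1 ∂P) * ∫ z, pY q.2 z.2 ∂P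

variable [MeasurableSpace 𝒳] [MeasurableSpace 𝒴] {μX : Measure 𝒳} {μY : Measure 𝒴}
  {A : ℝ≥0} {P : Measure (𝒳 × 𝒴)} {pX : ι → 𝒳 → ℝ} {pY : κ → 𝒴 → ℝ}

theorem measurable_covEst (hX : ∀ j, Measurable (pX j)) (hY : ∀ k, Measurable (pY k)) (q : ι × κ)
    (s t : Fin n) : Measurable (covEst (n := n) pX pY q s t) := by
  unfold covEst; fun_prop

theorem measurable_covKernel (hX : ∀ j, Measurable (pX j)) (hY : ∀ k, Measurable (pY k))
    (M : Finset (ι × κ)) (a b : Fin 4 → Fin n) :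
    Measurable fun z => covKernel (n := n) pX pY M z a b := by
  unfold covKernel; fun_prop

theorem sq_sub_sub_add_le (k₁ k₂ k₃ k₄ : ℝ) :
    (k₁ - k₂ - k₃ + k₄) ^ 2 ≤ 4 * (k₁ ^ 2 + k₂ ^ 2 + k₃ ^ 2 + k₄ ^ 2) := by
  nlinarith [sq_nonneg (k₁ + k₂), sq_nonneg (k₁ + k₃), sq_nonneg (k₁ - k₄), sq_nonneg (k₂ - k₃),
    sq_nonneg (k₂ + k₄), sq_nonneg (k₃ + k₄)]

theorem IsDominated.memLp_fst (h : IsDominated μX μY A P) (hX : IsL2Basis μX pX) (j : ι) :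
    MemLp (fun z : 𝒳 × 𝒴 => pX j z.1) 2 P := by
  have h1 : MemLp (pX j) 2 (P.map Prod.fst) :=
    (hX.memLp j).of_measure_le_smul ENNReal.coe_ne_top h.le_fst
  exact (memLp_map_measure_iff h1.1 measurable_fst.aemeasurable).1 h1

theorem IsDominated.memLp_snd (h : IsDominated μX μY A P) (hY : IsL2Basis μY pY) (k : κ) :
    MemLp (fun z : 𝒳 × 𝒴 => pY k z.2) 2 P := by
  have h1 : MemLp (pY k) 2 (P.map Prod.snd) :=
    (hY.memLp k).of_measure_le_smul ENNReal.coe_ne_top h.le_snd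
  exact (memLp_map_measure_iff h1.1 measurable_snd.aemeasurable).1 h1

theorem integral_pi_eval {Z : Type*} [MeasurableSpace Z] (P : Measure Z) [IsProbabilityMeasure P]
    (i : Fin n) {f : Z → ℝ} (hf : Measurable f) :
    ∫ z, f (z i) ∂(Measure.pi fun _ : Fin n => P) = ∫ w, f w ∂P := by
  have := integral_map (μ := Measure.pi fun _ : Fin n => P) (φ := Function.eval i)
    (measurable_pi_apply i).aemeasurable hf.aestronglyMeasurable
  rw [(measurePreserving_eval (fun _ : Fin n => P) i).map_eq] at this
  exact this.symm

/-- Of the four products, the two with equal indices have the joint moment as mean and the two mixed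
ones, by independence, the product of the means; the factor 1/2 makes the estimator unbiased. -/
theorem IsDominated.integral_covEst (h : IsDominated μX μY A P) (hX : IsL2Basis μX pX)
    (hY : IsL2Basis μY pY) (q : ι × κ) {s t : Fin n} (hst : s ≠ t) :
    ∫ z, covEst pX pY q s t z ∂(Measure.pi fun _ : Fin n => P) = covCoeff pX pY P q := by
  have := h.prob
  have hXm := hX.measurable
  have hYm := hY.measurable
  set u : Fin n → (Fin n → 𝒳 × 𝒴) → ℝ := fun i z => pX q.1 (z i).1 with hu
  set v : Fin n → (Fin n → 𝒳 × 𝒴) → ℝ := fun i z => pY q.2 (z i).2 with hv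
  have hu2 : ∀ i, MemLp (u i) 2 (Measure.pi fun _ : Fin n => P) := fun i =>
    (h.memLp_fst hX q.1).comp_measurePreserving (measurePreserving_eval (fun _ : Fin n => P) i)
  have hv2 : ∀ i, MemLp (v i) 2 (Measure.pi fun _ : Fin n => P) := fun i =>
    (h.memLp_snd hY q.2).comp_measurePreserving (measurePreserving_eval (fun _ : Fin n => P) i)
  have hI : ∀ i l, Integrable (fun z => u i z * v l z) (Measure.pi fun _ : Fin n => P) :=
    fun i l => (hu2 i).integrable_mul (hv2 l)
  have hd : ∀ i, ∫ z, u i z * v i z ∂(Measure.pi fun _ : Fin n => P) =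
      ∫ z, pX q.1 z.1 * pY q.2 z.2 ∂P := fun i =>
    integral_pi_eval P i (f := fun w => pX q.1 w.1 * pY q.2 w.2) (by fun_prop)
  have ho : ∀ i l, i ≠ l → ∫ z, u i z * v l z ∂(Measure.pi fun _ : Fin n => P) =
      (∫ z, pX q.1 z.1 ∂P) * ∫ z, pY q.2 z.2 ∂P := by
    intro i l hil
    rw [(indepFun_of_dependsOn (P := P) (f := u i) (g := v l) (by fun_prop) (by fun_prop) {i} {l}
      (by simpa using hil) (fun z w hzw => by simp only [hu, hzw i (by simp)])
      (fun z w hzw => by simp only [hv, hzw l (by simp)])).integral_fun_mul_eq_mul_integral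
      (hu2 i).1 (hv2 l).1]
    congr 1
    · exact integral_pi_eval P i (f := fun w => pX q.1 w.1) (by fun_prop)
    · exact integral_pi_eval P l (f := fun w => pY q.2 w.2) (by fun_prop)
  have he : ∀ z, covEst pX pY q s t z =
      (u s z * v s z - u s z * v t z - u t z * v s z + u t z * v t z) / 2 := fun z => by
    simp only [covEst, hu, hv]; ring
  simp_rw [he]
  have hI1 : Integrable (fun z => u s z * v s z - u s z * v t z)
    (Measure.pi fun _ : Fin n => P) := (hI _ _).sub (hI _ _)
  have hI2 : Integrable (fun z => u s z * v s z - u s z * v t z - u t z * v s z)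
    (Measure.pi fun _ : Fin n => P) := hI1.sub (hI _ _)
  rw [integral_div, integral_add hI2 (hI _ _), integral_sub hI1 (hI _ _), integral_sub (hI _ _) (hI _ _), hd, hd,
    ho s t hst, ho t s hst.symm, covCoeff]
  ring

variable [SFinite μX] [SFinite μY]

/-- On a product set the kernel factors into a function of the first coordinates and one of the
second, each a signed sum of four projection kernels. The index maps `a` and `b` may overlap
arbitrarily, as is needed for permuted data. -/
theorem IsDominated.covKernel_sq (h : IsDominated μX μY A P) (hX : IsL2Basis μX pX)
    (hY : IsL2Basis μY pY) (S : Finset ι) (T : Finset κ) {a b : Fin 4 → Fin n}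
    (ha : Function.Injective a) (hb : Function.Injective b) :
    MemLp (fun z => covKernel pX pY (S ×ˢ T) z a b) 2 (Measure.pi fun _ : Fin n => P) ∧
    ∫ z, covKernel pX pY (S ×ˢ T) z a b ^ 2 ∂(Measure.pi fun _ : Fin n => P) ≤
      16 * A ^ 4 * (S ×ˢ T).card := by
  have hXm := hX.measurable
  have hYm := hY.measurable
  refine memLp_two_of_lintegral_sq_le (measurable_covKernel hXm hYm _ _ _).aestronglyMeasurable
    (by positivity) ?_
  let G : 𝒳 × 𝒳 → ℝ := fun x => ∑ j ∈ S, pX j x.1 * pX j x.2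
  let H : 𝒴 × 𝒴 → ℝ := fun y => ∑ k ∈ T, pY k y.1 * pY k y.2
  -- The position pairs in the expansion of (u₀ - u₁)(u₂ - u₃). Their entries differ, as
  -- `lintegral_quadruple_le` requires.
  let J : Fin 4 → Fin 4 × Fin 4 := ![(0, 2), (0, 3), (1, 2), (1, 3)]
  have hJ : ∀ s, (J s).1 ≠ (J s).2 := by decide
  have hGm : Measurable G := by fun_prop
  have hHm : Measurable H := by fun_prop
  let g : Fin 4 → (Fin n → 𝒳 × 𝒴) → ℝ := fun s z => G ((z (a (J s).1)).1, (z (a (J s).2)).1)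
  let k : Fin 4 → (Fin n → 𝒳 × 𝒴) → ℝ := fun s z => H ((z (b (J s).1)).2, (z (b (J s).2)).2)
  have hfac : ∀ z, covKernel pX pY (S ×ˢ T) z a b =
      (g 0 z - g 1 z - g 2 z + g 3 z) * (k 0 z - k 1 z - k 2 z + k 3 z) / 4 := by
    intro z
    have e1 : g 0 z - g 1 z - g 2 z + g 3 z = ∑ j ∈ S,
        (pX j (z (a 0)).1 - pX j (z (a 1)).1) * (pX j (z (a 2)).1 - pX j (z (a 3)).1) := by
      simp only [g, G, J, ← sum_sub_distrib, ← sum_add_distrib]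
      exact sum_congr rfl fun j _ => by simp; ring
    have e2 : k 0 z - k 1 z - k 2 z + k 3 z = ∑ j ∈ T,
        (pY j (z (b 0)).2 - pY j (z (b 1)).2) * (pY j (z (b 2)).2 - pY j (z (b 3)).2) := by
      simp only [k, H, J, ← sum_sub_distrib, ← sum_add_distrib]
      exact sum_congr rfl fun j _ => by simp; ring
    rw [e1, e2, sum_mul_sum, sum_div, covKernel, sum_product]
    refine sum_congr rfl fun i _ => ?_
    rw [sum_div]
    exact sum_congr rfl fun j _ => by ring
  -- Each factor contributes a 4 and the denominator is 4², so the constant is 1; the 16 of the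
  -- statement counts the terms.
  have hbound : ∀ z, covKernel pX pY (S ×ˢ T) z a b ^ 2 ≤ ∑ s, ∑ t, g s z ^ 2 * k t z ^ 2 := by
    intro z
    have e1 := sq_sub_sub_add_le (g 0 z) (g 1 z) (g 2 z) (g 3 z)
    have e2 := sq_sub_sub_add_le (k 0 z) (k 1 z) (k 2 z) (k 3 z)
    rw [hfac, div_pow, mul_pow, ← sum_mul_sum, Fin.sum_univ_four, Fin.sum_univ_four]
    have := mul_le_mul e1 e2 (sq_nonneg _) (by positivity)
    linarith
  have hterm : ∀ s t, ∫⁻ z, ENNReal.ofReal (g s z ^ 2) * ENNReal.ofReal (k t z ^ 2)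
      ∂(Measure.pi fun _ : Fin n => P) ≤ A ^ 4 * (S.card * T.card) := by
    intro s t
    have := h.lintegral_quadruple_le (ha.ne (hJ s)) (hb.ne (hJ t))
      (G := fun x => ENNReal.ofReal (G x ^ 2)) (H := fun y => ENNReal.ofReal (H y ^ 2))
      (by fun_prop) (by fun_prop)
    rwa [hX.lintegral_kernel_sq S, hY.lintegral_kernel_sq T] at this
  calc ∫⁻ z, ENNReal.ofReal (covKernel pX pY (S ×ˢ T) z a b ^ 2) ∂(Measure.pi fun _ : Fin n => P)
      ≤ ∫⁻ z, ∑ s, ∑ t, ENNReal.ofReal (g s z ^ 2) * ENNReal.ofReal (k t z ^ 2)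
          ∂(Measure.pi fun _ : Fin n => P) := by
        refine lintegral_mono fun z => (ENNReal.ofReal_le_ofReal (hbound z)).trans_eq ?_
        rw [ENNReal.ofReal_sum_of_nonneg fun s _ => by positivity]
        refine sum_congr rfl fun s _ => ?_
        rw [ENNReal.ofReal_sum_of_nonneg fun s _ => by positivity]
        exact sum_congr rfl fun t _ => ENNReal.ofReal_mul (sq_nonneg _)
    _ = ∑ s, ∑ t, ∫⁻ z, ENNReal.ofReal (g s z ^ 2) * ENNReal.ofReal (k t z ^ 2)
          ∂(Measure.pi fun _ : Fin n => P) := by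
        rw [lintegral_finsetSum _ fun s _ => by fun_prop]
        exact sum_congr rfl fun s _ => lintegral_finsetSum _ fun t _ => by fun_prop
    _ ≤ ∑ s : Fin 4, ∑ t : Fin 4, (A : ℝ≥0∞) ^ 4 * (S.card * T.card) :=
        sum_le_sum fun s _ => sum_le_sum fun t _ => hterm s t
    _ = ENNReal.ofReal (16 * A ^ 4 * (S ×ˢ T).card) := by
        rw [card_product]
        simp only [sum_const, card_univ, Fintype.card_fin, nsmul_eq_mul]
        rw [ENNReal.ofReal_mul (by positivity), ENNReal.ofReal_mul (by positivity),
          ENNReal.ofReal_pow (by positivity), ENNReal.ofReal_coe_nnreal, ENNReal.ofReal_natCast]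
        push_cast
        simp only [ENNReal.ofReal_ofNat]
        ring

theorem IsDominated.sum_covEst_sq (h : IsDominated μX μY A P) (hX : IsL2Basis μX pX)
    (hY : IsL2Basis μY pY) (S : Finset ι) (T : Finset κ) (c : ι × κ → ℝ) (s t : Fin n) :
    MemLp (fun z => ∑ q ∈ S ×ˢ T, c q * covEst pX pY q s t z) 2 (Measure.pi fun _ : Fin n => P) ∧
    ∫ z, (∑ q ∈ S ×ˢ T, c q * covEst pX pY q s t z) ^ 2 ∂(Measure.pi fun _ : Fin n => P) ≤
      4 * A ^ 2 * ∑ q ∈ S ×ˢ T, c q ^ 2 := by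
  have hXm := hX.measurable
  have hYm := hY.measurable
  have hem := fun q => measurable_covEst (n := n) hXm hYm q s t
  refine memLp_two_of_lintegral_sq_le (by fun_prop)
    (mul_nonneg (by positivity) (sum_nonneg fun q _ => sq_nonneg _)) ?_
  let g : 𝒳 × 𝒴 → ℝ := fun z => ∑ q ∈ S ×ˢ T, c q * (pX q.1 z.1 * pY q.2 z.2)
  have hgm : Measurable g := by fun_prop
  let e : Fin n → Fin n → (Fin n → 𝒳 × 𝒴) → ℝ := fun s t z => g ((z s).1, (z t).2)
  have hbound : ∀ z, (∑ q ∈ S ×ˢ T, c q * covEst pX pY q s t z) ^ 2 ≤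
      e s s z ^ 2 + e s t z ^ 2 + e t s z ^ 2 + e t t z ^ 2 := by
    intro z
    have e1 : ∑ q ∈ S ×ˢ T, c q * covEst pX pY q s t z =
        (e s s z - e s t z - e t s z + e t t z) / 2 := by
      simp only [e, g, ← sum_sub_distrib, ← sum_add_distrib, sum_div, covEst]
      exact sum_congr rfl fun j _ => by ring
    rw [e1]
    have := sq_sub_sub_add_le (e s s z) (e s t z) (e t s z) (e t t z)
    linarith
  have hterm : ∀ s t, ∫⁻ z, ENNReal.ofReal (e s t z ^ 2) ∂(Measure.pi fun _ : Fin n => P) ≤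
      A ^ 2 * ENNReal.ofReal (∑ q ∈ S ×ˢ T, c q ^ 2) := by
    intro s t
    have := h.lintegral_pair_le s t (F := fun z => ENNReal.ofReal (g z ^ 2)) (by fun_prop)
    rwa [lintegral_prod_sq_sum hX hY S T c] at this
  calc ∫⁻ z, ENNReal.ofReal ((∑ q ∈ S ×ˢ T, c q * covEst pX pY q s t z) ^ 2)
        ∂(Measure.pi fun _ : Fin n => P)
      ≤ ∫⁻ z, (ENNReal.ofReal (e s s z ^ 2) + ENNReal.ofReal (e s t z ^ 2) +
          ENNReal.ofReal (e t s z ^ 2) + ENNReal.ofReal (e t t z ^ 2))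
          ∂(Measure.pi fun _ : Fin n => P) := by
        refine lintegral_mono fun z => (ENNReal.ofReal_le_ofReal (hbound z)).trans_eq ?_
        rw [ENNReal.ofReal_add (by positivity) (by positivity),
          ENNReal.ofReal_add (by positivity) (by positivity),
          ENNReal.ofReal_add (by positivity) (by positivity)]
    _ = _ := by
        rw [lintegral_add_left (by fun_prop), lintegral_add_left (by fun_prop),
          lintegral_add_left (by fun_prop)]
    _ ≤ A ^ 2 * ENNReal.ofReal (∑ q ∈ S ×ˢ T, c q ^ 2) +
        A ^ 2 * ENNReal.ofReal (∑ q ∈ S ×ˢ T, c q ^ 2) +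
        A ^ 2 * ENNReal.ofReal (∑ q ∈ S ×ˢ T, c q ^ 2) +
        A ^ 2 * ENNReal.ofReal (∑ q ∈ S ×ˢ T, c q ^ 2) := by
        gcongr <;> exact hterm _ _
    _ = ENNReal.ofReal (4 * A ^ 2 * ∑ q ∈ S ×ˢ T, c q ^ 2) := by
        rw [ENNReal.ofReal_mul (by positivity), ENNReal.ofReal_mul (by positivity),
          ENNReal.ofReal_pow (by positivity), ENNReal.ofReal_coe_nnreal]
        simp only [ENNReal.ofReal_ofNat]
        ring

theorem IsDominated.memLp_covEst (h : IsDominated μX μY A P) (hX : IsL2Basis μX pX)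
    (hY : IsL2Basis μY pY) (q : ι × κ) (s t : Fin n) :
    MemLp (covEst pX pY q s t) 2 (Measure.pi fun _ : Fin n => P) := by
  simpa using (h.sum_covEst_sq hX hY {q.1} {q.2} (fun _ => 1) s t).1

end SecondMoment
end USP

namespace USP

/-! ### Variance of the statistic and second moment of its permuted version -/

section Variance

open Finset
open scoped BigOperators NNReal

variable {𝒳 𝒴 ι κ : Type*} {n m : ℕ} [MeasurableSpace 𝒳] [MeasurableSpace 𝒴] {μX : Measure 𝒳}
  {μY : Measure 𝒴} {A : ℝ≥0} {P : Measure (𝒳 × 𝒴)} {pX : ι → 𝒳 → ℝ} {pY : κ → 𝒴 → ℝ}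

theorem integral_sq_sub_mean {Ω : Type*} [MeasurableSpace Ω] {ν : Measure Ω}
    [IsProbabilityMeasure ν] {f : Ω → ℝ} (hf : MemLp f 2 ν) {D : ℝ} (hD : ∫ ω, f ω ∂ν = D) :
    ∫ ω, (f ω - D) ^ 2 ∂ν = ∫ ω, f ω ^ 2 ∂ν - D ^ 2 := by
  have e1 : ∀ ω, (f ω - D) ^ 2 = f ω ^ 2 - 2 * D * f ω + D ^ 2 := fun ω => by ring
  have i1 : Integrable (fun ω => f ω ^ 2) ν := hf.integrable_sq
  have i2 : Integrable (fun ω => 2 * D * f ω) ν := (hf.integrable one_le_two).const_mul _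
  have i3 : Integrable (fun ω => f ω ^ 2 - 2 * D * f ω) ν := i1.sub i2
  simp_rw [e1]
  rw [integral_add i3 (integrable_const _), integral_sub i1 i2, integral_const_mul, hD]
  simp only [integral_const, probReal_univ, smul_eq_mul, one_mul]
  ring

theorem integral_sq_expect_le {Ω T : Type*} [MeasurableSpace Ω] {ν : Measure Ω} [Fintype T]
    {W : T → Ω → ℝ} (hW : ∀ t, MemLp (W t) 2 ν)
    (h : ∀ s t, s ≠ t → ∫ ω, W s ω * W t ω ∂ν = 0) {V : ℝ} (hV : ∀ t, ∫ ω, W t ω ^ 2 ∂ν ≤ V) :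
    ∫ ω, (𝔼 t, W t ω) ^ 2 ∂ν ≤ V / Fintype.card T := by
  simp_rw [Fintype.expect_eq_sum_div_card, div_pow]
  rw [integral_div, integral_sq_sum_eq hW h]
  have h1 : ∑ t, ∫ ω, W t ω ^ 2 ∂ν ≤ Fintype.card T * V := by
    refine (sum_le_sum fun t _ => hV t).trans_eq ?_
    simp
  rcases isEmpty_or_nonempty T with hT | hT
  · simp
  have hc : (0 : ℝ) < Fintype.card T := by exact_mod_cast Fintype.card_pos
  rw [div_le_div_iff₀ (by positivity) hc]
  nlinarith

theorem memLp_expect {Ω T : Type*} [MeasurableSpace Ω] {ν : Measure Ω} [Fintype T]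
    {W : T → Ω → ℝ} (hW : ∀ t, MemLp (W t) 2 ν) : MemLp (fun ω => 𝔼 t, W t ω) 2 ν := by
  simp_rw [Fintype.expect_eq_sum_div_card, div_eq_mul_inv]
  exact (memLp_finsetSum _ fun t _ => hW t).mul_const _

/-- The second moment of an average over a square grid whose entries split into two one-way
effects and an interaction, all of them orthogonal families. -/
theorem integral_sq_expect_add_le {Ω : Type*} [MeasurableSpace Ω] {ν : Measure Ω} (hm : 0 < m)
    {L L' : Fin m → Ω → ℝ} {G : Fin m × Fin m → Ω → ℝ} (hL : ∀ a, MemLp (L a) 2 ν)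
    (hL' : ∀ a, MemLp (L' a) 2 ν) (hG : ∀ p, MemLp (G p) 2 ν)
    (oL : ∀ a b, a ≠ b → ∫ z, L a z * L b z ∂ν = 0)
    (oL' : ∀ a b, a ≠ b → ∫ z, L' a z * L' b z ∂ν = 0)
    (oG : ∀ p p', p ≠ p' → ∫ z, G p z * G p' z ∂ν = 0) {W V : ℝ}
    (hLW : ∀ a, ∫ z, L a z ^ 2 ∂ν ≤ W) (hLW' : ∀ a, ∫ z, L' a z ^ 2 ∂ν ≤ W)
    (hGV : ∀ p, ∫ z, G p z ^ 2 ∂ν ≤ V) :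
    MemLp (fun z => 𝔼 p : Fin m × Fin m, (L p.1 z + L' p.2 z + G p z)) 2 ν ∧
    ∫ z, (𝔼 p : Fin m × Fin m, (L p.1 z + L' p.2 z + G p z)) ^ 2 ∂ν ≤
      6 * W / m + 3 * V / m ^ 2 := by
  have : Nonempty (Fin m) := ⟨⟨0, hm⟩⟩
  refine ⟨memLp_expect fun p => ((hL _).add (hL' _)).add (hG _), ?_⟩
  have e1 : ∀ z, 𝔼 p : Fin m × Fin m, (L p.1 z + L' p.2 z + G p z) =
      (𝔼 a, L a z) + (𝔼 b, L' b z) + 𝔼 p, G p z := by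
    intro z
    rw [expect_add_distrib, expect_add_distrib, ← univ_product_univ, expect_product,
      expect_product]
    simp only [Fintype.expect_const]
  have h1 := integral_sq_expect_le hL oL hLW
  have h2 := integral_sq_expect_le hL' oL' hLW'
  have h3 := integral_sq_expect_le hG oG hGV
  rw [Fintype.card_fin] at h1 h2
  rw [Fintype.card_prod, Fintype.card_fin] at h3
  have i1 := (memLp_expect hL).integrable_sq
  have i2 := (memLp_expect hL').integrable_sq
  have i3 := (memLp_expect hG).integrable_sq
  have i4 : Integrable (fun z => (𝔼 a, L a z) ^ 2 + (𝔼 b, L' b z) ^ 2) ν := i1.add i2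
  simp_rw [e1]
  calc ∫ z, ((𝔼 a, L a z) + (𝔼 b, L' b z) + 𝔼 p, G p z) ^ 2 ∂ν
      ≤ ∫ z, 3 * ((𝔼 a, L a z) ^ 2 + (𝔼 b, L' b z) ^ 2 + (𝔼 p, G p z) ^ 2) ∂ν := by
        refine integral_mono ?_ ((i4.add i3).const_mul _) fun z => ?_
        · exact (((memLp_expect hL).add (memLp_expect hL')).add (memLp_expect hG)).integrable_sq
        · simp only
          nlinarith [sq_nonneg ((𝔼 a, L a z) - 𝔼 b, L' b z), sq_nonneg ((𝔼 a, L a z) - 𝔼 p, G p z),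
            sq_nonneg ((𝔼 b, L' b z) - 𝔼 p, G p z)]
    _ = 3 * ((∫ z, (𝔼 a, L a z) ^ 2 ∂ν) + (∫ z, (𝔼 b, L' b z) ^ 2 ∂ν) +
          ∫ z, (𝔼 p, G p z) ^ 2 ∂ν) := by
        rw [integral_const_mul, integral_add i4 i3, integral_add i1 i2]
    _ ≤ 3 * (W / m + W / m + V / ((m * m : ℕ) : ℝ)) := by gcongr
    _ = _ := by push_cast; ring

/-- A centred function of some coordinates is orthogonal to every function of the others. -/
theorem integral_mul_eq_zero_of_dependsOn {Z ι : Type*} [MeasurableSpace Z] [Fintype ι]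
    [DecidableEq ι] {P : Measure Z} [IsProbabilityMeasure P] {f g : (ι → Z) → ℝ}
    (hf : Measurable f) (hg : Measurable g) (S : Finset ι) (hfS : DependsOn f S)
    (hgS : DependsOn g (Sᶜ : Finset ι)) (h0 : ∫ z, f z ∂(Measure.pi fun _ : ι => P) = 0) :
    ∫ z, f z * g z ∂(Measure.pi fun _ : ι => P) = 0 := by
  rw [(indepFun_of_dependsOn hf hg S Sᶜ disjoint_compl_right hfS hgS).integral_fun_mul_eq_mul_integral
    hf.aestronglyMeasurable hg.aestronglyMeasurable, h0, zero_mul]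

variable [SFinite μX] [SFinite μY]

set_option maxHeartbeats 1000000 in
-- A Hoeffding-type decomposition over block pairs. The first half of one block and the second half
-- of another involve different observations even when the blocks coincide, so all products of
-- estimators are unbiased. The linear parts average over m blocks and have variance proportional to
-- D; the interactions average over m² pairs and have variance proportional to the number of
-- coefficients.
theorem IsDominated.integral_sq_block_sub_le (h : IsDominated μX μY A P) (hX : IsL2Basis μX pX)
    (hY : IsL2Basis μY pY) (S : Finset ι) (T : Finset κ) (hm : 0 < m) (B : Fin m → Fin 4 → Fin n)
    (hB : ∀ a b s t, B a s = B b t ↔ a = b ∧ s = t) :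
    MemLp (fun z => (𝔼 p : Fin m × Fin m, ∑ q ∈ S ×ˢ T,
        covEst pX pY q (B p.1 0) (B p.1 1) z * covEst pX pY q (B p.2 2) (B p.2 3) z) -
        ∑ q ∈ S ×ˢ T, covCoeff pX pY P q ^ 2) 2 (Measure.pi fun _ : Fin n => P) ∧
    ∫ z, ((𝔼 p : Fin m × Fin m, ∑ q ∈ S ×ˢ T,
        covEst pX pY q (B p.1 0) (B p.1 1) z * covEst pX pY q (B p.2 2) (B p.2 3) z) -
        ∑ q ∈ S ×ˢ T, covCoeff pX pY P q ^ 2) ^ 2 ∂(Measure.pi fun _ : Fin n => P) ≤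
      24 * A ^ 2 * (∑ q ∈ S ×ˢ T, covCoeff pX pY P q ^ 2) / m +
        768 * A ^ 4 * (S ×ˢ T).card / m ^ 2 := by
  have := h.prob
  set ν : Measure (Fin n → 𝒳 × 𝒴) := Measure.pi fun _ : Fin n => P with hν
  set c : ι × κ → ℝ := covCoeff pX pY P with hc
  set D : ℝ := ∑ q ∈ S ×ˢ T, c q ^ 2 with hD
  set N : ℝ := ((S ×ˢ T).card : ℝ) with hN
  set e : ι × κ → Fin m → Fin 4 → Fin 4 → (Fin n → 𝒳 × 𝒴) → ℝ :=
    fun q a s t => covEst pX pY q (B a s) (B a t) with he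
  have hem : ∀ q a s t, Measurable (e q a s t) := fun q a s t =>
    measurable_covEst hX.measurable hY.measurable q _ _
  have heL : ∀ q a s t, MemLp (e q a s t) 2 ν := fun q a s t => h.memLp_covEst hX hY q _ _
  have heI : ∀ q a s t, s ≠ t → ∫ z, e q a s t z ∂ν = c q := fun q a s t hst =>
    h.integral_covEst hX hY q fun h' => hst ((hB _ _ _ _).1 h').2
  have heD : ∀ q a s t (R : Set (Fin n)), B a s ∈ R → B a t ∈ R → DependsOn (e q a s t) R :=
    fun q a s t R h1 h2 => covEst_dependsOn pX pY q _ _ h1 h2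
  -- the centred estimators
  let x : ι × κ → Fin m → (Fin n → 𝒳 × 𝒴) → ℝ := fun q a z => e q a 0 1 z - c q
  let y : ι × κ → Fin m → (Fin n → 𝒳 × 𝒴) → ℝ := fun q b z => e q b 2 3 z - c q
  have hxm : ∀ q a, Measurable (x q a) := fun q a => (hem q a 0 1).sub_const _
  have hym : ∀ q a, Measurable (y q a) := fun q a => (hem q a 2 3).sub_const _
  have hxL : ∀ q a, MemLp (x q a) 2 ν := fun q a => (heL q a 0 1).sub (memLp_const _)
  have hyL : ∀ q a, MemLp (y q a) 2 ν := fun q a => (heL q a 2 3).sub (memLp_const _)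
  have hI1 : ∀ {f : (Fin n → 𝒳 × 𝒴) → ℝ}, MemLp f 2 ν → Integrable f ν := fun hf =>
    hf.integrable one_le_two
  have hx0 : ∀ q a, ∫ z, x q a z ∂ν = 0 := fun q a => by
    rw [integral_sub (hI1 (heL q a 0 1)) (integrable_const _), heI q a 0 1 (by decide)]; simp
  have hy0 : ∀ q a, ∫ z, y q a z ∂ν = 0 := fun q a => by
    rw [integral_sub (hI1 (heL q a 2 3)) (integrable_const _), heI q a 2 3 (by decide)]; simp
  have hxD : ∀ q a (R : Set (Fin n)), B a 0 ∈ R → B a 1 ∈ R → DependsOn (x q a) R :=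
    fun q a R h1 h2 z w hzw => by simp only [x, heD q a 0 1 R h1 h2 hzw]
  have hyD : ∀ q a (R : Set (Fin n)), B a 2 ∈ R → B a 3 ∈ R → DependsOn (y q a) R :=
    fun q a R h1 h2 z w hzw => by simp only [y, heD q a 2 3 R h1 h2 hzw]
  -- Expanding (c + x)(c + y) in each summand gives `K` = `D` + `L` + `L'` + `G`; `E` is the
  -- uncentred form of the linear parts.
  let K : Fin m × Fin m → (Fin n → 𝒳 × 𝒴) → ℝ := fun p z =>
    ∑ q ∈ S ×ˢ T, e q p.1 0 1 z * e q p.2 2 3 z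
  let E : Fin m → Fin 4 → Fin 4 → (Fin n → 𝒳 × 𝒴) → ℝ := fun a s t z =>
    ∑ q ∈ S ×ˢ T, c q * e q a s t z
  let L : Fin m → (Fin n → 𝒳 × 𝒴) → ℝ := fun a z => ∑ q ∈ S ×ˢ T, c q * x q a z
  let L' : Fin m → (Fin n → 𝒳 × 𝒴) → ℝ := fun a z => ∑ q ∈ S ×ˢ T, c q * y q a z
  let G : Fin m × Fin m → (Fin n → 𝒳 × 𝒴) → ℝ := fun p z =>
    ∑ q ∈ S ×ˢ T, x q p.1 z * y q p.2 z
  have hLE : ∀ a z, L a z = E a 0 1 z - D := fun a z => by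
    simp only [L, E, x, hD, ← sum_sub_distrib]
    exact sum_congr rfl fun q _ => by ring
  have hLE' : ∀ a z, L' a z = E a 2 3 z - D := fun a z => by
    simp only [L', E, y, hD, ← sum_sub_distrib]
    exact sum_congr rfl fun q _ => by ring
  have hGK : ∀ p z, G p z = K p z - E p.2 2 3 z - E p.1 0 1 z + D := fun p z => by
    simp only [G, K, E, x, y, hD, ← sum_sub_distrib, ← sum_add_distrib]
    exact sum_congr rfl fun q _ => by ring
  have hKinj : ∀ p : Fin m × Fin m, Function.Injective
      fun t : Fin 4 => B (if t = 0 ∨ t = 1 then p.1 else p.2) t :=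
    fun p s t hst => ((hB _ _ _ _).1 hst).2
  have hK : ∀ p, MemLp (K p) 2 ν ∧ ∫ z, K p z ^ 2 ∂ν ≤ 16 * A ^ 4 * N := fun p =>
    h.covKernel_sq hX hY S T (hKinj p) (hKinj p)
  have hE : ∀ a s t, MemLp (E a s t) 2 ν ∧ ∫ z, E a s t z ^ 2 ∂ν ≤ 4 * A ^ 2 * D :=
    fun a s t => h.sum_covEst_sq hX hY S T c _ _
  have hLL : ∀ a, MemLp (L a) 2 ν := fun a => by
    rw [show L a = fun z => E a 0 1 z - D from funext (hLE a)]
    exact (hE a 0 1).1.sub (memLp_const _)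
  have hLL' : ∀ a, MemLp (L' a) 2 ν := fun a => by
    rw [show L' a = fun z => E a 2 3 z - D from funext (hLE' a)]
    exact (hE a 2 3).1.sub (memLp_const _)
  have hGL : ∀ p, MemLp (G p) 2 ν := fun p => by
    rw [show G p = fun z => K p z - E p.2 2 3 z - E p.1 0 1 z + D from funext (hGK p)]
    exact (((hK p).1.sub (hE p.2 2 3).1).sub (hE p.1 0 1).1).add (memLp_const _)
  have hLm : ∀ a, Measurable (L a) := fun a => by fun_prop
  have hLm' : ∀ a, Measurable (L' a) := fun a => by fun_prop
  have hGm : ∀ p, Measurable (G p) := fun p => by fun_prop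
  have hEI : ∀ a s t, s ≠ t → ∫ z, E a s t z ∂ν = D := fun a s t hst => by
    simp only [E]
    rw [integral_finsetSum _ fun q _ => (hI1 (heL q a s t)).const_mul _]
    refine sum_congr rfl fun q _ => ?_
    rw [integral_const_mul, heI q a s t hst, sq]
  have hL0 : ∀ a, ∫ z, L a z ∂ν = 0 := fun a => by
    simp_rw [hLE]
    rw [integral_sub (hI1 (hE a 0 1).1) (integrable_const _), hEI a 0 1 (by decide)]; simp
  have hL0' : ∀ a, ∫ z, L' a z ∂ν = 0 := fun a => by
    simp_rw [hLE']
    rw [integral_sub (hI1 (hE a 2 3).1) (integrable_const _), hEI a 2 3 (by decide)]; simp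
  have hvar : ∀ a s t, s ≠ t → ∫ z, (E a s t z - D) ^ 2 ∂ν ≤ 4 * A ^ 2 * D := by
    intro a s t hst
    rw [integral_sq_sub_mean (hE a s t).1 (hEI a s t hst)]
    linarith [(hE a s t).2, sq_nonneg D]
  have hKI : ∀ p, ∫ z, K p z ∂ν = D := by
    intro p
    simp only [K]
    have i1 : ∀ q, Integrable (fun z => e q p.1 0 1 z * e q p.2 2 3 z) ν := fun q =>
      (heL q p.1 0 1).integrable_mul (heL q p.2 2 3)
    rw [integral_finsetSum _ fun q _ => i1 q]
    refine sum_congr rfl fun q _ => ?_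
    rw [(indepFun_of_dependsOn (P := P) (hem q p.1 0 1) (hem q p.2 2 3) {B p.1 0, B p.1 1}
      {B p.2 2, B p.2 3} (by simp [hB]) (heD _ _ _ _ _ (by simp) (by simp))
      (heD _ _ _ _ _ (by simp) (by simp))).integral_fun_mul_eq_mul_integral (heL q p.1 0 1).1
      (heL q p.2 2 3).1, heI _ _ _ _ (by decide), heI _ _ _ _ (by decide), sq]
  -- `D` is the mean of `K p`, so its square is at most the second moment.
  have hDsq : D ^ 2 ≤ 16 * A ^ 4 * N := by
    have p : Fin m × Fin m := ⟨⟨0, hm⟩, ⟨0, hm⟩⟩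
    have h1 : 0 ≤ ∫ z, (K p z - D) ^ 2 ∂ν := integral_nonneg fun z => sq_nonneg _
    rw [integral_sq_sub_mean (hK p).1 (hKI p)] at h1
    linarith [(hK p).2]
  have hDN : D ≤ 4 * A ^ 2 * N := by
    have hN2 : N ≤ N ^ 2 := by
      rw [hN]; exact_mod_cast Nat.le_self_pow two_ne_zero _
    refine abs_le_of_sq_le_sq' ?_ (by positivity) |>.2
    calc D ^ 2 ≤ 16 * A ^ 4 * N := hDsq
      _ ≤ 16 * A ^ 4 * N ^ 2 := by gcongr
      _ = (4 * A ^ 2 * N) ^ 2 := by ring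
  -- `G` is a signed sum of four terms, each with second moment at most 16 A⁴ N, and squaring costs
  -- a further factor 4 per term.
  have hG2 : ∀ p, ∫ z, G p z ^ 2 ∂ν ≤ 256 * A ^ 4 * N := by
    intro p
    have i1 := (hK p).1.integrable_sq
    have i2 := (hE p.2 2 3).1.integrable_sq
    have i3 := (hE p.1 0 1).1.integrable_sq
    have i4 : Integrable (fun z => K p z ^ 2 + E p.2 2 3 z ^ 2) ν := i1.add i2
    have i5 : Integrable (fun z => K p z ^ 2 + E p.2 2 3 z ^ 2 + E p.1 0 1 z ^ 2) ν := i4.add i3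
    have h1 : ∫ z, G p z ^ 2 ∂ν ≤
        ∫ z, 4 * (K p z ^ 2 + E p.2 2 3 z ^ 2 + E p.1 0 1 z ^ 2 + D ^ 2) ∂ν :=
      integral_mono (hGL p).integrable_sq ((i5.add (integrable_const _)).const_mul _)
        fun z => by
          simp only [hGK]
          exact sq_sub_sub_add_le _ _ _ _
    rw [integral_const_mul, integral_add i5 (integrable_const _), integral_add i4 i3,
      integral_add i1 i2] at h1
    simp only [integral_const, probReal_univ, smul_eq_mul, one_mul] at h1
    have hA : 4 * (A : ℝ) ^ 2 * D ≤ 16 * A ^ 4 * N := by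
      have := mul_le_mul_of_nonneg_left hDN (by positivity : (0 : ℝ) ≤ 4 * A ^ 2)
      linarith
    linarith [(hK p).2, (hE p.2 2 3).2, (hE p.1 0 1).2]
  -- orthogonality
  have oL : ∀ a b, a ≠ b → ∫ z, L a z * L b z ∂ν = 0 := fun a b hab =>
    integral_mul_eq_zero_of_dependsOn (hLm a) (hLm b) {B a 0, B a 1}
      (fun z w hzw => sum_congr rfl fun q _ => by
        rw [hxD q a _ (by simp) (by simp) hzw])
      (fun z w hzw => sum_congr rfl fun q _ => by
        rw [hxD q b _ (by simp [hB, hab.symm]) (by simp [hB, hab.symm]) hzw]) (hL0 a)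
  have oL' : ∀ a b, a ≠ b → ∫ z, L' a z * L' b z ∂ν = 0 := fun a b hab =>
    integral_mul_eq_zero_of_dependsOn (hLm' a) (hLm' b) {B a 2, B a 3}
      (fun z w hzw => sum_congr rfl fun q _ => by
        rw [hyD q a _ (by simp) (by simp) hzw])
      (fun z w hzw => sum_congr rfl fun q _ => by
        rw [hyD q b _ (by simp [hB, hab.symm]) (by simp [hB, hab.symm]) hzw]) (hL0' a)
  have oG : ∀ p p', p ≠ p' → ∫ z, G p z * G p' z ∂ν = 0 := by
    intro p p' hp
    have hGD : ∀ R : Set (Fin n), B p'.1 0 ∈ R → B p'.1 1 ∈ R → B p'.2 2 ∈ R → B p'.2 3 ∈ R →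
        DependsOn (G p') R := fun R h0 h1 h2 h3 z w hzw => sum_congr rfl fun q _ => by
      rw [hxD q _ R h0 h1 hzw, hyD q _ R h2 h3 hzw]
    -- a centred factor of `G p` that is independent of all the others
    obtain ⟨f, g, hf0, hfL, hfm, hgI, hgm, hfg, R, hfR, hgR⟩ :
        ∃ f g : ι × κ → (Fin n → 𝒳 × 𝒴) → ℝ, (∀ q, ∫ z, f q z ∂ν = 0) ∧ (∀ q, MemLp (f q) 2 ν) ∧
          (∀ q, Measurable (f q)) ∧ (∀ q, Integrable (g q) ν) ∧ (∀ q, Measurable (g q)) ∧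
          (∀ q z, x q p.1 z * y q p.2 z * G p' z = f q z * g q z) ∧ ∃ R : Finset (Fin n),
          (∀ q, DependsOn (f q) R) ∧ ∀ q, DependsOn (g q) (Rᶜ : Finset (Fin n)) := by
      by_cases hp1 : p.1 = p'.1
      · have hp2 : p.2 ≠ p'.2 := fun h2 => hp (Prod.ext hp1 h2)
        refine ⟨fun q => y q p.2, fun q z => x q p.1 z * G p' z, fun q => hy0 q _,
          fun q => hyL q _, fun q => hym q _, fun q => (hxL q p.1).integrable_mul (hGL p'),
          fun q => (hxm q _).mul (hGm p'), fun q z => by ring, {B p.2 2, B p.2 3},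
          fun q => hyD q _ _ (by simp) (by simp), fun q z w hzw => ?_⟩
        simp only
        rw [hxD q p.1 _ (by simp [hB]) (by simp [hB]) hzw, hGD _ (by simp [hB]) (by simp [hB])
          (by simp [hB, hp2.symm]) (by simp [hB, hp2.symm]) hzw]
      · refine ⟨fun q => x q p.1, fun q z => y q p.2 z * G p' z, fun q => hx0 q _,
          fun q => hxL q _, fun q => hxm q _, fun q => (hyL q p.2).integrable_mul (hGL p'),
          fun q => (hym q _).mul (hGm p'), fun q z => by ring, {B p.1 0, B p.1 1},
          fun q => hxD q _ _ (by simp) (by simp), fun q z w hzw => ?_⟩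
        simp only
        rw [hyD q p.2 _ (by simp [hB]) (by simp [hB]) hzw, hGD _ (by simp [hB, Ne.symm hp1])
          (by simp [hB, Ne.symm hp1]) (by simp [hB]) (by simp [hB]) hzw]
    have e1 : ∀ z, G p z * G p' z = ∑ q ∈ S ×ˢ T, f q z * g q z := fun z => by
      simp only [← hfg, ← sum_mul]
      rfl
    simp_rw [e1]
    -- `g q` is a product of two L² functions, so only its integrability is available; independence
    -- from `f q` makes the product integrable.
    have i1 : ∀ q, Integrable (fun z => f q z * g q z) ν := fun q =>
      (indepFun_of_dependsOn (hfm q) (hgm q) R Rᶜ disjoint_compl_right (hfR q)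
        (hgR q)).integrable_mul (hI1 (hfL q)) (hgI q)
    rw [integral_finsetSum _ fun q _ => i1 q]
    exact sum_eq_zero fun q _ =>
      integral_mul_eq_zero_of_dependsOn (hfm q) (hgm q) R (hfR q) (hgR q) (hf0 q)
  have hsplit : ∀ z, (𝔼 p : Fin m × Fin m, K p z) - D =
      𝔼 p : Fin m × Fin m, (L p.1 z + L' p.2 z + G p z) := fun z => by
    have : Nonempty (Fin m × Fin m) := ⟨⟨⟨0, hm⟩, ⟨0, hm⟩⟩⟩
    rw [← Fintype.expect_const (ι := Fin m × Fin m) D, ← expect_sub_distrib]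
    refine expect_congr rfl fun p _ => ?_
    rw [hLE, hLE', hGK]
    ring
  have hfin := integral_sq_expect_add_le hm hLL hLL' hGL oL oL' oG
    (fun a => by simp_rw [hLE]; exact hvar a 0 1 (by decide))
    (fun a => by simp_rw [hLE']; exact hvar a 2 3 (by decide)) hG2
  simp_rw [← hsplit] at hfin
  refine ⟨hfin.1, hfin.2.trans_eq ?_⟩
  ring

/-- Each relabelling `σ` of the observations gives a block average with the same bound, and Jensen
carries it to the average over `σ`. -/
theorem IsDominated.integral_sq_Dhat_sub_le (h : IsDominated μX μY A P) (hX : IsL2Basis μX pX)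
    (hY : IsL2Basis μY pY) (S : Finset ι) (T : Finset κ) (hm : 0 < m) (hmn : 4 * m ≤ n) :
    Integrable (fun z => (Dhat pX pY (S ×ˢ T) z - ∑ q ∈ S ×ˢ T, covCoeff pX pY P q ^ 2) ^ 2)
      (Measure.pi fun _ : Fin n => P) ∧
    ∫ z, (Dhat pX pY (S ×ˢ T) z - ∑ q ∈ S ×ˢ T, covCoeff pX pY P q ^ 2) ^ 2
        ∂(Measure.pi fun _ : Fin n => P) ≤
      24 * A ^ 2 * (∑ q ∈ S ×ˢ T, covCoeff pX pY P q ^ 2) / m +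
        768 * A ^ 4 * (S ×ˢ T).card / m ^ 2 := by
  have := h.prob
  set D := ∑ q ∈ S ×ˢ T, covCoeff pX pY P q ^ 2 with hD
  let R : Equiv.Perm (Fin n) → (Fin n → 𝒳 × 𝒴) → ℝ := fun σ z => (𝔼 p : Fin m × Fin m,
    covKernel pX pY (S ×ˢ T) z (σ ∘ blockPair hmn p) (σ ∘ blockPair hmn p)) - D
  have hR : ∀ σ, MemLp (R σ) 2 (Measure.pi fun _ : Fin n => P) ∧
      ∫ z, R σ z ^ 2 ∂(Measure.pi fun _ : Fin n => P) ≤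
        24 * A ^ 2 * D / m + 768 * A ^ 4 * (S ×ˢ T).card / m ^ 2 := fun σ =>
    h.integral_sq_block_sub_le hX hY S T hm (fun a t => σ (blockIndex hmn a t)) fun a b s t => by
      rw [σ.injective.eq_iff, blockIndex_inj]
  have hDR : ∀ z, Dhat pX pY (S ×ˢ T) z - D = 𝔼 σ, R σ z := fun z => by
    rw [Dhat_eq_expect_blocks hm hmn, expect_sub_distrib, Fintype.expect_const]
  simp_rw [hDR]
  refine ⟨(memLp_expect fun σ => (hR σ).1).integrable_sq, ?_⟩
  have hI : Integrable (fun z => 𝔼 σ, R σ z ^ 2) (Measure.pi fun _ : Fin n => P) := by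
    simp_rw [Fintype.expect_eq_sum_div_card]
    exact (integrable_finsetSum _ fun σ _ => (hR σ).1.integrable_sq).div_const _
  refine (integral_mono (memLp_expect fun σ => (hR σ).1).integrable_sq hI
    fun z => sq_expect_le _).trans ?_
  simp_rw [Fintype.expect_eq_sum_div_card]
  rw [integral_div, integral_finsetSum _ fun σ _ => (hR σ).1.integrable_sq,
    ← Fintype.expect_eq_sum_div_card]
  exact expect_le univ_nonempty fun σ _ => (hR σ).2

/-- The cross terms have already vanished for fixed data, so only the m² diagonal moments from
`covKernel_sq` remain. Unlike the variance bound, there is no term of order 1/m. -/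
theorem IsDominated.integral_expect_sq_Dhat_permuteData_le (h : IsDominated μX μY A P)
    (hX : IsL2Basis μX pX) (hY : IsL2Basis μY pY) (S : Finset ι) (T : Finset κ) (hm : 0 < m)
    (hmn : 4 * m ≤ n) :
    Integrable (fun z => 𝔼 σ : Equiv.Perm (Fin n), Dhat pX pY (S ×ˢ T) (permuteData σ z) ^ 2)
      (Measure.pi fun _ : Fin n => P) ∧
    ∫ z, 𝔼 σ : Equiv.Perm (Fin n), Dhat pX pY (S ×ˢ T) (permuteData σ z) ^ 2
        ∂(Measure.pi fun _ : Fin n => P) ≤ 16 * A ^ 4 * (S ×ˢ T).card / m ^ 2 := by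
  have := h.prob
  set ν := Measure.pi fun _ : Fin n => P with hν
  let K : Equiv.Perm (Fin n) → Equiv.Perm (Fin n) → Fin m × Fin m → (Fin n → 𝒳 × 𝒴) → ℝ :=
    fun τ π p z => covKernel pX pY (S ×ˢ T) z (τ ∘ blockPair hmn p) (π ∘ blockPair hmn p)
  have hK : ∀ τ π p, MemLp (K τ π p) 2 ν ∧ ∫ z, K τ π p z ^ 2 ∂ν ≤ 16 * A ^ 4 * (S ×ˢ T).card :=
    fun τ π p => h.covKernel_sq hX hY S T (τ.injective.comp (blockPair hmn p).injective)
      (π.injective.comp (blockPair hmn p).injective)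
  have hKi := fun τ π p => (hK τ π p).1.integrable_sq
  have hm' : (m : ℝ) ≠ 0 := by positivity
  have iE : ∀ {G : Type} [Fintype G] {f : G → (Fin n → 𝒳 × 𝒴) → ℝ},
      (∀ g, Integrable (f g) ν) → Integrable (fun z => 𝔼 g, f g z) ν := fun hf => by
    simp_rw [Fintype.expect_eq_sum_div_card]
    exact (integrable_finsetSum _ fun g _ => hf g).div_const _
  have eE : ∀ {G : Type} [Fintype G] {f : G → (Fin n → 𝒳 × 𝒴) → ℝ},
      (∀ g, Integrable (f g) ν) → ∫ z, 𝔼 g, f g z ∂ν = 𝔼 g, ∫ z, f g z ∂ν := fun hf => by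
    simp_rw [Fintype.expect_eq_sum_div_card]
    rw [integral_div, integral_finsetSum _ fun g _ => hf g]
  have hbI : Integrable (fun z => (1 / (m : ℝ) ^ 4) * ∑ p, 𝔼 τ, 𝔼 π, K τ π p z ^ 2) ν :=
    (integrable_finsetSum _ fun p _ => iE fun τ => iE fun π => hKi τ π p).const_mul _
  have hle : ∀ z, 𝔼 σ : Equiv.Perm (Fin n), Dhat pX pY (S ×ˢ T) (permuteData σ z) ^ 2 ≤
      (1 / (m : ℝ) ^ 4) * ∑ p, 𝔼 τ, 𝔼 π, K τ π p z ^ 2 := fun z =>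
    expect_sq_Dhat_permuteData_le hm hmn pX pY (S ×ˢ T) z
  have hmeas : Measurable fun z : Fin n → 𝒳 × 𝒴 =>
      𝔼 σ : Equiv.Perm (Fin n), Dhat pX pY (S ×ˢ T) (permuteData σ z) ^ 2 := by
    simp_rw [Fintype.expect_eq_sum_div_card]
    exact (Finset.measurable_sum _ fun σ _ => ((measurable_Dhat hX.measurable hY.measurable _).comp
      (measurable_permuteData σ)).pow_const 2).div_const _
  have hI : Integrable (fun z => 𝔼 σ : Equiv.Perm (Fin n),
      Dhat pX pY (S ×ˢ T) (permuteData σ z) ^ 2) ν :=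
    hbI.mono' hmeas.aestronglyMeasurable (ae_of_all _ fun z => by
      rw [Real.norm_of_nonneg (expect_nonneg fun σ _ => sq_nonneg _)]
      exact hle z)
  refine ⟨hI, (integral_mono hI hbI hle).trans ?_⟩
  rw [integral_const_mul, integral_finsetSum _ fun p _ => iE fun τ => iE fun π => hKi τ π p]
  have h1 : ∀ p, ∫ z, 𝔼 τ, 𝔼 π, K τ π p z ^ 2 ∂ν ≤ 16 * A ^ 4 * (S ×ˢ T).card := fun p => by
    rw [eE fun τ => iE fun π => hKi τ π p]
    refine expect_le univ_nonempty fun τ _ => ?_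
    rw [eE fun π => hKi τ π p]
    exact expect_le univ_nonempty fun π _ => (hK τ π p).2
  calc (1 / (m : ℝ) ^ 4) * ∑ p, ∫ z, 𝔼 τ, 𝔼 π, K τ π p z ^ 2 ∂ν
      ≤ (1 / (m : ℝ) ^ 4) * ∑ p : Fin m × Fin m, 16 * A ^ 4 * ((S ×ˢ T).card : ℝ) := by
        gcongr with p
        exact h1 p
    _ = _ := by
        simp only [sum_const, card_univ, Fintype.card_prod, Fintype.card_fin, nsmul_eq_mul]
        push_cast
        field_simp

end Variance
end USP

namespace USP

/-! ### Densities -/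

section Density

open scoped NNReal

theorem memLp_mul_prod {𝒳 𝒴 : Type*} [MeasurableSpace 𝒳] [MeasurableSpace 𝒴] {μX : Measure 𝒳}
    {μY : Measure 𝒴} [SigmaFinite μX] [SigmaFinite μY] {u : 𝒳 → ℝ} {v : 𝒴 → ℝ}
    (hu : MemLp u 2 μX) (hv : MemLp v 2 μY) :
    MemLp (fun z : 𝒳 × 𝒴 => u z.1 * v z.2) 2 (μX.prod μY) := by
  refine (memLp_two_iff_integrable_sq (hu.1.comp_fst.mul hv.1.comp_snd)).2 ?_
  have := hu.integrable_sq.mul_prod hv.integrable_sq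
  simpa only [Pi.mul_apply, mul_pow] using this

theorem memLp_two_of_integrable_of_bounded {Z : Type*} [MeasurableSpace Z] {ν : Measure Z}
    {f : Z → ℝ} (hf : Integrable f ν) {c : ℝ} (hc : ∀ z, ‖f z‖ ≤ c) : MemLp f 2 ν := by
  refine (memLp_two_iff_integrable_sq hf.1).2 ?_
  simp_rw [sq]
  exact hf.bdd_mul hf.1 (ae_of_all _ hc)

variable {𝒳 𝒴 ι κ : Type*} [MeasurableSpace 𝒳] [MeasurableSpace 𝒴] {μX : Measure 𝒳}
  {μY : Measure 𝒴} {pX : ι → 𝒳 → ℝ} {pY : κ → 𝒴 → ℝ} {f : 𝒳 × 𝒴 → ℝ} {A : ℝ}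

theorem IsDensity.integrable (hf : IsDensity μX μY f) : Integrable f (μX.prod μY) := by
  by_contra h
  have := hf.integral_eq_one
  rw [integral_undef h] at this
  exact zero_ne_one this

theorem integral_law (hf : IsDensity μX μY f) (u : 𝒳 × 𝒴 → ℝ) :
    ∫ z, u z ∂(law μX μY f) = ∫ z, f z * u z ∂(μX.prod μY) := by
  rw [law, integral_withDensity_eq_integral_toReal_smul₀
    hf.integrable.1.aemeasurable.ennreal_ofReal (ae_of_all _ fun _ => ENNReal.ofReal_lt_top)]
  refine integral_congr_ae ?_
  filter_upwards [hf.nonneg] with z hz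
  rw [ENNReal.toReal_ofReal hz, smul_eq_mul]

theorem integrable_law (hf : IsDensity μX μY f) {u : 𝒳 × 𝒴 → ℝ} (hu : Integrable u (law μX μY f)) :
    Integrable (fun z => f z * u z) (μX.prod μY) := by
  rw [law, integrable_withDensity_iff_integrable_smul₀'
    hf.integrable.1.aemeasurable.ennreal_ofReal (ae_of_all _ fun _ => ENNReal.ofReal_lt_top)] at hu
  refine hu.congr ?_
  filter_upwards [hf.nonneg] with z hz
  rw [ENNReal.toReal_ofReal hz, smul_eq_mul]

variable [SigmaFinite μX] [SigmaFinite μY]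

/-- Parseval's identity for the tensor product of two orthonormal bases. -/
theorem tsum_sq_integral_prod [Countable ι] [Countable κ] (hX : IsL2Basis μX pX) (hY : IsL2Basis μY pY) {g : 𝒳 × 𝒴 → ℝ}
    (hg : MemLp g 2 (μX.prod μY)) :
    ∑' q : ι × κ, ENNReal.ofReal ((∫ z, g z * (pX q.1 z.1 * pY q.2 z.2) ∂(μX.prod μY)) ^ 2) =
      ∫⁻ z, ENNReal.ofReal (g z ^ 2) ∂(μX.prod μY) := by
  let G : κ → 𝒳 → ℝ := fun k x => ∫ y, g (x, y) * pY k y ∂μY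
  have hGm : ∀ k, AEStronglyMeasurable (G k) μX := fun k =>
    (hg.1.mul ((hY.measurable k).comp measurable_snd).aestronglyMeasurable).integral_prod_right'
  have hsec : ∀ᵐ x ∂μX, MemLp (fun y => g (x, y)) 2 μY := by
    filter_upwards [hg.1.prodMk_left, hg.integrable_sq.prod_right_ae] with x h1 h2
    exact (memLp_two_iff_integrable_sq h1).2 h2
  have hcountable : ∫⁻ z, ENNReal.ofReal (g z ^ 2) ∂(μX.prod μY) =
      ∫⁻ x, ∑' k, ENNReal.ofReal (G k x ^ 2) ∂μX := by
    rw [lintegral_prod _ (hg.1.aemeasurable.pow_const 2).ennreal_ofReal]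
    refine lintegral_congr_ae ?_
    filter_upwards [hsec] with x hx
    exact (hY.tsum_sq_integral hx).symm
  have hGL : ∀ k, MemLp (G k) 2 μX := by
    intro k
    refine (memLp_two_iff_integrable_sq (hGm k)).2 ⟨(hGm k).pow 2, ?_⟩
    rw [hasFiniteIntegral_iff_ofReal (ae_of_all _ fun x => sq_nonneg _)]
    have hfin : ∫⁻ z, ENNReal.ofReal (g z ^ 2) ∂(μX.prod μY) < ∞ :=
      (hasFiniteIntegral_iff_ofReal (ae_of_all _ fun x => sq_nonneg _)).1 hg.integrable_sq.2
    refine lt_of_le_of_lt ?_ (hcountable ▸ hfin)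
    exact lintegral_mono fun x => ENNReal.le_tsum (f := fun k => ENNReal.ofReal (G k x ^ 2)) k
  have hint : ∀ j k, ∫ x, G k x * pX j x ∂μX =
      ∫ z, g z * (pX j z.1 * pY k z.2) ∂(μX.prod μY) := by
    intro j k
    have i1 : Integrable (fun z => g z * (pX j z.1 * pY k z.2)) (μX.prod μY) :=
      hg.integrable_mul (memLp_mul_prod (hX.memLp j) (hY.memLp k))
    rw [integral_prod _ i1]
    refine integral_congr_ae (ae_of_all _ fun x => ?_)
    simp only [G]
    rw [← integral_mul_const]
    exact integral_congr_ae (ae_of_all _ fun y => by ring)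
  rw [hcountable, lintegral_tsum fun k => ((hGm k).aemeasurable.pow_const 2).ennreal_ofReal,
    ENNReal.tsum_prod (f := fun j k => ENNReal.ofReal
      ((∫ z, g z * (pX j z.1 * pY k z.2) ∂(μX.prod μY)) ^ 2)), ENNReal.tsum_comm]
  refine tsum_congr fun k => ?_
  rw [← hX.tsum_sq_integral (hGL k)]
  exact tsum_congr fun j => by rw [hint]

theorem norm_le_of_supNorm_le {Z : Type*} {f : Z → ℝ} (hA : 0 < A)
    (h : supNorm f ≤ ENNReal.ofReal A) (z : Z) : ‖f z‖ ≤ A := by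
  have h1 : ‖f z‖ₑ ≤ ENNReal.ofReal A := (le_iSup (fun z => ‖f z‖ₑ) z).trans h
  rwa [← ofReal_norm, ENNReal.ofReal_le_ofReal_iff hA.le] at h1

/-- The upper bound `max A 1` as a nonnegative real. -/
noncomputable def boundOf (A : ℝ) : ℝ≥0 := (max A 1).toNNReal

theorem coe_boundOf (A : ℝ) : (boundOf A : ℝ) = max A 1 :=
  Real.coe_toNNReal _ (le_trans zero_le_one (le_max_right _ _))

theorem ofReal_le_boundOf {A t : ℝ} (h : t ≤ A) : ENNReal.ofReal t ≤ boundOf A := by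
  rw [boundOf]
  exact ENNReal.ofReal_le_ofReal (h.trans (le_max_left _ _))

theorem map_fst_withDensity_le {f : 𝒳 × 𝒴 → ℝ} (hfI : Integrable f (μX.prod μY))
    (hf0 : ∀ᵐ z ∂(μX.prod μY), 0 ≤ f z) (hA : ∀ x, margX μY f x ≤ A) :
    (law μX μY f).map Prod.fst ≤ boundOf A • μX := by
  refine Measure.le_iff.2 fun S hS => ?_
  rw [Measure.map_apply measurable_fst hS, law, withDensity_apply _ (measurable_fst hS),
    ← Set.prod_univ, ← Measure.prod_restrict, Measure.restrict_univ,
    lintegral_prod _ (by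
      have := hfI.1.aemeasurable.ennreal_ofReal.restrict (s := S ×ˢ Set.univ)
      rwa [← Measure.prod_restrict, Measure.restrict_univ] at this)]
  calc ∫⁻ x in S, ∫⁻ y, ENNReal.ofReal (f (x, y)) ∂μY ∂μX
      ≤ ∫⁻ x in S, boundOf A ∂μX := by
        refine lintegral_mono_ae (ae_restrict_of_ae ?_)
        filter_upwards [hfI.prod_right_ae, Measure.ae_ae_of_ae_prod hf0] with x h1 h2
        rw [← ofReal_integral_eq_lintegral_ofReal h1 h2]
        exact ofReal_le_boundOf (hA x)
    _ = (boundOf A • μX) S := by rw [setLIntegral_const]; rfl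

theorem IsDensity.isDominated (hf : IsDensity μX μY f) (hA : 0 < A)
    (h1 : supNorm f ≤ ENNReal.ofReal A) (h2 : supNorm (margX μY f) ≤ ENNReal.ofReal A)
    (h3 : supNorm (margY μX f) ≤ ENNReal.ofReal A) :
    IsDominated μX μY (boundOf A) (law μX μY f) where
  prob := by
    refine ⟨?_⟩
    rw [law, withDensity_apply _ MeasurableSet.univ, Measure.restrict_univ,
      ← ofReal_integral_eq_lintegral_ofReal hf.integrable hf.nonneg, hf.integral_eq_one,
      ENNReal.ofReal_one]
  one_le := by
    have : (1 : ℝ) ≤ (boundOf A : ℝ) := by rw [coe_boundOf]; exact le_max_right _ _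
    exact_mod_cast this
  le_prod := by
    have h4 : (fun z => ENNReal.ofReal (f z)) ≤ fun _ => (boundOf A : ℝ≥0∞) := fun z =>
      ofReal_le_boundOf ((le_abs_self _).trans (norm_le_of_supNorm_le hA h1 z))
    refine (withDensity_mono (ae_of_all _ h4)).trans_eq ?_
    rw [withDensity_const]
    rfl
  le_fst := map_fst_withDensity_le hf.integrable hf.nonneg fun x =>
    (le_abs_self _).trans (norm_le_of_supNorm_le hA h2 x)
  le_snd := by
    have hm : MeasurePreserving (Prod.swap : 𝒳 × 𝒴 → 𝒴 × 𝒳) (μX.prod μY) (μY.prod μX) :=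
      ⟨measurable_swap, Measure.prod_swap⟩
    have hswap : law μY μX (fun z => f z.swap) = (law μX μY f).map Prod.swap := by
      refine Measure.ext fun S hS => ?_
      rw [law, law, Measure.map_apply measurable_swap hS, withDensity_apply _ hS,
        withDensity_apply _ (measurable_swap hS), ← hm.setLIntegral_comp_preimage_emb
          MeasurableEquiv.prodComm.measurableEmbedding]
      simp
    have := map_fst_withDensity_le (μX := μY) (μY := μX) (f := fun z => f z.swap) (A := A)
      hf.integrable.swap (hm.symm MeasurableEquiv.prodComm |>.quasiMeasurePreserving.ae hf.nonneg)
      fun y => (le_abs_self _).trans (norm_le_of_supNorm_le hA h3 y)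
    rwa [hswap, Measure.map_map measurable_fst measurable_swap] at this

theorem coeffX_eq (hf : IsDensity μX μY f) {j : ι}
    (hj : Integrable (fun z : 𝒳 × 𝒴 => pX j z.1) (law μX μY f)) :
    coeffX μX μY pX f j = ∫ z, pX j z.1 ∂(law μX μY f) := by
  rw [integral_law hf, integral_prod _ (integrable_law hf hj)]
  exact integral_congr_ae (ae_of_all _ fun x => (integral_mul_const _ _).symm)

theorem coeffY_eq (hf : IsDensity μX μY f) {k : κ}
    (hk : Integrable (fun z : 𝒳 × 𝒴 => pY k z.2) (law μX μY f)) :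
    coeffY μX μY pY f k = ∫ z, pY k z.2 ∂(law μX μY f) := by
  rw [integral_law hf, integral_prod_symm _ (integrable_law hf hk)]
  exact integral_congr_ae (ae_of_all _ fun x => (integral_mul_const _ _).symm)

theorem covCoeff_law_eq (hX : IsL2Basis μX pX) (hY : IsL2Basis μY pY) (hf : IsDensity μX μY f)
    (hd : IsDominated μX μY (boundOf A) (law μX μY f)) (q : ι × κ) :
    coeff μX μY pX pY f q.1 q.2 - coeffX μX μY pX f q.1 * coeffY μX μY pY f q.2 =
      covCoeff pX pY (law μX μY f) q := by
  have := hd.prob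
  rw [covCoeff, coeffX_eq hf ((hd.memLp_fst hX q.1).integrable one_le_two),
    coeffY_eq hf ((hd.memLp_snd hY q.2).integrable one_le_two), coeff, ← integral_law hf]

/-- The dependence functional is the sum of the squared covariances of the basis functions. -/
theorem tsum_covCoeff_sq [Countable ι] [Countable κ] (hX : IsL2Basis μX pX) (hY : IsL2Basis μY pY)
    (hf : IsDensity μX μY f) (hA : 0 < A) (h1 : supNorm f ≤ ENNReal.ofReal A)
    (h2 : supNorm (margX μY f) ≤ ENNReal.ofReal A) (h3 : supNorm (margY μX f) ≤ ENNReal.ofReal A) :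
    ∑' q, ENNReal.ofReal (covCoeff pX pY (law μX μY f) q ^ 2) =
      ENNReal.ofReal (dep μX μY f) := by
  have hd := hf.isDominated hA h1 h2 h3
  have hXL : MemLp (margX μY f) 2 μX := memLp_two_of_integrable_of_bounded
    hf.integrable.integral_prod_left (norm_le_of_supNorm_le hA h2)
  have hYL : MemLp (margY μX f) 2 μY := memLp_two_of_integrable_of_bounded
    hf.integrable.integral_prod_right (norm_le_of_supNorm_le hA h3)
  have hpL := memLp_mul_prod hXL hYL
  have hgL : MemLp (fun z => f z - margX μY f z.1 * margY μX f z.2) 2 (μX.prod μY) :=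
    hf.memLp.sub hpL
  rw [dep, ofReal_integral_eq_lintegral_ofReal hgL.integrable_sq
    (ae_of_all _ fun z => sq_nonneg _), ← tsum_sq_integral_prod hX hY hgL]
  refine tsum_congr fun q => ?_
  have hb := memLp_mul_prod (hX.memLp q.1) (hY.memLp q.2)
  congr 2
  rw [← covCoeff_law_eq hX hY hf hd, coeff, coeffX, coeffY, ← integral_prod_mul]
  have i1 : Integrable (fun z => f z * (pX q.1 z.1 * pY q.2 z.2)) (μX.prod μY) :=
    hf.memLp.integrable_mul hb
  have i2 : Integrable (fun z => margX μY f z.1 * pX q.1 z.1 * (margY μX f z.2 * pY q.2 z.2))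
      (μX.prod μY) := (hXL.integrable_mul (hX.memLp q.1)).mul_prod
        (hYL.integrable_mul (hY.memLp q.2))
  rw [← integral_sub i1 i2]
  exact integral_congr_ae (ae_of_all _ fun z => by ring)

end Density

/-! ### Truncation of the Sobolev class -/

section Truncation

variable {dX dY : ℕ}

theorem one_le_norm1 {d : ℕ} {j : Fin d → ℕ} (hj : j ≠ 0) : 1 ≤ norm1 j := by
  by_contra h
  have h0 : norm1 j = 0 := by omega
  exact hj (funext fun i => (Finset.sum_eq_zero_iff.1 h0) i (Finset.mem_univ i))

theorem one_le_sobolevWeight {sX sY : ℝ} (hsX : 0 < sX) (j : Fin dX → ℕ) (k : Fin dY → ℕ) :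
    1 ≤ sobolevWeight sX sY j k := by
  rw [sobolevWeight]
  split_ifs with h
  · rw [← ENNReal.ofReal_one]
    refine ENNReal.ofReal_le_ofReal (le_max_of_le_left (Real.one_le_rpow ?_ hsX.le))
    exact_mod_cast one_le_norm1 h.1
  · exact le_top

theorem le_sobolevWeight {sX sY T : ℝ} (hsX : 0 < sX) (hsY : 0 < sY) {mX mY : ℕ}
    (hmX : T ≤ (mX : ℝ) ^ sX) (hmY : T ≤ (mY : ℝ) ^ sY) {j : Fin dX → ℕ} {k : Fin dY → ℕ}
    (h : (j, k) ∉ multiIndices dX mX ×ˢ multiIndices dY mY) :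
    ENNReal.ofReal T ≤ sobolevWeight sX sY j k := by
  rw [sobolevWeight]
  split_ifs with h0
  · refine ENNReal.ofReal_le_ofReal ?_
    rw [Finset.mem_product, mem_multiIndices, mem_multiIndices] at h
    have hj := one_le_norm1 h0.1
    have hk := one_le_norm1 h0.2
    by_cases hc : norm1 j ≤ mX
    · have hc' : mY ≤ norm1 k := by
        by_contra hc'
        exact h ⟨⟨hj, hc⟩, hk, by simp only; omega⟩
      refine le_max_of_le_right (hmY.trans ?_)
      gcongr
    · refine le_max_of_le_left (hmX.trans ?_)
      have : mX ≤ norm1 j := by omega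
      gcongr
  · exact le_top

/-- Outside the truncation set the weight is at least `T`, being infinite when an index is zero. A
discarded coefficient is thus at most T⁻² times its term in the smoothness sum. -/
theorem sum_truncation_ge {sX sY T r D : ℝ} (hsX : 0 < sX) (hsY : 0 < sY) (hT : 0 < T) {mX mY : ℕ}
    (hmX : T ≤ (mX : ℝ) ^ sX) (hmY : T ≤ (mY : ℝ) ^ sY) (hr : 0 < r)
    (c : (Fin dX → ℕ) × (Fin dY → ℕ) → ℝ)
    (hD : ∑' q, ENNReal.ofReal (c q ^ 2) = ENNReal.ofReal D)
    (hS : ∑' q, sobolevWeight sX sY q.1 q.2 ^ 2 * ENNReal.ofReal (c q ^ 2) ≤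
      ENNReal.ofReal (r ^ 2)) :
    D ≤ ∑ q ∈ multiIndices dX mX ×ˢ multiIndices dY mY, c q ^ 2 + r ^ 2 / T ^ 2 := by
  set M := multiIndices dX mX ×ˢ multiIndices dY mY with hM
  have hT2 : 0 < T ^ 2 := by positivity
  have hterm : ∀ q, ENNReal.ofReal (c q ^ 2) ≤ (if q ∈ M then ENNReal.ofReal (c q ^ 2) else 0) +
      ENNReal.ofReal (1 / T ^ 2) *
        (sobolevWeight sX sY q.1 q.2 ^ 2 * ENNReal.ofReal (c q ^ 2)) := by
    intro q
    by_cases hq : q ∈ M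
    · simp [hq]
    · rw [if_neg hq, zero_add, ← mul_assoc]
      have h1 : (1 : ENNReal) ≤ ENNReal.ofReal (1 / T ^ 2) * sobolevWeight sX sY q.1 q.2 ^ 2 := by
        calc (1 : ENNReal) = ENNReal.ofReal (1 / T ^ 2) * ENNReal.ofReal T ^ 2 := by
              rw [← ENNReal.ofReal_pow hT.le, ← ENNReal.ofReal_mul (by positivity),
                one_div_mul_cancel hT2.ne', ENNReal.ofReal_one]
          _ ≤ _ := by
              gcongr
              exact le_sobolevWeight hsX hsY hmX hmY hq
      exact le_mul_of_one_le_left zero_le h1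
  have h2 : ENNReal.ofReal D ≤ ENNReal.ofReal (∑ q ∈ M, c q ^ 2 + r ^ 2 / T ^ 2) := by
    rw [← hD]
    refine (ENNReal.tsum_le_tsum hterm).trans ?_
    rw [ENNReal.tsum_add, ENNReal.tsum_mul_left, ENNReal.ofReal_add
      (Finset.sum_nonneg fun q _ => sq_nonneg _) (by positivity),
      ENNReal.ofReal_sum_of_nonneg fun q _ => sq_nonneg _]
    gcongr
    · rw [tsum_eq_sum (s := M) fun q hq => if_neg hq]
      exact Finset.sum_le_sum fun q hq => by rw [if_pos hq]
    · rw [div_eq_mul_one_div (r ^ 2), mul_comm (r ^ 2), ENNReal.ofReal_mul (by positivity)]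
      gcongr
  exact (ENNReal.ofReal_le_ofReal_iff (add_nonneg (Finset.sum_nonneg fun q _ => sq_nonneg _)
    (by positivity))).1 h2

theorem le_of_smoothness_le {sX sY r D : ℝ} (hsX : 0 < sX) (c : (Fin dX → ℕ) × (Fin dY → ℕ) → ℝ)
    (hD : ∑' q, ENNReal.ofReal (c q ^ 2) = ENNReal.ofReal D)
    (hS : ∑' q, sobolevWeight sX sY q.1 q.2 ^ 2 * ENNReal.ofReal (c q ^ 2) ≤
      ENNReal.ofReal (r ^ 2)) : D ≤ r ^ 2 := by
  rw [← ENNReal.ofReal_le_ofReal_iff (sq_nonneg r), ← hD]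
  refine le_trans (ENNReal.tsum_le_tsum fun q => ?_) hS
  exact le_mul_of_one_le_left zero_le (one_le_pow₀ (one_le_sobolevWeight hsX _ _))

theorem card_multiIndices_le (d m : ℕ) : (multiIndices d m).card ≤ (m + 1) ^ d := by
  refine (Finset.card_filter_le _ _).trans_eq ?_
  rw [Pi.card_Icc]
  simp

end Truncation
end USP

namespace USP

/-! ### Power of the permutation test from moment bounds -/

section Power

open Finset
open scoped BigOperators

theorem expect_pi_apply {G : Type*} [Fintype G] [Nonempty G] {B : ℕ} (b : Fin B) (F : G → ℝ) :
    𝔼 π : Fin B → G, F (π b) = 𝔼 g, F g := by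
  rw [Fintype.expect_equiv (Equiv.funSplitAt b G) (fun π => F (π b)) (fun q => F q.1)
    fun π => rfl, ← univ_product_univ, expect_product]
  simp only [Fintype.expect_const]

/-- Either the statistic is below D/2 and the first error term is at least 1, or every permuted
statistic that reaches it is at least D/2 and its indicator is at most 4/D² times its square.
Markov's inequality for the count against t(1 + B) then gives the second term. -/
theorem one_sub_le_expect_pValue {𝒳 𝒴 ι κ : Type*} {n B : ℕ} (pX : ι → 𝒳 → ℝ) (pY : κ → 𝒴 → ℝ)
    (M : Finset (ι × κ)) (z : Fin n → 𝒳 × 𝒴) {D t : ℝ} (hD : 0 < D) (ht : 0 < t) :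
    1 - (4 / D ^ 2 * (Dhat pX pY M z - D) ^ 2 + 1 / (t * (1 + B)) *
      (1 + B * (4 / D ^ 2 * 𝔼 σ : Equiv.Perm (Fin n), Dhat pX pY M (permuteData σ z) ^ 2))) ≤
      𝔼 π : Fin B → Equiv.Perm (Fin n), (if pValue pX pY M z π < t then (1 : ℝ) else 0) := by
  have hB : (0 : ℝ) < 1 + B := by positivity
  have hperm : 0 ≤ 𝔼 σ : Equiv.Perm (Fin n), Dhat pX pY M (permuteData σ z) ^ 2 :=
    expect_nonneg fun σ _ => sq_nonneg _
  by_cases hc : Dhat pX pY M z < D / 2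
  · refine le_trans ?_ (expect_nonneg fun π _ => by positivity)
    have h1 : 1 ≤ 4 / D ^ 2 * (Dhat pX pY M z - D) ^ 2 := by
      rw [div_mul_eq_mul_div, le_div_iff₀ (by positivity)]
      nlinarith
    have h2 : 0 ≤ 1 / (t * (1 + B)) * (1 + B * (4 / D ^ 2 *
      𝔼 σ : Equiv.Perm (Fin n), Dhat pX pY M (permuteData σ z) ^ 2)) := by positivity
    linarith
  · push Not at hc
    obtain ⟨F, hFdef⟩ : ∃ F : Equiv.Perm (Fin n) → ℝ, ∀ σ,
        F σ = 4 / D ^ 2 * Dhat pX pY M (permuteData σ z) ^ 2 := ⟨_, fun σ => rfl⟩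
    have hF0 : ∀ σ, 0 ≤ F σ := fun σ => by rw [hFdef]; positivity
    have hF : ∀ σ, (if Dhat pX pY M z ≤ Dhat pX pY M (permuteData σ z) then (1 : ℝ) else 0) ≤
        F σ := by
      intro σ
      split_ifs with h
      · rw [hFdef, div_mul_eq_mul_div, le_div_iff₀ (by positivity)]
        nlinarith
      · exact hF0 σ
    have hpt : ∀ π : Fin B → Equiv.Perm (Fin n),
        1 - 1 / (t * (1 + B)) * (1 + ∑ b, F (π b)) ≤
          if pValue pX pY M z π < t then (1 : ℝ) else 0 := by
      intro π
      have hs : 0 ≤ ∑ b, F (π b) := sum_nonneg fun b _ => hF0 _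
      split_ifs with h
      · have : 0 ≤ 1 / (t * (1 + B)) * (1 + ∑ b, F (π b)) := by positivity
        linarith
      · push Not at h
        rw [pValue, le_div_iff₀ hB] at h
        have h3 : t * (1 + B) ≤ 1 + ∑ b, F (π b) :=
          h.trans (by gcongr with b; exact hF (π b))
        have : 1 ≤ 1 / (t * (1 + B)) * (1 + ∑ b, F (π b)) := by
          rw [div_mul_eq_mul_div, one_mul, le_div_iff₀ (by positivity)]
          linarith
        linarith
    refine le_trans ?_ (expect_le_expect fun π _ => hpt π)
    have hE : 𝔼 π : Fin B → Equiv.Perm (Fin n), (1 - 1 / (t * (1 + B)) * (1 + ∑ b, F (π b))) =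
        1 - 1 / (t * (1 + B)) * (1 + B * (4 / D ^ 2 *
          𝔼 σ : Equiv.Perm (Fin n), Dhat pX pY M (permuteData σ z) ^ 2)) := by
      rw [expect_sub_distrib, Fintype.expect_const, ← mul_expect, expect_add_distrib,
        Fintype.expect_const, expect_sum_comm, sum_congr rfl fun b _ => expect_pi_apply b F,
        mul_expect]
      simp [hFdef]
    rw [hE]
    have : 0 ≤ 4 / D ^ 2 * (Dhat pX pY M z - D) ^ 2 := by positivity
    linarith

/-- The combined test rejects whenever test `q` does, so moment bounds at one well-chosen level
suffice. -/
theorem le_lintegral_adaptiveTest {𝒳 𝒴 : Type*} [MeasurableSpace 𝒳] [MeasurableSpace 𝒴]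
    {dX dY n : ℕ} {pX : (Fin dX → ℕ) → 𝒳 → ℝ} {pY : (Fin dY → ℕ) → 𝒴 → ℝ}
    {B : Fin (numLevels dX n) × Fin (numLevels dY n) → ℕ} {Q : PMF (PermFamily B)}
    (hX : ∀ j, Measurable (pX j)) (hY : ∀ k, Measurable (pY k)) (hQ : HasUniformPerms Q)
    (P : Measure (𝒳 × 𝒴)) [IsProbabilityMeasure P] {α β D v w : ℝ} (q)
    (ht : 0 < α / ((numLevels dX n : ℝ) * (numLevels dY n : ℝ))) (hD : 0 < D)
    (iv : Integrable (fun z => (Dhat pX pY (truncation q) z - D) ^ 2)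
      (Measure.pi fun _ : Fin n => P))
    (hv : ∫ z, (Dhat pX pY (truncation q) z - D) ^ 2 ∂(Measure.pi fun _ : Fin n => P) ≤ v)
    (iw : Integrable (fun z => 𝔼 σ : Equiv.Perm (Fin n),
      Dhat pX pY (truncation q) (permuteData σ z) ^ 2) (Measure.pi fun _ : Fin n => P))
    (hw : ∫ z, 𝔼 σ : Equiv.Perm (Fin n), Dhat pX pY (truncation q) (permuteData σ z) ^ 2
      ∂(Measure.pi fun _ : Fin n => P) ≤ w)
    (hβ : 4 / D ^ 2 * v + 1 / (α / ((numLevels dX n : ℝ) * (numLevels dY n : ℝ)) * (1 + B q)) *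
      (1 + B q * (4 / D ^ 2 * w)) ≤ β) :
    ENNReal.ofReal (1 - β) ≤
      ∫⁻ z, adaptiveTest pX pY α B Q z ∂(Measure.pi fun _ : Fin n => P) := by
  set t := α / ((numLevels dX n : ℝ) * (numLevels dY n : ℝ)) with ht'
  set ν := Measure.pi fun _ : Fin n => P with hν
  let E : (Fin n → 𝒳 × 𝒴) → ℝ := fun z => 𝔼 π : Fin (B q) → Equiv.Perm (Fin n),
    (if pValue pX pY (truncation q) z π < t then (1 : ℝ) else 0)
  have hE0 : ∀ z, 0 ≤ E z := fun z => expect_nonneg fun π _ => by positivity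
  have hE1 : ∀ z, E z ≤ 1 := fun z => expect_le univ_nonempty fun π _ => by split_ifs <;> norm_num
  have hEm : Measurable E := by
    simp only [E, Fintype.expect_eq_sum_div_card]
    refine Measurable.div_const (Finset.measurable_sum _ fun π _ => ?_) _
    exact Measurable.ite (measurableSet_lt (measurable_pValue hX hY _ π) measurable_const)
      measurable_const measurable_const
  have hEI : Integrable E ν := Integrable.of_bound hEm.aestronglyMeasurable 1
    (ae_of_all _ fun z => by rw [Real.norm_of_nonneg (hE0 z)]; exact hE1 z)
  have hle : ∀ z, ENNReal.ofReal (E z) ≤ adaptiveTest pX pY α B Q z := fun z => by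
    rw [← toOuterMeasure_level hQ q fun π => pValue pX pY (truncation q) z π < t]
    exact measure_mono fun π hπ => ⟨q, hπ⟩
  refine le_trans ?_ (lintegral_mono hle)
  rw [← ofReal_integral_eq_lintegral_ofReal hEI (ae_of_all _ hE0)]
  refine ENNReal.ofReal_le_ofReal ?_
  have i1 : Integrable (fun z => 4 / D ^ 2 * (Dhat pX pY (truncation q) z - D) ^ 2) ν :=
    iv.const_mul _
  have i2 : Integrable (fun z => 4 / D ^ 2 * 𝔼 σ : Equiv.Perm (Fin n),
      Dhat pX pY (truncation q) (permuteData σ z) ^ 2) ν := iw.const_mul _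
  have i3 : Integrable (fun z => 1 + B q * (4 / D ^ 2 * 𝔼 σ : Equiv.Perm (Fin n),
      Dhat pX pY (truncation q) (permuteData σ z) ^ 2)) ν :=
    (integrable_const _).add (i2.const_mul _)
  have i4 : Integrable (fun z => 1 / (t * (1 + B q)) * (1 + B q * (4 / D ^ 2 *
      𝔼 σ : Equiv.Perm (Fin n), Dhat pX pY (truncation q) (permuteData σ z) ^ 2))) ν :=
    i3.const_mul _
  have h1 := integral_mono ((integrable_const (1 : ℝ)).sub (i1.add i4)) hEI fun z =>
    one_sub_le_expect_pValue pX pY (truncation q) z hD ht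
  refine le_trans ?_ h1
  simp only [Pi.sub_apply, Pi.add_apply]
  rw [integral_sub (integrable_const _) (by exact i1.add i4), integral_add i1 i4,
    integral_const_mul, integral_const_mul, integral_add (integrable_const _) (i2.const_mul _),
    integral_const_mul, integral_const_mul]
  simp only [integral_const, probReal_univ, smul_eq_mul, one_mul]
  have : 4 / D ^ 2 * (∫ z, (Dhat pX pY (truncation q) z - D) ^ 2 ∂ν) + 1 / (t * (1 + B q)) *
      (1 + B q * (4 / D ^ 2 * ∫ z, 𝔼 σ : Equiv.Perm (Fin n),
        Dhat pX pY (truncation q) (permuteData σ z) ^ 2 ∂ν)) ≤ β := by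
    refine le_trans ?_ hβ
    gcongr
  linarith

end Power

/-! ### The adaptive rate -/

section Rate

theorem one_le_log {n : ℕ} (hn : 4 ≤ n) : 1 ≤ Real.log n := by
  rw [Real.le_log_iff_exp_le (by positivity)]
  have h1 : (4 : ℝ) ≤ n := by exact_mod_cast hn
  linarith [Real.exp_one_lt_d9]

/-- Since log 2 > 2/3, the argument of the ceiling is at most 3 log n; the rounding error 1 is
absorbed by log n ≥ 1. -/
theorem numLevels_le {d n : ℕ} (hd : 1 ≤ d) (hn : 4 ≤ n) : (numLevels d n : ℝ) ≤ 4 * Real.log n := by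
  have hL := one_le_log hn
  have hd' : (1 : ℝ) ≤ d := by exact_mod_cast hd
  have h2 : Real.logb 2 n ≤ 3 / 2 * Real.log n := by
    rw [Real.logb, div_le_iff₀ (Real.log_pos one_lt_two)]
    nlinarith [Real.log_two_gt_d9]
  have hb : 0 ≤ Real.logb 2 n := by
    rw [Real.logb]; exact div_nonneg (by linarith) (Real.log_pos one_lt_two).le
  have h3 : 2 / (d : ℝ) ≤ 2 := by
    rw [div_le_iff₀ (by linarith)]; linarith
  have h4 := Nat.ceil_lt_add_one (a := (2 / (d : ℝ)) * Real.logb 2 n) (by positivity)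
  rw [numLevels]
  nlinarith

/-- The largest level is at least n^(2/d), so it satisfies the lower bound. The smallest level that
does so overshoots T^(1/s) by at most a factor 2, or equals 2 while T^(1/s) ≥ 1, which controls the
number of multi-indices. -/
theorem exists_level {d n : ℕ} (hd : 1 ≤ d) (hn : 4 ≤ n) {s T : ℝ} (hs : 0 < s) (hT : 1 ≤ T)
    (hTn : T ^ ((d : ℝ) / s) ≤ (n : ℝ) ^ 2) :
    ∃ l : Fin (numLevels d n), T ≤ ((2 ^ ((l : ℕ) + 1) : ℕ) : ℝ) ^ s ∧
      ((multiIndices d (2 ^ ((l : ℕ) + 1))).card : ℝ) ≤ 4 ^ d * T ^ ((d : ℝ) / s) := by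
  have hd0 : (0 : ℝ) < d := by exact_mod_cast hd
  have hn0 : (0 : ℝ) < n := by positivity
  have hT0 : 0 < T := by linarith
  have hγ := numLevels_pos (n := n) hd hn
  have hex : T ≤ ((2 ^ (numLevels d n - 1 + 1) : ℕ) : ℝ) ^ s := by
    rw [Nat.sub_add_cancel hγ]
    push_cast
    have h1 : (n : ℝ) ^ (2 / (d : ℝ)) ≤ 2 ^ numLevels d n := by
      have h2 : (n : ℝ) ^ (2 / (d : ℝ)) = 2 ^ ((2 / (d : ℝ)) * Real.logb 2 n) := by
        rw [mul_comm, Real.rpow_mul zero_le_two, Real.rpow_logb two_pos (by norm_num) hn0]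
      rw [h2, ← Real.rpow_natCast]
      exact Real.rpow_le_rpow_of_exponent_le one_le_two (Nat.le_ceil _)
    calc T = (T ^ ((d : ℝ) / s)) ^ (s / d) := by
          rw [← Real.rpow_mul hT0.le, div_mul_div_cancel₀ hs.ne', div_self hd0.ne', Real.rpow_one]
      _ ≤ ((n : ℝ) ^ 2) ^ (s / d) := by gcongr
      _ = ((n : ℝ) ^ (2 / (d : ℝ))) ^ s := by
          rw [← Real.rpow_natCast, ← Real.rpow_mul hn0.le, ← Real.rpow_mul hn0.le]
          congr 1
          push_cast
          ring
      _ ≤ _ := by gcongr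
  classical
  have hex' : ∃ l : ℕ, T ≤ ((2 ^ (l + 1) : ℕ) : ℝ) ^ s := ⟨_, hex⟩
  have hlt : Nat.find hex' < numLevels d n := by
    have := Nat.find_min' hex' hex
    omega
  refine ⟨⟨Nat.find hex', hlt⟩, Nat.find_spec hex', ?_⟩
  simp only
  set l := Nat.find hex' with hl
  have hl2 : (2 : ℝ) ^ l ≤ T ^ (1 / s) := by
    rcases Nat.eq_zero_or_pos l with h0 | h0
    · rw [h0, pow_zero]
      exact Real.one_le_rpow hT (by positivity)
    · have h1 := Nat.find_min hex' (m := l - 1) (by omega)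
      rw [Nat.sub_add_cancel h0] at h1
      push_cast at h1
      push Not at h1
      calc (2 : ℝ) ^ l = (((2 : ℝ) ^ l) ^ s) ^ (1 / s) := by
            rw [← Real.rpow_mul (by positivity), mul_one_div_cancel hs.ne', Real.rpow_one]
        _ ≤ T ^ (1 / s) := by gcongr
  have h3 : ((multiIndices d (2 ^ (l + 1))).card : ℝ) ≤ ((2 : ℝ) ^ (l + 1) + 1) ^ d := by
    exact_mod_cast card_multiIndices_le d (2 ^ (l + 1))
  have h4 : (1 : ℝ) ≤ 2 ^ l := one_le_pow₀ one_le_two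
  calc ((multiIndices d (2 ^ (l + 1))).card : ℝ) ≤ ((2 : ℝ) ^ (l + 1) + 1) ^ d := h3
    _ ≤ (4 * T ^ (1 / s)) ^ d := by
        gcongr
        rw [pow_succ]
        linarith
    _ = 4 ^ d * T ^ ((d : ℝ) / s) := by
        rw [mul_pow, ← Real.rpow_natCast (T ^ (1 / s)), ← Real.rpow_mul hT0.le]
        congr 2
        ring

/-- The exponent `d / s = dX / sX + dY / sY`. -/
noncomputable def rateExp (dX dY : ℕ) (sX sY : ℝ) : ℝ := (dX : ℝ) / sX + (dY : ℝ) / sY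

/-- With κ = d/s one has 4 + κ = (4s + d)/s, so this power clears the root in the rate and leaves
the exponents κ and 2. -/
theorem adaptiveRate_rpow {dX dY n : ℕ} (hdX : 1 ≤ dX) (hn : 4 ≤ n) {sX sY r : ℝ} (hsX : 0 < sX)
    (hsY : 0 < sY) (hr : 0 < r) :
    adaptiveRate dX dY sX sY r n ^ (4 + rateExp dX dY sX sY) =
      r ^ rateExp dX dY sX sY * (Real.log n / n) ^ 2 := by
  have hL : 0 < Real.log n := by linarith [one_le_log hn]
  have hn0 : (0 : ℝ) < n := by positivity
  have hdX0 : (0 : ℝ) < dX := by exact_mod_cast hdX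
  have hκ : 0 < rateExp dX dY sX sY := by rw [rateExp]; positivity
  set κ := rateExp dX dY sX sY with hκ'
  have hs : effSmoothness dX dY sX sY = ((dX : ℝ) + dY) / κ := rfl
  have hd : 0 < (dX : ℝ) + dY := by positivity
  rw [adaptiveRate, hs, ← Real.rpow_mul (by positivity)]
  have he : 1 / (4 * (((dX : ℝ) + dY) / κ) + ((dX : ℝ) + dY)) * (4 + κ) = κ / ((dX : ℝ) + dY) := by
    field_simp
  rw [he, Real.div_rpow (by positivity) (by positivity), ← Real.rpow_natCast, ← Real.rpow_mul hr.le,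
    ← Real.rpow_mul (by positivity)]
  have e1 : ((dX + dY : ℕ) : ℝ) * (κ / ((dX : ℝ) + dY)) = κ := by
    push_cast; field_simp
  have e2 : 2 * (((dX : ℝ) + dY) / κ) * (κ / ((dX : ℝ) + dY)) = 2 := by field_simp
  rw [e1, e2, Real.rpow_two]
  field_simp

theorem rate_condition {dX dY n : ℕ} (hdX : 1 ≤ dX) (hn : 4 ≤ n) {sX sY r ρ C : ℝ} (hsX : 0 < sX)
    (hsY : 0 < sY) (hr : 0 < r) (hC : 1 ≤ C) (h : C * adaptiveRate dX dY sX sY r n ≤ ρ) :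
    C ^ 4 * (r ^ rateExp dX dY sX sY * (Real.log n / n) ^ 2) ≤
      ρ ^ 4 * ρ ^ rateExp dX dY sX sY := by
  have hκ : 0 < rateExp dX dY sX sY := by
    rw [rateExp]
    have : (0 : ℝ) < dX := by exact_mod_cast hdX
    positivity
  have hL : 0 < Real.log n := by linarith [one_le_log hn]
  have ha : 0 < adaptiveRate dX dY sX sY r n := by
    have hn0 : (0 : ℝ) < n := by positivity
    rw [adaptiveRate]; positivity
  have hC0 : 0 < C := by linarith
  have hρ : 0 < ρ := lt_of_lt_of_le (by positivity) h
  set κ := rateExp dX dY sX sY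
  calc C ^ 4 * (r ^ κ * (Real.log n / n) ^ 2)
      ≤ C ^ (4 + κ) * adaptiveRate dX dY sX sY r n ^ (4 + κ) := by
        rw [adaptiveRate_rpow hdX hn hsX hsY hr]
        gcongr
        rw [← Real.rpow_natCast]
        exact Real.rpow_le_rpow_of_exponent_le hC (by push_cast; linarith)
    _ = (C * adaptiveRate dX dY sX sY r n) ^ (4 + κ) := (Real.mul_rpow hC0.le ha.le).symm
    _ ≤ ρ ^ (4 + κ) := by gcongr
    _ = ρ ^ 4 * ρ ^ κ := by
        rw [Real.rpow_add hρ, ← Real.rpow_natCast]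
        norm_num

end Rate
end USP

namespace USP

/-! ### Error budget, choice of the truncation level, and power of the adaptive test -/

section Adaptivity

open scoped BigOperators

/-- The β of allowed error is split in two: 4β/7 pays for the 1 in the numerator of the p-value,
that is, for using finitely many permutations, and 3β/7 for the variance and permutation moments,
all of which are O(1/C). -/
theorem error_budget {n m L N D ρ C K A α β γ B : ℝ} (hn : 0 < n) (hm : n / 8 ≤ m) (hL : 1 ≤ L)
    (hN : 0 ≤ N) (hρ : 0 < ρ) (hD : ρ ^ 2 / 2 ≤ D) (hC : 1 ≤ C) (hK : 0 ≤ K)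
    (hα : 0 < α) (hβ : 0 < β) (hαβ : α + β < 1) (hγ1 : 1 ≤ γ) (hγ : γ ≤ 16 * L ^ 2)
    (hB : 2 * (γ / (α * β) - 1) ≤ B) (hB0 : 0 ≤ B)
    (hJ : C ^ 4 * (N * (L / n) ^ 2) ≤ K * ρ ^ 4) (hρC : C ^ 4 * (L / n) ^ 2 ≤ ρ ^ 4)
    (hCZ : 7 / (3 * β) * (1536 * A ^ 2 + 786432 * A ^ 4 * K + 262144 * A ^ 4 * K / α) ≤ C) :
    4 / D ^ 2 * (24 * A ^ 2 * D / m + 768 * A ^ 4 * N / m ^ 2) +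
      1 / (α / γ * (1 + B)) * (1 + B * (4 / D ^ 2 * (16 * A ^ 4 * N / m ^ 2))) ≤ β := by
  have hC0 : 0 < C := by linarith
  have hm0 : 0 < m := lt_of_lt_of_le (by positivity) hm
  have hD0 : 0 < D := lt_of_lt_of_le (by positivity) hD
  have hγ0 : 0 < γ := by linarith
  have hDm : ρ ^ 2 * n / 16 ≤ D * m := by
    calc ρ ^ 2 * n / 16 = ρ ^ 2 / 2 * (n / 8) := by ring
      _ ≤ D * m := by gcongr
  have hρ2 : C ^ 2 ≤ ρ ^ 2 * n := by
    have h1 : C ^ 2 * (L / n) ≤ ρ ^ 2 := by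
      refine abs_le_of_sq_le_sq' ?_ (by positivity) |>.2
      calc (C ^ 2 * (L / n)) ^ 2 = C ^ 4 * (L / n) ^ 2 := by ring
        _ ≤ ρ ^ 4 := hρC
        _ = (ρ ^ 2) ^ 2 := by ring
    calc C ^ 2 ≤ C ^ 2 * L := le_mul_of_one_le_right (by positivity) hL
      _ = C ^ 2 * (L / n) * n := by field_simp
      _ ≤ ρ ^ 2 * n := by gcongr
  have hCC2 : C ≤ C ^ 2 := by nlinarith
  have hCC4 : C ≤ C ^ 4 := le_self_pow₀ hC (by norm_num)
  have hX : 1 / (D * m) ≤ 16 / C := by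
    rw [div_le_div_iff₀ (by positivity) hC0]
    linarith
  have hDm2 : (ρ ^ 2 * n / 16) ^ 2 ≤ (D * m) ^ 2 := by gcongr
  have hY : N * L ^ 2 / (D * m) ^ 2 ≤ 256 * K / C := by
    rw [div_le_div_iff₀ (by positivity) hC0]
    have h2 : C * (N * L ^ 2) ≤ K * ρ ^ 4 * n ^ 2 := by
      calc C * (N * L ^ 2) ≤ C ^ 4 * (N * L ^ 2) := by gcongr
        _ = C ^ 4 * (N * (L / n) ^ 2) * n ^ 2 := by field_simp
        _ ≤ K * ρ ^ 4 * n ^ 2 := by gcongr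
    calc N * L ^ 2 * C = C * (N * L ^ 2) := by ring
      _ ≤ K * ρ ^ 4 * n ^ 2 := h2
      _ = 256 * K * (ρ ^ 2 * n / 16) ^ 2 := by ring
      _ ≤ 256 * K * (D * m) ^ 2 := by gcongr
  have hY' : N / (D * m) ^ 2 ≤ 256 * K / C := by
    refine le_trans ?_ hY
    gcongr
    exact le_mul_of_one_le_right hN (one_le_pow₀ hL)
  have t1 : 4 / D ^ 2 * (24 * A ^ 2 * D / m + 768 * A ^ 4 * N / m ^ 2) ≤
      1536 * A ^ 2 / C + 786432 * A ^ 4 * K / C := by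
    calc 4 / D ^ 2 * (24 * A ^ 2 * D / m + 768 * A ^ 4 * N / m ^ 2)
        = 96 * A ^ 2 * (1 / (D * m)) + 3072 * A ^ 4 * (N / (D * m) ^ 2) := by
          field_simp; ring
      _ ≤ 96 * A ^ 2 * (16 / C) + 3072 * A ^ 4 * (256 * K / C) := by gcongr
      _ = _ := by ring
  -- The lower bound on `B` gives 2/β - α/γ in the denominator; α/γ ≤ α ≤ 1/(4β), from αβ ≤ 1/4,
  -- leaves at least 7/(4β).
  have t2 : 1 / (α / γ * (1 + B)) ≤ 4 * β / 7 := by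
    have hαβ4 : α * β ≤ 1 / 4 := by nlinarith [sq_nonneg (α - β)]
    have h1 : α / γ * (1 + 2 * (γ / (α * β) - 1)) ≤ α / γ * (1 + B) := by gcongr
    have h2 : α / γ * (1 + 2 * (γ / (α * β) - 1)) = 2 / β - α / γ := by
      field_simp; ring
    have h3 : α / γ ≤ α := div_le_self hα.le hγ1
    have h4 : α ≤ 1 / (4 * β) := by
      rw [le_div_iff₀ (by positivity)]; linarith
    have h5 : 2 / β - 1 / (4 * β) = 7 / (4 * β) := by field_simp; norm_num
    have h6 : 7 / (4 * β) ≤ α / γ * (1 + B) := by linarith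
    calc 1 / (α / γ * (1 + B)) ≤ 1 / (7 / (4 * β)) := by gcongr
      _ = 4 * β / 7 := by field_simp
  -- The number of permutations cancels through B/(1 + B) ≤ 1, and γ ≤ 16 L² is the price of the
  -- Bonferroni correction. Only here is the bound on N L² needed, rather than on N.
  have t3 : 1 / (α / γ * (1 + B)) * (B * (4 / D ^ 2 * (16 * A ^ 4 * N / m ^ 2))) ≤
      262144 * A ^ 4 * K / α / C := by
    calc 1 / (α / γ * (1 + B)) * (B * (4 / D ^ 2 * (16 * A ^ 4 * N / m ^ 2)))
        = (B / (1 + B)) * (γ * (64 * A ^ 4 / α * (N / (D * m) ^ 2))) := by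
          field_simp; ring
      _ ≤ 1 * (16 * L ^ 2 * (64 * A ^ 4 / α * (N / (D * m) ^ 2))) := by
          gcongr
          rw [div_le_one (by positivity)]; linarith
      _ = 1024 * A ^ 4 / α * (N * L ^ 2 / (D * m) ^ 2) := by ring
      _ ≤ 1024 * A ^ 4 / α * (256 * K / C) := by gcongr
      _ = _ := by ring
  have t4 : 1536 * A ^ 2 / C + 786432 * A ^ 4 * K / C + 262144 * A ^ 4 * K / α / C ≤
      3 * β / 7 := by
    rw [← add_div, ← add_div, div_le_iff₀ hC0]
    calc 1536 * A ^ 2 + 786432 * A ^ 4 * K + 262144 * A ^ 4 * K / α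
        = 3 * β / 7 * (7 / (3 * β) *
          (1536 * A ^ 2 + 786432 * A ^ 4 * K + 262144 * A ^ 4 * K / α)) := by
          field_simp
      _ ≤ 3 * β / 7 * C := by gcongr
  rw [mul_add (1 / (α / γ * (1 + B))), mul_one]
  linarith

/-- The constant of the power statement. -/
noncomputable def powerConst (dX dY : ℕ) (sX sY A R₀ α β : ℝ) : ℝ :=
  1 + 7 / (3 * β) * (1536 * (max A 1) ^ 2 +
      786432 * (max A 1) ^ 4 * (4 ^ (dX + dY) * √2 ^ rateExp dX dY sX sY) +
      262144 * (max A 1) ^ 4 * (4 ^ (dX + dY) * √2 ^ rateExp dX dY sX sY) / α) +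
    √2 ^ rateExp dX dY sX sY * R₀ ^ 4

set_option maxHeartbeats 1000000 in
theorem le_lintegral_adaptiveTest_of_mem_alternatives {𝒳 𝒴 : Type*} [MeasurableSpace 𝒳]
    [MeasurableSpace 𝒴] {μX : Measure 𝒳} {μY : Measure 𝒴} [SigmaFinite μX] [SigmaFinite μY]
    {dX dY n : ℕ} (hdX : 1 ≤ dX) (hdY : 1 ≤ dY) {sX sY A R₀ α β : ℝ} (hsX : 0 < sX) (hsY : 0 < sY)
    (hA : 0 < A) (hR₀ : 0 < R₀) (hα : 0 < α) (hβ : 0 < β) (hαβ : α + β < 1)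
    {pX : (Fin dX → ℕ) → 𝒳 → ℝ} {pY : (Fin dY → ℕ) → 𝒴 → ℝ} (hX : IsL2Basis μX pX)
    (hY : IsL2Basis μY pY) (hn : 4 ≤ n) {B : Fin (numLevels dX n) × Fin (numLevels dY n) → ℕ}
    {Q : PMF (PermFamily B)}
    (hB : ∀ q, 2 * ((numLevels dX n : ℝ) * (numLevels dY n : ℝ) / (α * β) - 1) ≤ B q)
    (hQ : HasUniformPerms Q) {r ρ : ℝ} (hr : 0 < r) (hrR : r ≤ R₀) (hρ : 0 < ρ)
    (hrate : powerConst dX dY sX sY A R₀ α β * adaptiveRate dX dY sX sY r n ≤ ρ)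
    {f : 𝒳 × 𝒴 → ℝ}
    (hf : f ∈ alternatives μX μY pX pY (sobolevWeight sX sY) r A ρ) :
    ENNReal.ofReal (1 - β) ≤
      ∫⁻ z, adaptiveTest pX pY α B Q z ∂(Measure.pi fun _ : Fin n => law μX μY f) := by
  obtain ⟨hfd, hdep, hsm, h1, h2, h3⟩ := hf
  have hdom := hfd.isDominated hA h1 h2 h3
  have := hdom.prob
  set κ := rateExp dX dY sX sY with hκdef
  set C := powerConst dX dY sX sY A R₀ α β with hCdef
  set K : ℝ := 4 ^ (dX + dY) * √2 ^ κ with hK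
  set L := Real.log n with hLdef
  set c := covCoeff pX pY (law μX μY f) with hc
  have hdX0 : (0 : ℝ) < dX := by exact_mod_cast hdX
  have hdY0 : (0 : ℝ) < dY := by exact_mod_cast hdY
  have hκ : 0 < κ := by rw [hκdef, rateExp]; positivity
  have hL : 1 ≤ L := one_le_log hn
  have hn0 : (0 : ℝ) < n := by positivity
  have hK0 : 0 ≤ K := by positivity
  have hZ0 : 0 ≤ 7 / (3 * β) * (1536 * (max A 1) ^ 2 + 786432 * (max A 1) ^ 4 * K +
      262144 * (max A 1) ^ 4 * K / α) := by positivity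
  have hR0 : 0 ≤ √2 ^ κ * R₀ ^ 4 := by positivity
  have hCeq : C = 1 + 7 / (3 * β) * (1536 * (max A 1) ^ 2 + 786432 * (max A 1) ^ 4 * K +
      262144 * (max A 1) ^ 4 * K / α) + √2 ^ κ * R₀ ^ 4 := rfl
  have hC1 : 1 ≤ C := by linarith
  have hC4 : C ≤ C ^ 4 := le_self_pow₀ hC1 (by norm_num)
  -- Parseval and smoothness
  have hpars : ∑' q, ENNReal.ofReal (c q ^ 2) = ENNReal.ofReal (dep μX μY f) :=
    tsum_covCoeff_sq hX hY hfd hA h1 h2 h3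
  have hsm' : ∑' q : (Fin dX → ℕ) × (Fin dY → ℕ),
      sobolevWeight sX sY q.1 q.2 ^ 2 * ENNReal.ofReal (c q ^ 2) ≤ ENNReal.ofReal (r ^ 2) := by
    refine le_of_eq_of_le ?_ hsm
    rw [smoothness, ← ENNReal.tsum_prod (f := fun j k => sobolevWeight sX sY j k ^ 2 *
      ENNReal.ofReal ((coeff μX μY pX pY f j k - coeffX μX μY pX f j * coeffY μX μY pY f k) ^ 2))]
    exact tsum_congr fun q => by rw [covCoeff_law_eq hX hY hfd hdom]
  -- All weights are at least 1, so the dependence is at most r²; this makes `T` at least 1.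
  have hρr : ρ ≤ r := by
    have h4 := hdep.trans (le_of_smoothness_le hsX c hpars hsm')
    exact abs_le_of_sq_le_sq' h4 hr.le |>.2
  -- the rate condition
  have hrc := rate_condition hdX hn hsX hsY hr hC1 hrate
  rw [← hκdef, ← hLdef] at hrc
  -- The factor √2 makes the discarded tail r²/T² exactly half of ρ².
  set T : ℝ := √2 * r / ρ with hT
  have hsqrt2 : 1 ≤ √2 := Real.one_le_sqrt.2 one_le_two
  have hT1 : 1 ≤ T := by
    rw [hT, le_div_iff₀ hρ]
    nlinarith
  have hT0 : 0 < T := by linarith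
  have hTκ : T ^ κ = √2 ^ κ * (r ^ κ / ρ ^ κ) := by
    rw [hT, mul_div_assoc, Real.mul_rpow (by positivity) (by positivity),
      Real.div_rpow hr.le hρ.le]
  have hratio : C ^ 4 * (r ^ κ / ρ ^ κ * (L / n) ^ 2) ≤ ρ ^ 4 := by
    have h5 : 0 < ρ ^ κ := by positivity
    calc C ^ 4 * (r ^ κ / ρ ^ κ * (L / n) ^ 2) = C ^ 4 * (r ^ κ * (L / n) ^ 2) / ρ ^ κ := by ring
      _ ≤ ρ ^ 4 * ρ ^ κ / ρ ^ κ := by gcongr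
      _ = ρ ^ 4 := by field_simp
  have hratio1 : 1 ≤ r ^ κ / ρ ^ κ := by
    rw [one_le_div (by positivity)]
    gcongr
  -- The grid must reach the truncation level required by `T`. The summand √2^κ R₀⁴ of the constant,
  -- together with ρ ≤ r ≤ R₀, ensures this.
  have hTn : T ^ κ ≤ (n : ℝ) ^ 2 := by
    have h6 : √2 ^ κ * R₀ ^ 4 ≤ C ^ 4 := by linarith
    have h7 : C ^ 4 * (r ^ κ / ρ ^ κ) ≤ R₀ ^ 4 * n ^ 2 := by
      calc C ^ 4 * (r ^ κ / ρ ^ κ) ≤ C ^ 4 * (r ^ κ / ρ ^ κ) * L ^ 2 :=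
            le_mul_of_one_le_right (by positivity) (one_le_pow₀ hL)
        _ = C ^ 4 * (r ^ κ / ρ ^ κ * (L / n) ^ 2) * n ^ 2 := by field_simp
        _ ≤ ρ ^ 4 * n ^ 2 := by gcongr
        _ ≤ R₀ ^ 4 * n ^ 2 := by gcongr; linarith
    have h8 : R₀ ^ 4 * T ^ κ ≤ R₀ ^ 4 * n ^ 2 := by
      calc R₀ ^ 4 * T ^ κ = (√2 ^ κ * R₀ ^ 4) * (r ^ κ / ρ ^ κ) := by rw [hTκ]; ring
        _ ≤ C ^ 4 * (r ^ κ / ρ ^ κ) := by gcongr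
        _ ≤ R₀ ^ 4 * n ^ 2 := h7
    exact le_of_mul_le_mul_left h8 (by positivity)
  -- the truncation levels
  obtain ⟨lX, hlX, hcX⟩ := exists_level hdX hn hsX hT1
    ((Real.rpow_le_rpow_of_exponent_le hT1 (by
      rw [hκdef, rateExp]; linarith [div_pos hdY0 hsY])).trans hTn)
  obtain ⟨lY, hlY, hcY⟩ := exists_level hdY hn hsY hT1
    ((Real.rpow_le_rpow_of_exponent_le hT1 (by
      rw [hκdef, rateExp]; linarith [div_pos hdX0 hsX])).trans hTn)
  set S := multiIndices dX (2 ^ ((lX : ℕ) + 1)) with hS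
  set U := multiIndices dY (2 ^ ((lY : ℕ) + 1)) with hU
  set D : ℝ := ∑ q ∈ S ×ˢ U, c q ^ 2 with hD
  -- The same `T` serves both coordinates, so the two exponents add up to κ = d/s.
  have hN : ((S ×ˢ U).card : ℝ) ≤ 4 ^ (dX + dY) * T ^ κ := by
    rw [Finset.card_product, Nat.cast_mul]
    calc (S.card : ℝ) * U.card ≤ (4 ^ dX * T ^ ((dX : ℝ) / sX)) * (4 ^ dY * T ^ ((dY : ℝ) / sY)) := by
          gcongr
      _ = 4 ^ (dX + dY) * T ^ κ := by
          rw [hκdef, rateExp, Real.rpow_add hT0, pow_add]; ring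
  have hDρ : ρ ^ 2 / 2 ≤ D := by
    have h9 := sum_truncation_ge hsX hsY hT0 hlX hlY hr c hpars hsm'
    have h10 : r ^ 2 / T ^ 2 = ρ ^ 2 / 2 := by
      rw [hT, div_pow, mul_pow, Real.sq_sqrt zero_le_two]
      field_simp
    rw [h10] at h9
    linarith
  -- block sizes and moments
  have hm : 0 < n / 4 := by omega
  have hmn : 4 * (n / 4) ≤ n := by omega
  have hm8 : (n : ℝ) / 8 ≤ ((n / 4 : ℕ) : ℝ) := by
    rw [div_le_iff₀ (by norm_num)]
    exact_mod_cast (by omega : n ≤ n / 4 * 8)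
  have hv := hdom.integral_sq_Dhat_sub_le hX hY S U hm hmn
  have hw := hdom.integral_expect_sq_Dhat_permuteData_le hX hY S U hm hmn
  rw [coe_boundOf] at hv hw
  have hγX : (1 : ℝ) ≤ numLevels dX n := by exact_mod_cast numLevels_pos hdX hn
  have hγY : (1 : ℝ) ≤ numLevels dY n := by exact_mod_cast numLevels_pos hdY hn
  have hγX' := numLevels_le hdX hn
  have hγY' := numLevels_le hdY hn
  rw [← hLdef] at hγX' hγY'
  refine le_lintegral_adaptiveTest hX.measurable hY.measurable hQ _ (D := D) (lX, lY)
    (by positivity) (lt_of_lt_of_le (by positivity) hDρ) hv.1 hv.2 hw.1 hw.2 ?_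
  refine error_budget hn0 hm8 hL (by positivity) hρ hDρ hC1 hK0 hα hβ hαβ (by nlinarith)
    ?_ (hB _) (by positivity) ?_ ?_ (by linarith)
  · calc (numLevels dX n : ℝ) * numLevels dY n ≤ (4 * L) * (4 * L) := by gcongr
      _ = 16 * L ^ 2 := by ring
  · calc C ^ 4 * (((S ×ˢ U).card : ℝ) * (L / n) ^ 2)
        ≤ C ^ 4 * ((4 ^ (dX + dY) * T ^ κ) * (L / n) ^ 2) := by gcongr
      _ = K * (C ^ 4 * (r ^ κ / ρ ^ κ * (L / n) ^ 2)) := by rw [hTκ, hK]; ring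
      _ ≤ K * ρ ^ 4 := by gcongr
  · refine le_trans ?_ hratio
    gcongr
    exact le_mul_of_one_le_left (by positivity) hratio1

end Adaptivity
end USP

theorem mainTheorem11 (dX dY : ℕ) (hdX : 1 ≤ dX) (hdY : 1 ≤ dY)
    (sX sY A R₀ α β : ℝ) (hsX : 0 < sX) (hsY : 0 < sY) (hA : 0 < A) (hR₀ : 0 < R₀)
    (hα : 0 < α) (hβ : 0 < β) (hαβ : α + β < 1) :
    ∃ C : ℝ, 0 < C ∧
      ∀ (𝒳 : Type*) (𝒴 : Type*) [MeasurableSpace 𝒳] [MeasurableSpace 𝒴]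
        (μX : Measure 𝒳) (μY : Measure 𝒴) [SigmaFinite μX] [SigmaFinite μY]
        (pX : (Fin dX → ℕ) → 𝒳 → ℝ) (pY : (Fin dY → ℕ) → 𝒴 → ℝ),
        USP.IsL2Basis μX pX → USP.IsL2Basis μY pY →
      ∀ n : ℕ, 4 ≤ n →
      ∀ (B : Fin (USP.numLevels dX n) × Fin (USP.numLevels dY n) → ℕ)
        (Q : PMF (USP.PermFamily B)),
        (∀ q, 2 * ((USP.numLevels dX n : ℝ) * (USP.numLevels dY n : ℝ) / (α * β) - 1) ≤ B q) →
        USP.HasUniformPerms Q →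
        USP.IsValidTest α (USP.adaptiveTest pX pY α B Q) ∧
        (C ≤ (n : ℝ) →
          ∀ r ρ : ℝ, 0 < r → r ≤ R₀ → 0 < ρ → C * USP.adaptiveRate dX dY sX sY r n ≤ ρ →
          ∀ f ∈ USP.alternatives μX μY pX pY (USP.sobolevWeight sX sY) r A ρ,
            ENNReal.ofReal (1 - β) ≤
              ∫⁻ z, USP.adaptiveTest pX pY α B Q z
                ∂(Measure.pi fun _ : Fin n => USP.law μX μY f)) := by
  refine ⟨USP.powerConst dX dY sX sY A R₀ α β, ?_, ?_⟩
  · rw [USP.powerConst]; positivity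
  intro 𝒳 𝒴 _ _ μX μY _ _ pX pY hX hY n hn B Q hB hQ
  refine ⟨USP.isValidTest_adaptiveTest hdX hdY hn hα hX.measurable hY.measurable hQ, ?_⟩
  intro _ r ρ hr hrR hρ hrate f hf
  exact USP.le_lintegral_adaptiveTest_of_mem_alternatives hdX hdY hsX hsY hA hR₀ hα hβ hαβ hX hY hn
    hB hQ hr hrR hρ hrate hf
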